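/- **Setting.** Let $H_d$ be a real Hilbert space of dimension $d<\infty$ with orthonormal basis $\mathbf e_1,\dots,\mathbf e_d$, and $H_\infty$ a real separable infinite-dimensional Hilbert space with orthonormal basis $(\mathbf f_m)_{m\in\mathbb N}$. Let $Q$ be a bounded linear operator on $H_\infty$ with $Q\mathbf f_m=q_m\mathbf f_m$, $q_m\ge 0$, $\sum_m q_m<\infty$, and let $T\ge 0$. Let $A^1_1:H_d\to H_d$, $A^1_2:H_\infty\to H_d$, $A^2_1:H_d\to H_\infty$ be bounded linear operators, let $B^1_{11}:H_d\times H_d\to H_d$, $B^1_{12}:H_d\times H_\infty\to H_d$, $B^1_{22}:H_\infty\times H_\infty\to H_d$, $B^2_{11}:H_d\times H_d\to H_\infty$ be continuous bilinear maps, let $F^1:[0,T]\to H_d$ be continuous, and let $x_0\in H_d$. Assume * (C1) $A^2_1=(A^1_2)^*$; * (C2) $\langle B^1_{11}(x',x),x\rangle_{H_d}=0$ for all $x,x'\in H_d$; * (C3) $\langle B^1_{12}(x',y),x\rangle_{H_d}=-\langle B^2_{11}(x',x),y\rangle_{H_\infty}$ for all $x,x'\in H_d$, $y\in H_\infty$.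 Define $C:H_d\to H_d$ and $b_{\ell,m}\in H_d$ by $$\langle C(x),\mathbf e_i\rangle=\frac12\sum_{m\in\mathbb N}q_m\sum_{j=1}^d\langle B^1_{12}(\mathbf e_j,\mathbf f_m),\mathbf e_i\rangle\langle B^1_{12}(x,\mathbf f_m),\mathbf e_j\rangle,\qquad \langle b_{\ell,m},\mathbf e_i\rangle=\langle B^1_{22}(\mathbf f_\ell,\mathbf f_m),\mathbf e_i\rangle\sqrt{\frac{q_\ell q_m}{2}}.$$ Let $(\Omega,\mathcal F,(\mathcal F_t)_{t\ge 0},\mathbb P)$ be a filtered probability space such that $\mathcal F_0$ contains all $\mathbb P$-null sets. Let $W$ be a $Q$-Wiener process in $H_\infty$ and let $(\bar W^{\ell,m})_{\ell,m\in\mathbb N}$ be independent one-dimensional standard Wiener processes, independent of $W$; all of them are adapted to $(\mathcal F_t)$, and their increments after any time $s$ are jointly independent of $\mathcal F_s$. A *solution on $[0,T]$* is an $(\mathcal F_t)$-adapted process $\bar X=(\bar X_t)_{t\in[0,T]}$ in $H_d$ with almost surely continuous paths such that, almost surely, for all $t\in[0,T]$, $$\begin{aligned}\bar X_t={}&x_0+\int_0^t\big(F^1_s+A^1_1\bar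 X_s+B^1_{11}(\bar X_s,\bar X_s)\big)ds+\int_0^tA^1_2\big(A^2_1\bar X_s+B^2_{11}(\bar X_s,\bar X_s)\big)ds\\&+\int_0^tB^1_{12}\big(\bar X_s,A^2_1\bar X_s+B^2_{11}(\bar X_s,\bar X_s)\big)ds+\int_0^tC(\bar X_s)\,ds\\&+A^1_2W_t+\int_0^tB^1_{12}(\bar X_s,dW_s)+\sum_{\ell,m\in\mathbb N}b_{\ell,m}\bar W^{\ell,m}_t,\end{aligned}$$ where the stochastic integral is an Itô integral and the series converges in mean square. **Proposition 5.1.** Under (C1)–(C3), this equation has a unique global strong solution on $[0,T]$. That is, there is a solution $\bar X$ on $[0,T]$ such that, for every $t\in[0,T]$, $\bar X_t$ is measurable with respect to the $\mathbb P$-completion of the $\sigma$-algebra generated by $W_s$ and $\bar W^{\ell,m}_s$, $s\le t$, $\ell,m\in\mathbb N$; and any two solutions $X,Y$ on $[0,T]$ satisfy, almost surely, $X_t=Y_t$ for all $t\in[0,T]$. -/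

import Mathlib

open MeasureTheory ProbabilityTheory Filter Topology
open scoped NNReal ENNReal RealInnerProductSpace

namespace Climate

noncomputable section

/-! ### Wiener processes relative to a filtration -/

section Noise

variable {Hi Ω : Type*} [NormedAddCommGroup Hi] [InnerProductSpace ℝ Hi]
  [MeasurableSpace Hi] {mΩ : MeasurableSpace Ω}

/-- `W` is a `Q`-Wiener process in the Hilbert space `Hi`, relative to the filtration `F`:
it starts at `0`, has continuous paths, is adapted, and its increments `W t - W s` are independent
of `F s` and centred Gaussian with covariance operator `(t - s) Q`, that is, every projection
`⟪h, W t - W s⟫` is centred Gaussian with variance `(t - s) ⟪Q h, h⟫`. -/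
structure IsQWiener (F : Filtration ℝ≥0 mΩ) (P : Measure Ω) (Q : Hi →L[ℝ] Hi)
    (W : ℝ≥0 → Ω → Hi) : Prop where
  zero : ∀ᵐ ω ∂P, W 0 ω = 0
  cont : ∀ᵐ ω ∂P, Continuous fun t => W t ω
  adapted : ∀ t, StronglyMeasurable[F t] (W t)
  gaussian : ∀ s t : ℝ≥0, s ≤ t → ∀ h : Hi,
    HasLaw (fun ω => ⟪h, W t ω - W s ω⟫)
      (gaussianReal 0 (Real.toNNReal (((t : ℝ) - s) * ⟪Q h, h⟫))) P
  indep : ∀ s t : ℝ≥0, s ≤ t →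
    Indep (MeasurableSpace.comap (fun ω => W t ω - W s ω) inferInstance) (F s) P

/-- The driving noise: `W` is a `Q`-Wiener process, `Wb (ℓ, m)`, `ℓ, m ∈ ℕ`, is a family of
independent one-dimensional standard Wiener processes, independent of `W`, and all of them together
form a Wiener process relative to `F`. -/
structure IsNoise (F : Filtration ℝ≥0 mΩ) (P : Measure Ω) (Q : Hi →L[ℝ] Hi)
    (W : ℝ≥0 → Ω → Hi) (Wb : ℕ × ℕ → ℝ≥0 → Ω → ℝ) : Prop where
  wiener : IsQWiener F P Q W
  brownian : ∀ i, IsBrownianReal (Wb i) P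
  adapted : ∀ i t, StronglyMeasurable[F t] (Wb i t)
  /-- the processes `Wb i` are mutually independent -/
  indep_family : iIndepFun (fun i ω t => Wb i t ω) P
  /-- the process `W` is independent of the whole family `Wb` -/
  indep_wiener : IndepFun (fun ω t => W t ω) (fun ω i t => Wb i t ω) P
  /-- the increments over `[s, t]` of all the processes are jointly independent of `F s` -/
  indep_past : ∀ s t : ℝ≥0, s ≤ t →
    Indep (MeasurableSpace.comap
      (fun ω => (W t ω - W s ω, fun i => Wb i t ω - Wb i s ω)) inferInstance) (F s) P

/-- The σ-algebra generated by the noise `W`, `Wb` up to time `t`. -/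
@[reducible]
def noiseSigma (W : ℝ≥0 → Ω → Hi) (Wb : ℕ × ℕ → ℝ≥0 → Ω → ℝ) (t : ℝ≥0) : MeasurableSpace Ω :=
  ⨆ s ∈ Set.Iic t, (MeasurableSpace.comap (W s) inferInstance ⊔
    ⨆ i, MeasurableSpace.comap (Wb i s) inferInstance)

end Noise

/-! ### The Itô integral of operator-valued integrands -/

section Ito

variable {Hd Hi Ω : Type*} [NormedAddCommGroup Hd] [InnerProductSpace ℝ Hd]
  [NormedAddCommGroup Hi] [InnerProductSpace ℝ Hi] {mΩ : MeasurableSpace Ω}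

/-- Simple integrands: bounded `Φ i`, known at time `τ i`, is used on `(τ i, τ (i + 1)]`,
for `i < n`. -/
structure SimpleIntegrand (F : Filtration ℝ≥0 mΩ) (Hi Hd : Type*)
    [NormedAddCommGroup Hd] [InnerProductSpace ℝ Hd]
    [NormedAddCommGroup Hi] [InnerProductSpace ℝ Hi] where
  n : ℕ
  τ : ℕ → ℝ≥0
  Φ : ℕ → Ω → Hi →L[ℝ] Hd
  mono : Monotone τ
  meas : ∀ i, StronglyMeasurable[F (τ i)] (Φ i)
  bdd : ∃ K : ℝ, ∀ i ω, ‖Φ i ω‖ ≤ K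

/-- A simple integrand as an operator-valued process. -/
def SimpleIntegrand.process {F : Filtration ℝ≥0 mΩ} (S : SimpleIntegrand F Hi Hd)
    (s : ℝ≥0) (ω : Ω) : Hi →L[ℝ] Hd :=
  ∑ i ∈ Finset.range S.n, (Set.Ioc (S.τ i) (S.τ (i + 1))).indicator (fun _ => S.Φ i ω) s

/-- The elementary stochastic integral `∫₀ᵗ S dW` of a simple integrand. -/
def SimpleIntegrand.integral {F : Filtration ℝ≥0 mΩ} (S : SimpleIntegrand F Hi Hd)
    (W : ℝ≥0 → Ω → Hi) (t : ℝ≥0) (ω : Ω) : Hd :=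
  ∑ i ∈ Finset.range S.n, S.Φ i ω (W (min (S.τ (i + 1)) t) ω - W (min (S.τ i) t) ω)

/-- The squared Hilbert–Schmidt norm of `Φ Q^(1/2)`, where `Q` is diagonal in the orthonormal
basis `f` with eigenvalues `q`. -/
def hsNormSq (f : HilbertBasis ℕ ℝ Hi) (q : ℕ → ℝ) (Φ : Hi →L[ℝ] Hd) : ℝ≥0∞ :=
  ∑' m, ENNReal.ofReal (q m * ‖Φ (f m)‖ ^ 2)

/-- For an adapted integrand `H` with measurable paths:
`I` is (a version of) the Itô integral process `t ↦ ∫₀ᵗ H dW`, `t ∈ [0, T]`, that is, there are simple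
integrands `S k` with `∫₀ᵀ ‖(S k - H) Q^(1/2)‖²_HS ds → 0` in probability, the elementary
integrals of which converge to `I` in probability, uniformly in `t ∈ [0, T]`. -/
def IsItoIntegral (F : Filtration ℝ≥0 mΩ) (P : Measure Ω) (f : HilbertBasis ℕ ℝ Hi) (q : ℕ → ℝ)
    (W : ℝ≥0 → Ω → Hi) (T : ℝ≥0) (H : ℝ≥0 → Ω → Hi →L[ℝ] Hd) (I : ℝ≥0 → Ω → Hd) : Prop :=
  ∃ S : ℕ → SimpleIntegrand F Hi Hd,
    (∀ δ : ℝ≥0∞, 0 < δ → Tendsto (fun k => P {ω | δ ≤ ∫⁻ s in Set.Icc (0 : ℝ) T,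
        hsNormSq f q ((S k).process s.toNNReal ω - H s.toNNReal ω)}) atTop (𝓝 0)) ∧
    (∀ δ : ℝ, 0 < δ → Tendsto (fun k => P {ω | ∃ t ≤ T,
        δ ≤ ‖(S k).integral W t ω - I t ω‖}) atTop (𝓝 0))

end Ito

/-! ### The reduced climate equation -/

section Model

variable {Hd Hi Ω : Type*} [NormedAddCommGroup Hd] [InnerProductSpace ℝ Hd]
  [NormedAddCommGroup Hi] [InnerProductSpace ℝ Hi] {mΩ : MeasurableSpace Ω}

/-- The coefficients of the climate model: bounded linear operators, continuous bilinear maps, and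
the external force on the resolved variables. -/
structure Coefficients (Hd Hi : Type*) [NormedAddCommGroup Hd] [InnerProductSpace ℝ Hd]
    [NormedAddCommGroup Hi] [InnerProductSpace ℝ Hi] where
  /-- `A^1_1` -/
  A11 : Hd →L[ℝ] Hd
  /-- `A^1_2` -/
  A12 : Hi →L[ℝ] Hd
  /-- `A^2_1` -/
  A21 : Hd →L[ℝ] Hi
  /-- `B^1_{11}` -/
  B111 : Hd →L[ℝ] Hd →L[ℝ] Hd
  /-- `B^1_{12}` -/
  B112 : Hd →L[ℝ] Hi →L[ℝ] Hd
  /-- `B^1_{22}` -/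
  B122 : Hi →L[ℝ] Hi →L[ℝ] Hd
  /-- `B^2_{11}` -/
  B211 : Hd →L[ℝ] Hd →L[ℝ] Hi
  /-- `F^1` -/
  F1 : ℝ → Hd

variable {d : ℕ} (c : Coefficients Hd Hi) (e : OrthonormalBasis (Fin d) ℝ Hd)
  (f : HilbertBasis ℕ ℝ Hi) (q : ℕ → ℝ)

/-- The Stratonovich correction term `C`. -/
def stratonovich (x : Hd) : Hd :=
  ∑ i, (1 / 2 * ∑' m, q m * ∑ j, ⟪c.B112 (e j) (f m), e i⟫ * ⟪c.B112 x (f m), e j⟫) • e i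

/-- The vectors `b_{ℓ,m}`, with coordinates `⟪B^1_{22}(f_ℓ, f_m), e_i⟫ √(q_ℓ q_m / 2)`. -/
def bvec (p : ℕ × ℕ) : Hd :=
  ∑ i, (⟪c.B122 (f p.1) (f p.2), e i⟫ * Real.sqrt (q p.1 * q p.2 / 2)) • e i

/-- The drift of the reduced equation. -/
def drift (s : ℝ) (x : Hd) : Hd :=
  c.F1 s + c.A11 x + c.B111 x x + c.A12 (c.A21 x + c.B211 x x)
    + c.B112 x (c.A21 x + c.B211 x x) + stratonovich c e f q x

/-- `X` is a global solution on `[0, T]` of the reduced climate equation with initial condition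
`x₀`, driven by `W` and `Wb` on the filtered probability space `(Ω, F, P)`: it is adapted, has
continuous paths, and almost surely, for all `t ∈ [0, T]`,
`X_t = x₀ + ∫₀ᵗ drift(s, X_s) ds + A^1_2 W_t + ∫₀ᵗ B^1_{12}(X_s, dW_s) + ∑_{ℓ,m} b_{ℓ,m} Wb^{ℓ,m}_t`,
where the series converges in mean square. -/
structure IsSolution (F : Filtration ℝ≥0 mΩ) (P : Measure Ω)
    (W : ℝ≥0 → Ω → Hi) (Wb : ℕ × ℕ → ℝ≥0 → Ω → ℝ) (T : ℝ≥0) (x₀ : Hd)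
    (X : ℝ≥0 → Ω → Hd) : Prop where
  adapted : ∀ t ≤ T, StronglyMeasurable[F t] (X t)
  cont : ∀ᵐ ω ∂P, ContinuousOn (fun t => X t ω) (Set.Iic T)
  equation : ∃ I Z : ℝ≥0 → Ω → Hd,
    IsItoIntegral F P f q W T (fun s ω => c.B112 (X s ω)) I ∧
    (∀ t ≤ T, AEStronglyMeasurable (Z t) P) ∧
    (∀ t ≤ T, Tendsto (fun N : Finset (ℕ × ℕ) =>
      eLpNorm (fun ω => ∑ p ∈ N, Wb p t ω • bvec c e f q p - Z t ω) 2 P) atTop (𝓝 0)) ∧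
    ∀ᵐ ω ∂P, ∀ t ≤ T,
      X t ω = x₀ + (∫ s in (0 : ℝ)..t, drift c e f q s (X s.toNNReal ω))
        + c.A12 (W t ω) + I t ω + Z t ω

end Model

end

end Climate

/-!
The equation has the form `dX = β(t, X) dt + (A + B(X)) dW + dZ`, where `β(t, ·)` is a polynomial
of degree three plus the external force, `A` and `B` are bounded (bi)linear, and `Z` is the sum of
the series `∑ b_{ℓ,m} Wb^{ℓ,m}`. The drift is only locally Lipschitz, and the conditions (C1)–(C3)
are what prevents explosion: the contribution of the fast variables to `⟪x, β(t, x)⟫` is `⟪u, u +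
v⟫ - ⟪v, u + v⟫ = ‖u‖² - ‖v‖²` with `u = A²₁ x`, `v = B²₁₁(x, x)`. The cubic term is thus
dissipative, and `⟪x, β(t, x)⟫ ≤ κ (1 + ‖x‖²)` (`exists_coercive`). The diffusion coefficient
grows linearly.

Itô's formula and a theory of the stochastic integral are avoided by working along time grids,
with estimates which do not depend on the grid. They rest on the Itô isometry for one step
(`IsQWiener.lintegral_normSq_apply`) and on maximal inequalities for discrete martingales. Three
of them carry the proof.

* Stability (`exists_measure_le_of_residual_le`, `exists_eulerDefect_bound`): two adapted
  processes which stay in a ball and satisfy the Euler recursion up to a small defect are close in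
  probability, uniformly in time. This is Gronwall's lemma for the second moment of the
  difference, switched off at the exit from the ball or when the defect becomes large.
* Energy estimate (`exists_measure_exists_lt_norm_le`): along fine grids, the Euler scheme leaves
  the ball of radius `R` with probability `O(1 / R²)`.
* Comparison of elementary integrals (`SimpleIntegrand.measure_exists_le_integral_sub_le`), a
  consequence of a Lenglart-type inequality. By it, an Itô integral of `B(X)` is the limit in
  probability of the Riemann sums along dyadic grids (`exists_measure_riemannSum_sub_le`).

Uniqueness: by the last fact, the Euler defect of any solution tends to zero along the dyadic
grids, so that any two solutions are close in the sense of the stability estimate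
(`ae_forall_eq_of_equation`).

Existence: the series for `Z` converges uniformly in time by Kolmogorov's inequality
(`IsNoise.exists_additiveNoise`). The Euler scheme along a dyadic grid is bounded and
equicontinuous in probability by the energy estimate, hence has a small defect on all finer grids
(`exists_measure_eulerDefect_eulerScheme_le`). By stability the schemes are a Cauchy sequence,
uniformly in time and in probability. Their limit solves the equation, the simple integrands for
the Itô integral being the diffusion coefficients of the schemes, and it inherits measurability
with respect to the noise (`exists_solution_of_isCoerciveDrift`).
-/


set_option linter.unusedSectionVars false

namespace Climate

/-! ### Square-integrable martingale differences in discrete time -/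

section MartingaleDiff

variable {E Ω : Type*} [NormedAddCommGroup E] [InnerProductSpace ℝ E] {mΩ : MeasurableSpace Ω}

/-- A sequence of square-integrable martingale differences: `ξ i` is known at time `i + 1` and
orthogonal in `L²` to everything square-integrable that is known at time `i`. -/
structure IsMartingaleDiff (G : Filtration ℕ mΩ) (P : Measure Ω) (ξ : ℕ → Ω → E) : Prop where
  meas : ∀ i, StronglyMeasurable[G (i + 1)] (ξ i)
  memLp : ∀ i, MemLp (ξ i) 2 P
  orth : ∀ i (η : Ω → E), StronglyMeasurable[G i] η → MemLp η 2 P → ∫ ω, ⟪η ω, ξ i ω⟫ ∂P = 0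

omit [InnerProductSpace ℝ E] in
lemma integrable_normSq_of_memLp {P : Measure Ω} {u : Ω → E} (hu : MemLp u 2 P) :
    Integrable (fun ω => ‖u ω‖ ^ 2) P :=
  (memLp_two_iff_integrable_sq_norm hu.1).1 hu

lemma integrable_inner_of_memLp {P : Measure Ω} {u v : Ω → E} (hu : MemLp u 2 P)
    (hv : MemLp v 2 P) : Integrable (fun ω => ⟪u ω, v ω⟫) P := by
  refine ((integrable_normSq_of_memLp hu).add (integrable_normSq_of_memLp hv)).mono'
    (hu.1.inner hv.1) (ae_of_all _ fun ω => ?_)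
  have h1 := abs_real_inner_le_norm (u ω) (v ω)
  simp only [Pi.add_apply, Real.norm_eq_abs]
  nlinarith [sq_nonneg (‖u ω‖ - ‖v ω‖), sq_nonneg ‖u ω‖, sq_nonneg ‖v ω‖]

variable {G : Filtration ℕ mΩ} {P : Measure Ω} {ξ : ℕ → Ω → E}

namespace IsMartingaleDiff

lemma stronglyMeasurable_sum (h : IsMartingaleDiff G P ξ) (n : ℕ) :
    StronglyMeasurable[G n] (fun ω => ∑ i ∈ Finset.range n, ξ i ω) := by
  refine Finset.stronglyMeasurable_fun_sum _ fun i hi => ?_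
  exact (h.meas i).mono (G.mono (Finset.mem_range.1 hi))

lemma memLp_sum (h : IsMartingaleDiff G P ξ) (n : ℕ) :
    MemLp (fun ω => ∑ i ∈ Finset.range n, ξ i ω) 2 P :=
  memLp_finsetSum _ fun i _ => h.memLp i

lemma integral_indicator_normSq_succ (h : IsMartingaleDiff G P ξ) (n : ℕ) {s : Set Ω}
    (hs : MeasurableSet[G n] s) :
    ∫ ω in s, ‖∑ i ∈ Finset.range (n + 1), ξ i ω‖ ^ 2 ∂P =
      (∫ ω in s, ‖∑ i ∈ Finset.range n, ξ i ω‖ ^ 2 ∂P) + ∫ ω in s, ‖ξ n ω‖ ^ 2 ∂P := by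
  have hs' := G.le n s hs
  set M : Ω → E := fun ω => ∑ i ∈ Finset.range n, ξ i ω
  have hM : MemLp M 2 P := h.memLp_sum n
  have e : ∀ ω, ‖∑ i ∈ Finset.range (n + 1), ξ i ω‖ ^ 2 =
      ‖M ω‖ ^ 2 + 2 * ⟪M ω, ξ n ω⟫ + ‖ξ n ω‖ ^ 2 := fun ω => by
    rw [Finset.sum_range_succ, ← norm_add_sq_real]
  have i1 := (integrable_normSq_of_memLp hM).integrableOn (s := s)
  have i2 := ((integrable_inner_of_memLp hM (h.memLp n)).const_mul 2).integrableOn (s := s)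
  have i3 := (integrable_normSq_of_memLp (h.memLp n)).integrableOn (s := s)
  have ho : ∫ ω in s, ⟪M ω, ξ n ω⟫ ∂P = 0 := by
    have := h.orth n (s.indicator M) ((h.stronglyMeasurable_sum n).indicator hs) (hM.indicator hs')
    rw [← integral_indicator hs', ← this]
    congr 1 with ω
    by_cases hω : ω ∈ s <;> simp [hω]
  simp only [e]
  have i12 : Integrable (fun ω => ‖M ω‖ ^ 2 + 2 * ⟪M ω, ξ n ω⟫) (P.restrict s) := i1.add i2
  rw [integral_add i12 i3, integral_add i1 i2, integral_const_mul, ho, mul_zero, add_zero]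

/-- The partial sums of martingale differences satisfy Pythagoras' theorem in `L²`. -/
lemma integral_normSq_sum (h : IsMartingaleDiff G P ξ) (n : ℕ) :
    ∫ ω, ‖∑ i ∈ Finset.range n, ξ i ω‖ ^ 2 ∂P = ∑ i ∈ Finset.range n, ∫ ω, ‖ξ i ω‖ ^ 2 ∂P := by
  induction n with
  | zero => simp
  | succ n ih =>
    have := h.integral_indicator_normSq_succ n (s := Set.univ) MeasurableSet.univ
    simp only [Measure.restrict_univ] at this
    rw [this, ih, Finset.sum_range_succ]

lemma submartingale [IsFiniteMeasure P] (h : IsMartingaleDiff G P ξ) :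
    Submartingale (fun n ω => ‖∑ i ∈ Finset.range n, ξ i ω‖ ^ 2) G P := by
  refine submartingale_of_setIntegral_le_succ ?_
    (fun i => integrable_normSq_of_memLp (h.memLp_sum i)) fun i s hs => ?_
  · intro i
    exact (h.stronglyMeasurable_sum i).norm.pow 2
  · rw [h.integral_indicator_normSq_succ i hs]
    have : 0 ≤ ∫ ω in s, ‖ξ i ω‖ ^ 2 ∂P := integral_nonneg fun _ => by positivity
    linarith

/-- Kolmogorov's maximal inequality. -/
lemma measure_exists_le_norm_sum_le [IsFiniteMeasure P] (h : IsMartingaleDiff G P ξ) (n : ℕ)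
    {ε : ℝ} (hε : 0 < ε) :
    P {ω | ∃ j ≤ n, ε ≤ ‖∑ i ∈ Finset.range j, ξ i ω‖} ≤
      ENNReal.ofReal ((∑ i ∈ Finset.range n, ∫ ω, ‖ξ i ω‖ ^ 2 ∂P) / ε ^ 2) := by
  have hε2 : 0 < ε ^ 2 := by positivity
  have hm := maximal_ineq h.submartingale (fun n ω => by positivity) (ε := Real.toNNReal (ε ^ 2)) n
  set A := {ω | ((Real.toNNReal (ε ^ 2) : ℝ≥0) : ℝ) ≤ (Finset.range (n + 1)).sup'
    Finset.nonempty_range_add_one fun k => ‖∑ i ∈ Finset.range k, ξ i ω‖ ^ 2} with hA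
  have hAe : {ω | ∃ j ≤ n, ε ≤ ‖∑ i ∈ Finset.range j, ξ i ω‖} ⊆ A := by
    rintro ω ⟨j, hj, hj'⟩
    simp only [hA, Set.mem_ofPred_eq, Finset.le_sup'_iff, Finset.mem_range]
    rw [Real.coe_toNNReal _ hε2.le]
    exact ⟨j, by omega, pow_le_pow_left₀ hε.le hj' 2⟩
  have hle : ∫ ω in A, ‖∑ i ∈ Finset.range n, ξ i ω‖ ^ 2 ∂P ≤
      ∑ i ∈ Finset.range n, ∫ ω, ‖ξ i ω‖ ^ 2 ∂P := by
    rw [← h.integral_normSq_sum n]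
    exact setIntegral_le_integral (integrable_normSq_of_memLp (h.memLp_sum n))
      (ae_of_all _ fun ω => by positivity)
  refine (measure_mono hAe).trans ?_
  rw [ENNReal.ofReal_div_of_pos hε2, ENNReal.le_div_iff_mul_le (.inl (by simp [hε.ne'])) (by simp),
    mul_comm]
  exact hm.trans (ENNReal.ofReal_le_ofReal hle)

end IsMartingaleDiff

/-- Discrete Gronwall inequality for the step sizes `h i`. -/
lemma le_mul_exp_of_le_add_sum {u h : ℕ → ℝ} {a c : ℝ} (ha : 0 ≤ a) (hc : 0 ≤ c)
    (hh : ∀ i, 0 ≤ h i)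
    (hu : ∀ j, u j ≤ a + c * ∑ i ∈ Finset.range j, h i * u i) (j : ℕ) :
    u j ≤ a * Real.exp (c * ∑ i ∈ Finset.range j, h i) := by
  have key : ∀ j, a + c * ∑ i ∈ Finset.range j, h i * u i ≤
      a * Real.exp (c * ∑ i ∈ Finset.range j, h i) := by
    intro j
    induction j with
    | zero => simp
    | succ j ih =>
      rw [Finset.sum_range_succ, Finset.sum_range_succ, mul_add, mul_add, Real.exp_add]
      set S := a + c * ∑ i ∈ Finset.range j, h i * u i
      set X := Real.exp (c * ∑ i ∈ Finset.range j, h i)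
      have h1 : u j ≤ S := hu j
      have h2 : c * h j + 1 ≤ Real.exp (c * h j) := Real.add_one_le_exp _
      have h3 : 0 ≤ c * h j := mul_nonneg hc (hh j)
      have hX : 0 < X := Real.exp_pos _
      calc a + (c * ∑ i ∈ Finset.range j, h i * u i + c * (h j * u j))
          = S + c * h j * u j := by simp only [S]; ring
        _ ≤ S + c * h j * S := by gcongr
        _ = S * (c * h j + 1) := by ring
        _ ≤ (a * X) * (c * h j + 1) := by gcongr
        _ ≤ (a * X) * Real.exp (c * h j) := by gcongr
        _ = _ := by ring
  exact (hu j).trans (key j)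

end MartingaleDiff

/-! ### Moments of operator-valued integrands against Wiener increments -/

section NoiseMoments

variable {Hd Hi Ω : Type*} [NormedAddCommGroup Hd] [InnerProductSpace ℝ Hd]
  [NormedAddCommGroup Hi] [InnerProductSpace ℝ Hi] {mΩ : MeasurableSpace Ω}

/-- Second countability makes measurable functions into `Hi` strongly measurable, and makes the
σ-algebra of a product the product σ-algebra. -/
lemma secondCountableTopology_of_hilbertBasis (f : HilbertBasis ℕ ℝ Hi) :
    SecondCountableTopology Hi := by
  have h1 : TopologicalSpace.IsSeparable (Set.range f) :=
    (Set.countable_range f).isSeparable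
  have h2 : TopologicalSpace.IsSeparable
      ((Submodule.span ℝ (Set.range f)).topologicalClosure : Set Hi) := by
    rw [Submodule.topologicalClosure_coe]
    exact (h1.span (R := ℝ)).closure
  rw [f.dense_span] at h2
  have : TopologicalSpace.SeparableSpace Hi :=
    TopologicalSpace.isSeparable_univ_iff.1 (by simpa using h2)
  exact UniformSpace.secondCountable_of_separable Hi

lemma hasSum_inner_diagonal {f : HilbertBasis ℕ ℝ Hi} {Q : Hi →L[ℝ] Hi} {q : ℕ → ℝ}
    (hQ : ∀ m, Q (f m) = q m • f m) (ψ : Hi) :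
    HasSum (fun m => q m * ⟪ψ, f m⟫ ^ 2) ⟪Q ψ, ψ⟫ := by
  have h1 := ((f.hasSum_repr ψ).mapL Q).mapL (innerSL ℝ ψ)
  rw [innerSL_apply_apply, real_inner_comm] at h1
  refine h1.congr_fun fun m => ?_
  simp only [map_smul, hQ, innerSL_apply_apply, smul_eq_mul]
  rw [f.repr_apply_apply, real_inner_comm]
  ring

/-- The squared Hilbert–Schmidt norm of `Φ Q^(1/2)` is the trace of `Φ Q Φ*`. -/
lemma sum_inner_adjoint_eq_hsNormSq [FiniteDimensional ℝ Hd] [CompleteSpace Hi]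
    {f : HilbertBasis ℕ ℝ Hi} {Q : Hi →L[ℝ] Hi} {q : ℕ → ℝ}
    (hQ : ∀ m, Q (f m) = q m • f m) (hq : ∀ m, 0 ≤ q m) {ι : Type*} [Fintype ι]
    (e : OrthonormalBasis ι ℝ Hd) (Φ : Hi →L[ℝ] Hd) :
    ∑ i, ENNReal.ofReal ⟪Q (ContinuousLinearMap.adjoint Φ (e i)),
      ContinuousLinearMap.adjoint Φ (e i)⟫ = hsNormSq f q Φ := by
  have h1 : ∀ i, ENNReal.ofReal ⟪Q (ContinuousLinearMap.adjoint Φ (e i)),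
      ContinuousLinearMap.adjoint Φ (e i)⟫ =
      ∑' m, ENNReal.ofReal (q m * ⟪e i, Φ (f m)⟫ ^ 2) := fun i => by
    have h := hasSum_inner_diagonal hQ (ContinuousLinearMap.adjoint Φ (e i))
    rw [← h.tsum_eq, ENNReal.ofReal_tsum_of_nonneg
      (fun m => mul_nonneg (hq m) (sq_nonneg _)) h.summable]
    simp only [ContinuousLinearMap.adjoint_inner_left]
  simp only [h1]
  rw [hsNormSq, ← Summable.tsum_finsetSum fun _ _ => ENNReal.summable]
  congr 1 with m
  rw [← ENNReal.ofReal_sum_of_nonneg fun i _ => mul_nonneg (hq m) (sq_nonneg _), ← Finset.mul_sum]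
  congr 2
  have := e.sum_sq_norm_inner_right (Φ (f m))
  rw [← this]
  exact Finset.sum_congr rfl fun i _ => by rw [Real.norm_eq_abs, sq_abs]

lemma measurable_hsNormSq {m : MeasurableSpace Ω} (f : HilbertBasis ℕ ℝ Hi) (q : ℕ → ℝ)
    {Φ : Ω → Hi →L[ℝ] Hd} (hΦ : StronglyMeasurable[m] Φ) :
    Measurable[m] fun ω => hsNormSq f q (Φ ω) := by
  refine Measurable.tsum fun k => ?_
  have : StronglyMeasurable[m] fun ω => Φ ω (f k) :=
    (ContinuousLinearMap.apply ℝ Hd (f k)).continuous.comp_stronglyMeasurable hΦ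
  exact ((this.norm.measurable.pow_const 2).const_mul _).ennreal_ofReal

variable {F : Filtration ℝ≥0 mΩ} {P : Measure Ω} [IsProbabilityMeasure P]
  {f : HilbertBasis ℕ ℝ Hi} {Q : Hi →L[ℝ] Hi} {q : ℕ → ℝ} {W : ℝ≥0 → Ω → Hi}
  [MeasurableSpace Hi] [BorelSpace Hi]

namespace IsQWiener

lemma inner_nonneg (hQ : ∀ m, Q (f m) = q m • f m) (hq : ∀ m, 0 ≤ q m) (ψ : Hi) :
    0 ≤ ⟪Q ψ, ψ⟫ :=
  (hasSum_inner_diagonal hQ ψ).nonneg fun m => mul_nonneg (hq m) (sq_nonneg _)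

lemma measurable_increment (hW : IsQWiener F P Q W) (s t : ℝ≥0) :
    Measurable fun ω => W t ω - W s ω :=
  (((hW.adapted t).mono (F.le t)).sub ((hW.adapted s).mono (F.le s))).measurable

lemma integral_inner_sq (hW : IsQWiener F P Q W) (hQ : ∀ m, Q (f m) = q m • f m)
    (hq : ∀ m, 0 ≤ q m) {s t : ℝ≥0} (hst : s ≤ t) (ψ : Hi) :
    ∫⁻ w, ENNReal.ofReal (⟪ψ, w⟫ ^ 2) ∂(P.map fun ω => W t ω - W s ω) =
      ENNReal.ofReal ((t : ℝ) - s) * ENNReal.ofReal ⟪Q ψ, ψ⟫ := by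
  have hl := hW.gaussian s t hst ψ
  have hts : (0 : ℝ) ≤ t - s := sub_nonneg.2 (by exact_mod_cast hst)
  rw [lintegral_map (by fun_prop) (hW.measurable_increment s t)]
  have h2 : MemLp (fun ω => ⟪ψ, W t ω - W s ω⟫) 2 P := by
    have := memLp_id_gaussianReal (μ := 0) (v := Real.toNNReal (((t : ℝ) - s) * ⟪Q ψ, ψ⟫)) 2
    rw [← hl.map_eq] at this
    exact this.comp_of_map hl.aemeasurable
  rw [← ofReal_integral_eq_lintegral_ofReal h2.integrable_sq (ae_of_all _ fun _ => sq_nonneg _),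
    ← ENNReal.ofReal_mul hts]
  congr 1
  have hv := hl.variance_eq
  have hm := hl.integral_eq
  rw [integral_id_gaussianReal] at hm
  rw [variance_id_gaussianReal, variance_of_integral_eq_zero hl.aemeasurable hm,
    Real.coe_toNNReal _ (mul_nonneg hts (inner_nonneg hQ hq ψ))] at hv
  exact hv

lemma integral_inner_map (f : HilbertBasis ℕ ℝ Hi) (hW : IsQWiener F P Q W) {s t : ℝ≥0}
    (hst : s ≤ t) (ψ : Hi) :
    ∫ w, ⟪ψ, w⟫ ∂(P.map fun ω => W t ω - W s ω) = 0 := by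
  have hl := hW.gaussian s t hst ψ
  have := secondCountableTopology_of_hilbertBasis f
  rw [integral_map (hW.measurable_increment s t).aemeasurable
    (Continuous.aestronglyMeasurable (by fun_prop))]
  have hm := hl.integral_eq
  rwa [integral_id_gaussianReal] at hm

/-- The increment over `[s, t]` is independent of everything known at time `s`. -/
lemma map_prod (hW : IsQWiener F P Q W) {s t : ℝ≥0} (hst : s ≤ t) {Ψ : Ω → Hi}
    (hΨ : StronglyMeasurable[F s] Ψ) :
    P.map (fun ω => (Ψ ω, W t ω - W s ω)) =
      (P.map Ψ).prod (P.map fun ω => W t ω - W s ω) := by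
  have hi : IndepFun Ψ (fun ω => W t ω - W s ω) P := by
    rw [IndepFun_iff_Indep]
    exact (indep_of_indep_of_le_right (hW.indep s t hst) hΨ.measurable.comap_le).symm
  exact (indepFun_iff_map_prod_eq_prod_map_map
    ((hΨ.measurable.mono (F.le s) le_rfl).aemeasurable)
    (hW.measurable_increment s t).aemeasurable).1 hi

lemma lintegral_inner_sq (hW : IsQWiener F P Q W) (hQ : ∀ m, Q (f m) = q m • f m)
    (hq : ∀ m, 0 ≤ q m) {s t : ℝ≥0} (hst : s ≤ t) {Ψ : Ω → Hi}
    (hΨ : StronglyMeasurable[F s] Ψ) :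
    ∫⁻ ω, ENNReal.ofReal (⟪Ψ ω, W t ω - W s ω⟫ ^ 2) ∂P =
      ENNReal.ofReal ((t : ℝ) - s) * ∫⁻ ω, ENNReal.ofReal ⟪Q (Ψ ω), Ψ ω⟫ ∂P := by
  have := secondCountableTopology_of_hilbertBasis f
  have hΨ' := hΨ.measurable.mono (F.le s) le_rfl
  have hm : Measurable fun x : Hi × Hi => ENNReal.ofReal (⟪x.1, x.2⟫ ^ 2) := by fun_prop
  rw [← lintegral_map (f := fun x : Hi × Hi => ENNReal.ofReal (⟪x.1, x.2⟫ ^ 2)) hm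
    (hΨ'.prodMk (hW.measurable_increment s t)), hW.map_prod hst hΨ,
    lintegral_prod _ hm.aemeasurable]
  simp only [hW.integral_inner_sq hQ hq hst]
  rw [lintegral_const_mul _ (by fun_prop), lintegral_map (by fun_prop) hΨ']

/-- The Itô isometry on one step. -/
lemma lintegral_normSq_apply [FiniteDimensional ℝ Hd] [CompleteSpace Hi]
    (hW : IsQWiener F P Q W) (hQ : ∀ m, Q (f m) = q m • f m) (hq : ∀ m, 0 ≤ q m)
    {s t : ℝ≥0} (hst : s ≤ t) {Φ : Ω → Hi →L[ℝ] Hd} (hΦ : StronglyMeasurable[F s] Φ) :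
    ∫⁻ ω, ENNReal.ofReal (‖Φ ω (W t ω - W s ω)‖ ^ 2) ∂P =
      ENNReal.ofReal ((t : ℝ) - s) * ∫⁻ ω, hsNormSq f q (Φ ω) ∂P := by
  have := secondCountableTopology_of_hilbertBasis f
  set e := stdOrthonormalBasis ℝ Hd
  set Ψ : Fin (Module.finrank ℝ Hd) → Ω → Hi := fun i ω => ContinuousLinearMap.adjoint (Φ ω) (e i)
  have hΨ : ∀ i, StronglyMeasurable[F s] (Ψ i) := fun i =>
    ((ContinuousLinearMap.apply ℝ Hi (e i)).continuous.comp
      (ContinuousLinearMap.adjoint (𝕜 := ℝ) (E := Hi) (F := Hd)).continuous).comp_stronglyMeasurable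
        hΦ
  have hΨ' := fun i => (hΨ i).measurable.mono (F.le s) le_rfl
  have h1 : ∀ ω, ENNReal.ofReal (‖Φ ω (W t ω - W s ω)‖ ^ 2) =
      ∑ i, ENNReal.ofReal (⟪Ψ i ω, W t ω - W s ω⟫ ^ 2) := fun ω => by
    rw [← ENNReal.ofReal_sum_of_nonneg fun i _ => sq_nonneg _, ← e.sum_sq_norm_inner_right]
    congr 1
    refine Finset.sum_congr rfl fun i _ => ?_
    rw [ContinuousLinearMap.adjoint_inner_left, Real.norm_eq_abs, sq_abs]
  have h2 : ∀ ω, hsNormSq f q (Φ ω) = ∑ i, ENNReal.ofReal ⟪Q (Ψ i ω), Ψ i ω⟫ := fun ω =>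
    (sum_inner_adjoint_eq_hsNormSq hQ hq e (Φ ω)).symm
  have h3 : ∀ i, Measurable fun ω => ENNReal.ofReal ⟪Q (Ψ i ω), Ψ i ω⟫ := fun i =>
    ((Q.measurable.comp (hΨ' i)).inner (hΨ' i)).ennreal_ofReal
  simp only [h1, h2]
  have hm := hW.measurable_increment s t
  rw [lintegral_finsetSum _ fun i _ => (((hΨ' i).inner hm).pow_const 2).ennreal_ofReal,
    lintegral_finsetSum _ fun i _ => h3 i, Finset.mul_sum]
  exact Finset.sum_congr rfl fun i _ => hW.lintegral_inner_sq hQ hq hst (hΨ i)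

lemma stronglyMeasurable_apply (hW : IsQWiener F P Q W) {s t : ℝ≥0} (hst : s ≤ t)
    {Φ : Ω → Hi →L[ℝ] Hd} (hΦ : StronglyMeasurable[F s] Φ) :
    StronglyMeasurable[F t] fun ω => Φ ω (W t ω - W s ω) :=
  isBoundedBilinearMap_apply.continuous.comp_stronglyMeasurable
    ((hΦ.mono (F.mono hst)).prodMk ((hW.adapted t).sub ((hW.adapted s).mono (F.mono hst))))

lemma memLp_apply [FiniteDimensional ℝ Hd] [CompleteSpace Hi]
    (hW : IsQWiener F P Q W) (hQ : ∀ m, Q (f m) = q m • f m) (hq : ∀ m, 0 ≤ q m)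
    {s t : ℝ≥0} (hst : s ≤ t) {Φ : Ω → Hi →L[ℝ] Hd} (hΦ : StronglyMeasurable[F s] Φ)
    (hfin : ∫⁻ ω, hsNormSq f q (Φ ω) ∂P ≠ ∞) :
    MemLp (fun ω => Φ ω (W t ω - W s ω)) 2 P := by
  have hm := ((hW.stronglyMeasurable_apply hst hΦ).mono (F.le t))
  rw [memLp_two_iff_integrable_sq_norm hm.aestronglyMeasurable]
  refine ⟨(hm.norm.pow 2).aestronglyMeasurable, ?_⟩
  rw [hasFiniteIntegral_iff_ofReal (ae_of_all _ fun _ => by positivity),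
    hW.lintegral_normSq_apply hQ hq hst hΦ]
  exact ENNReal.mul_lt_top ENNReal.ofReal_lt_top hfin.lt_top

/-- Increments of the Wiener process, transformed by an operator known in advance, are orthogonal to
the past. -/
lemma integral_inner_apply [FiniteDimensional ℝ Hd] [CompleteSpace Hi]
    (hW : IsQWiener F P Q W) (hQ : ∀ m, Q (f m) = q m • f m) (hq : ∀ m, 0 ≤ q m)
    {s t : ℝ≥0} (hst : s ≤ t) {Φ : Ω → Hi →L[ℝ] Hd} (hΦ : StronglyMeasurable[F s] Φ)
    (hfin : ∫⁻ ω, hsNormSq f q (Φ ω) ∂P ≠ ∞) {η : Ω → Hd} (hη : StronglyMeasurable[F s] η)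
    (hη2 : MemLp η 2 P) :
    ∫ ω, ⟪η ω, Φ ω (W t ω - W s ω)⟫ ∂P = 0 := by
  have := secondCountableTopology_of_hilbertBasis f
  set Ψ : Ω → Hi := fun ω => ContinuousLinearMap.adjoint (Φ ω) (η ω)
  have hΨ : StronglyMeasurable[F s] Ψ :=
    isBoundedBilinearMap_apply.continuous.comp_stronglyMeasurable
      (((ContinuousLinearMap.adjoint (𝕜 := ℝ) (E := Hi) (F := Hd)).continuous.comp_stronglyMeasurable
        hΦ).prodMk hη)
  have hΨ' := hΨ.measurable.mono (F.le s) le_rfl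
  have hm := hW.measurable_increment s t
  have hint : Integrable (fun ω => ⟪Ψ ω, W t ω - W s ω⟫) P := by
    refine (integrable_inner_of_memLp hη2 (hW.memLp_apply hQ hq hst hΦ hfin)).congr
      (ae_of_all _ fun ω => ?_)
    exact (ContinuousLinearMap.adjoint_inner_left (Φ ω) _ _).symm
  have hc : Continuous fun x : Hi × Hi => ⟪x.1, x.2⟫ := by fun_prop
  calc ∫ ω, ⟪η ω, Φ ω (W t ω - W s ω)⟫ ∂P = ∫ ω, ⟪Ψ ω, W t ω - W s ω⟫ ∂P := by
        simp only [Ψ, ContinuousLinearMap.adjoint_inner_left]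
    _ = ∫ x, ⟪x.1, x.2⟫ ∂(P.map fun ω => (Ψ ω, W t ω - W s ω)) := by
        rw [integral_map (hΨ'.prodMk hm).aemeasurable hc.aestronglyMeasurable]
    _ = 0 := by
        have hi : Integrable (fun x : Hi × Hi => ⟪x.1, x.2⟫)
            (P.map fun ω => (Ψ ω, W t ω - W s ω)) := by
          rw [integrable_map_measure hc.aestronglyMeasurable (hΨ'.prodMk hm).aemeasurable]
          exact hint
        rw [hW.map_prod hst hΨ] at hi ⊢
        have : IsProbabilityMeasure (P.map Ψ) := Measure.isProbabilityMeasure_map hΨ'.aemeasurable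
        have : IsProbabilityMeasure (P.map fun ω => W t ω - W s ω) :=
          Measure.isProbabilityMeasure_map hm.aemeasurable
        rw [integral_prod _ hi]
        simp [integral_inner_map f hW hst]

end IsQWiener

end NoiseMoments

/-! ### Sampling along a time grid and a Lenglart-type inequality -/

section Sampling

variable {Hd Hi Ω : Type*} [NormedAddCommGroup Hd] [InnerProductSpace ℝ Hd]
  [NormedAddCommGroup Hi] [InnerProductSpace ℝ Hi] {mΩ : MeasurableSpace Ω}

/-- The discrete-time filtration obtained by observing `F` along a monotone sequence of times. -/
def sampled (F : Filtration ℝ≥0 mΩ) {g : ℕ → ℝ≥0} (hg : Monotone g) : Filtration ℕ mΩ where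
  seq j := F (g j)
  mono' _ _ h := F.mono (hg h)
  le' j := F.le (g j)

variable {F : Filtration ℝ≥0 mΩ} {P : Measure Ω} [IsProbabilityMeasure P]
  {f : HilbertBasis ℕ ℝ Hi} {Q : Hi →L[ℝ] Hi} {q : ℕ → ℝ} {W : ℝ≥0 → Ω → Hi}
  [MeasurableSpace Hi] [BorelSpace Hi] [FiniteDimensional ℝ Hd] [CompleteSpace Hi]

lemma hsNormSq_le (f : HilbertBasis ℕ ℝ Hi) (hq : ∀ m, 0 ≤ q m) (hq_sum : Summable q)
    (Φ : Hi →L[ℝ] Hd) : hsNormSq f q Φ ≤ ENNReal.ofReal ((∑' m, q m) * ‖Φ‖ ^ 2) := by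
  rw [← tsum_mul_right, ENNReal.ofReal_tsum_of_nonneg
    (fun m => mul_nonneg (hq m) (sq_nonneg _)) (hq_sum.mul_right _)]
  refine ENNReal.tsum_le_tsum fun m => ENNReal.ofReal_le_ofReal ?_
  have h1 : ‖Φ (f m)‖ ≤ ‖Φ‖ := by
    simpa [f.orthonormal.1 m] using Φ.le_opNorm (f m)
  have := hq m
  gcongr

lemma hsNormSq_zero : hsNormSq f q (0 : Hi →L[ℝ] Hd) = 0 := by simp [hsNormSq]

namespace IsQWiener

lemma isMartingaleDiff_apply (hW : IsQWiener F P Q W) (hQ : ∀ m, Q (f m) = q m • f m)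
    (hq : ∀ m, 0 ≤ q m) {g : ℕ → ℝ≥0} (hg : Monotone g) {Φ : ℕ → Ω → Hi →L[ℝ] Hd}
    (hΦ : ∀ i, StronglyMeasurable[F (g i)] (Φ i))
    (hfin : ∀ i, ∫⁻ ω, hsNormSq f q (Φ i ω) ∂P ≠ ∞) :
    IsMartingaleDiff (sampled F hg) P (fun i ω => Φ i ω (W (g (i + 1)) ω - W (g i) ω)) where
  meas i := hW.stronglyMeasurable_apply (hg (Nat.le_succ i)) (hΦ i)
  memLp i := hW.memLp_apply hQ hq (hg (Nat.le_succ i)) (hΦ i) (hfin i)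
  orth i _ hη hη2 := hW.integral_inner_apply hQ hq (hg (Nat.le_succ i)) (hΦ i) (hfin i) hη hη2

lemma ofReal_integral_normSq_apply (hW : IsQWiener F P Q W) (hQ : ∀ m, Q (f m) = q m • f m)
    (hq : ∀ m, 0 ≤ q m) {s t : ℝ≥0} (hst : s ≤ t) {Φ : Ω → Hi →L[ℝ] Hd}
    (hΦ : StronglyMeasurable[F s] Φ) (hfin : ∫⁻ ω, hsNormSq f q (Φ ω) ∂P ≠ ∞) :
    ENNReal.ofReal (∫ ω, ‖Φ ω (W t ω - W s ω)‖ ^ 2 ∂P) =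
      ENNReal.ofReal ((t : ℝ) - s) * ∫⁻ ω, hsNormSq f q (Φ ω) ∂P := by
  rw [← hW.lintegral_normSq_apply hQ hq hst hΦ, ofReal_integral_eq_lintegral_ofReal
    (integrable_normSq_of_memLp (hW.memLp_apply hQ hq hst hΦ hfin))
    (ae_of_all _ fun _ => by positivity)]

/-- A bound on the moment of the increment through a pointwise bound on the integrand. -/
lemma integral_normSq_apply_le (hW : IsQWiener F P Q W) (hQ : ∀ m, Q (f m) = q m • f m)
    (hq : ∀ m, 0 ≤ q m) {s t : ℝ≥0} (hst : s ≤ t) {Φ : Ω → Hi →L[ℝ] Hd}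
    (hΦ : StronglyMeasurable[F s] Φ) {v : Ω → ℝ} (hv : Integrable v P) (hv0 : ∀ ω, 0 ≤ v ω)
    (hle : ∀ ω, hsNormSq f q (Φ ω) ≤ ENNReal.ofReal (v ω)) :
    ∫⁻ ω, hsNormSq f q (Φ ω) ∂P ≠ ∞ ∧
    ∫ ω, ‖Φ ω (W t ω - W s ω)‖ ^ 2 ∂P ≤ ((t : ℝ) - s) * ∫ ω, v ω ∂P := by
  have h1 : ∫⁻ ω, hsNormSq f q (Φ ω) ∂P ≤ ENNReal.ofReal (∫ ω, v ω ∂P) := by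
    rw [ofReal_integral_eq_lintegral_ofReal hv (ae_of_all _ hv0)]
    exact lintegral_mono hle
  have hfin := ne_top_of_le_ne_top ENNReal.ofReal_ne_top h1
  refine ⟨hfin, ?_⟩
  have hts : (0 : ℝ) ≤ t - s := sub_nonneg.2 (by exact_mod_cast hst)
  rw [← ENNReal.ofReal_le_ofReal_iff (mul_nonneg hts (integral_nonneg hv0)),
    hW.ofReal_integral_normSq_apply hQ hq hst hΦ hfin, ENNReal.ofReal_mul hts]
  gcongr

/-- A Lenglart-type inequality: where the accumulated Hilbert–Schmidt norm of the integrand is at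
most `N`, the elementary integral exceeds `ε` with probability at most `N / ε²`. The integrand is
switched off as soon as its accumulated norm exceeds `N`. -/
lemma measure_exists_le_norm_sum_apply_le (hW : IsQWiener F P Q W)
    (hQ : ∀ m, Q (f m) = q m • f m) (hq : ∀ m, 0 ≤ q m) {g : ℕ → ℝ≥0} (hg : Monotone g)
    {Φ : ℕ → Ω → Hi →L[ℝ] Hd} (hΦ : ∀ i, StronglyMeasurable[F (g i)] (Φ i)) (n : ℕ)
    {N ε : ℝ} (hε : 0 < ε) :
    P {ω | (∃ j ≤ n, ε ≤ ‖∑ i ∈ Finset.range j, Φ i ω (W (g (i + 1)) ω - W (g i) ω)‖) ∧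
      ∑ i ∈ Finset.range n, ENNReal.ofReal ((g (i + 1) : ℝ) - g i) * hsNormSq f q (Φ i ω) ≤
        ENNReal.ofReal N} ≤ ENNReal.ofReal (N / ε ^ 2) := by
  set x : ℕ → Ω → ℝ≥0∞ := fun i ω =>
    ENNReal.ofReal ((g (i + 1) : ℝ) - g i) * hsNormSq f q (Φ i ω) with hx
  set V : ℕ → Ω → ℝ≥0∞ := fun k ω => ∑ i ∈ Finset.range k, x i ω with hV
  -- `V (i + 1)` is known at time `g i`, so the integrand can be switched off before the step; steps of
  -- length zero do not contribute to `V`, and are dropped to keep the integrand square integrable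
  set A : ℕ → Set Ω := fun i => {ω | V (i + 1) ω ≤ ENNReal.ofReal N ∧ g i < g (i + 1)} with hA
  have hhs : ∀ i j, i ≤ j → Measurable[F (g j)] fun ω => x i ω := fun i j hij =>
    (measurable_hsNormSq f q ((hΦ i).mono (F.mono (hg hij)))).const_mul _
  have hAm : ∀ i, MeasurableSet[F (g i)] (A i) := fun i => by
    have h1 : Measurable[F (g i)] (V (i + 1)) :=
      Finset.measurable_fun_sum _ fun k hk => hhs k i (by simp at hk; omega)
    by_cases hlt : g i < g (i + 1)
    · simpa [hA, hlt] using measurableSet_le h1 measurable_const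
    · simp [hA, hlt]
  set Φ' : ℕ → Ω → Hi →L[ℝ] Hd := fun i => (A i).indicator (Φ i) with hΦ'
  have hm : ∀ i, StronglyMeasurable[F (g i)] (Φ' i) := fun i => (hΦ i).indicator (hAm i)
  have hpos : ∀ i, (0 : ℝ) ≤ (g (i + 1) : ℝ) - g i := fun i =>
    sub_nonneg.2 (by exact_mod_cast hg (Nat.le_succ i))
  -- the switched-off integrand never accumulates more than `N`
  have hsum : ∀ k ω, ∑ i ∈ Finset.range k,
      ENNReal.ofReal ((g (i + 1) : ℝ) - g i) * hsNormSq f q (Φ' i ω) ≤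
        min (V k ω) (ENNReal.ofReal N) := by
    intro k ω
    induction k with
    | zero => simp
    | succ k ih =>
      rw [Finset.sum_range_succ]
      by_cases hω : ω ∈ A k
      · have hle : ∑ i ∈ Finset.range k,
            ENNReal.ofReal ((g (i + 1) : ℝ) - g i) * hsNormSq f q (Φ' i ω) +
            ENNReal.ofReal ((g (k + 1) : ℝ) - g k) * hsNormSq f q (Φ' k ω) ≤ V (k + 1) ω := by
          have e : V (k + 1) ω = V k ω + x k ω := Finset.sum_range_succ _ _
          rw [e]
          refine add_le_add (ih.trans (min_le_left _ _)) (le_of_eq ?_)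
          simp only [hx, hΦ', Set.indicator_of_mem hω]
        exact le_min hle (hle.trans hω.1)
      · simp only [hΦ', Set.indicator_of_notMem hω, hsNormSq_zero, mul_zero, add_zero]
        refine ih.trans (min_le_min ?_ le_rfl)
        simp only [hV, Finset.sum_range_succ]
        exact le_self_add
  have hfin : ∀ i, ∫⁻ ω, hsNormSq f q (Φ' i ω) ∂P ≠ ∞ := fun i => by
    by_cases hlt : g i < g (i + 1)
    · have hd : 0 < (g (i + 1) : ℝ) - g i := sub_pos.2 (by exact_mod_cast hlt)
      have hb : ∀ ω, hsNormSq f q (Φ' i ω) ≤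
          ENNReal.ofReal N / ENNReal.ofReal ((g (i + 1) : ℝ) - g i) := fun ω => by
        rw [ENNReal.le_div_iff_mul_le (.inl (by simpa using hd)) (.inl ENNReal.ofReal_ne_top),
          mul_comm]
        refine le_trans ?_ ((hsum (i + 1) ω).trans (min_le_right _ _))
        rw [Finset.sum_range_succ]
        exact le_add_self
      refine ne_top_of_le_ne_top ?_ (lintegral_mono hb)
      rw [lintegral_const, measure_univ, mul_one]
      exact ENNReal.div_ne_top ENNReal.ofReal_ne_top (by simpa using hd)
    · have : ∀ ω, Φ' i ω = 0 := fun ω => by simp [hΦ', hA, hlt]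
      simp [this, hsNormSq_zero]
  have hmd := hW.isMartingaleDiff_apply hQ hq hg hm hfin
  have hsub : {ω | (∃ j ≤ n, ε ≤ ‖∑ i ∈ Finset.range j, Φ i ω (W (g (i + 1)) ω - W (g i) ω)‖) ∧
      V n ω ≤ ENNReal.ofReal N} ⊆
      {ω | ∃ j ≤ n, ε ≤ ‖∑ i ∈ Finset.range j, Φ' i ω (W (g (i + 1)) ω - W (g i) ω)‖} := by
    rintro ω ⟨⟨j, hj, hj'⟩, hVn⟩
    refine ⟨j, hj, hj'.trans (le_of_eq ?_)⟩
    congr 1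
    refine Finset.sum_congr rfl fun i hi => ?_
    rw [Finset.mem_range] at hi
    rcases (hg (Nat.le_succ i)).lt_or_eq with hlt | heq
    · have hω : ω ∈ A i := ⟨le_trans (Finset.sum_le_sum_of_subset
        (Finset.range_mono (by omega))) hVn, hlt⟩
      simp only [hΦ', Set.indicator_of_mem hω]
    · rw [← Nat.succ_eq_add_one, ← heq]; simp
  refine (measure_mono hsub).trans ((hmd.measure_exists_le_norm_sum_le n hε).trans ?_)
  have hε2 : 0 < ε ^ 2 := by positivity
  rw [ENNReal.ofReal_div_of_pos hε2, ENNReal.ofReal_div_of_pos hε2]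
  refine ENNReal.div_le_div_right ?_ _
  rw [ENNReal.ofReal_sum_of_nonneg fun i _ => integral_nonneg fun ω => by positivity]
  calc ∑ i ∈ Finset.range n, ENNReal.ofReal
        (∫ ω, ‖Φ' i ω (W (g (i + 1)) ω - W (g i) ω)‖ ^ 2 ∂P)
      = ∑ i ∈ Finset.range n, ∫⁻ ω, ENNReal.ofReal ((g (i + 1) : ℝ) - g i) *
          hsNormSq f q (Φ' i ω) ∂P := by
        refine Finset.sum_congr rfl fun i _ => ?_
        rw [hW.ofReal_integral_normSq_apply hQ hq (hg (Nat.le_succ i)) (hm i) (hfin i),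
          lintegral_const_mul' _ _ ENNReal.ofReal_ne_top]
    _ = ∫⁻ ω, ∑ i ∈ Finset.range n, ENNReal.ofReal ((g (i + 1) : ℝ) - g i) *
          hsNormSq f q (Φ' i ω) ∂P := by
        rw [lintegral_finsetSum _ fun i _ =>
          (measurable_hsNormSq f q ((hm i).mono (F.le _))).const_mul _]
    _ ≤ ∫⁻ _, ENNReal.ofReal N ∂P :=
        lintegral_mono fun ω => (hsum n ω).trans (min_le_right _ _)
    _ = ENNReal.ofReal N := by simp

end IsQWiener

end Sampling

/-! ### Stability of the discretized equation -/

section Stability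

variable {Hd Hi Ω : Type*} [NormedAddCommGroup Hd] [InnerProductSpace ℝ Hd]
  [NormedAddCommGroup Hi] [InnerProductSpace ℝ Hi] {mΩ : MeasurableSpace Ω}

lemma measure_le_ofReal_of_integral_sq {P : Measure Ω} {u : Ω → ℝ}
    (hi : Integrable (fun ω => u ω ^ 2) P) {ε C : ℝ} (hε : 0 < ε)
    (hC : ∫ ω, u ω ^ 2 ∂P ≤ C) : P {ω | ε ≤ u ω} ≤ ENNReal.ofReal (C / ε ^ 2) := by
  have hε2 : 0 < ε ^ 2 := by positivity
  have h1 : {ω | ε ≤ u ω} ⊆ {ω | ENNReal.ofReal (ε ^ 2) ≤ ENNReal.ofReal (u ω ^ 2)} :=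
    fun ω (hω : ε ≤ u ω) => ENNReal.ofReal_le_ofReal (pow_le_pow_left₀ hε.le hω 2)
  refine (measure_mono h1).trans ((meas_ge_le_lintegral_div
    (hi.aemeasurable.ennreal_ofReal) (by simpa using hε.ne') ENNReal.ofReal_ne_top).trans ?_)
  rw [ENNReal.ofReal_div_of_pos hε2,
    ← ofReal_integral_eq_lintegral_ofReal hi (ae_of_all _ fun _ => sq_nonneg _)]
  gcongr

/-- What is missing from `X - Y` to be the difference of two Euler recursions along the grid `g`,
with drifts `β i` and diffusion `B`. -/
noncomputable def residual (B : Hd →L[ℝ] Hi →L[ℝ] Hd) (W : ℝ≥0 → Ω → Hi) (g : ℕ → ℝ≥0)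
    (β : ℕ → Hd → Hd)
    (X Y : ℕ → Ω → Hd) (j : ℕ) (ω : Ω) : Hd :=
  X j ω - Y j ω - ∑ i ∈ Finset.range j, (((g (i + 1) : ℝ) - g i) • (β i (X i ω) - β i (Y i ω)) +
    B (X i ω - Y i ω) (W (g (i + 1)) ω - W (g i) ω))

variable {F : Filtration ℝ≥0 mΩ} {P : Measure Ω} [IsProbabilityMeasure P]
  {f : HilbertBasis ℕ ℝ Hi} {Q : Hi →L[ℝ] Hi} {q : ℕ → ℝ} {W : ℝ≥0 → Ω → Hi}
  [MeasurableSpace Hi] [BorelSpace Hi] [FiniteDimensional ℝ Hd] [CompleteSpace Hi]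

lemma stronglyMeasurable_residual (hW : IsQWiener F P Q W) (B : Hd →L[ℝ] Hi →L[ℝ] Hd)
    {g : ℕ → ℝ≥0} (hg : Monotone g) {β : ℕ → Hd → Hd} (hβ : ∀ i, Continuous (β i))
    {X Y : ℕ → Ω → Hd} (hX : ∀ j, StronglyMeasurable[F (g j)] (X j))
    (hY : ∀ j, StronglyMeasurable[F (g j)] (Y j)) (j : ℕ) :
    StronglyMeasurable[F (g j)] (residual B W g β X Y j) := by
  refine ((hX j).sub (hY j)).sub (Finset.stronglyMeasurable_fun_sum _ fun i hi => ?_)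
  have hij : i + 1 ≤ j := by simpa using hi
  have hXi := (hX i).mono (F.mono (hg (Nat.le_of_succ_le hij)))
  have hYi := (hY i).mono (F.mono (hg (Nat.le_of_succ_le hij)))
  refine StronglyMeasurable.add (StronglyMeasurable.const_smul (((hβ i).comp_stronglyMeasurable hXi).sub
    ((hβ i).comp_stronglyMeasurable hYi)) _) ?_
  exact (hW.stronglyMeasurable_apply (hg (Nat.le_succ i)) (Φ := fun ω => B (X i ω - Y i ω))
    (B.continuous.comp_stronglyMeasurable ((hX i).sub (hY i)))).mono (F.mono (hg hij))

/-- Stability of the Euler recursion, uniformly in the grid: two adapted sequences which stay in the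
ball of radius `R`, on which the drift is `L`-Lipschitz, and whose residual stays below `η`, are
uniformly close in probability. -/
lemma exists_measure_le_of_residual_le (hW : IsQWiener F P Q W)
    (hQ : ∀ m, Q (f m) = q m • f m) (hq : ∀ m, 0 ≤ q m) (hq_sum : Summable q)
    (B : Hd →L[ℝ] Hi →L[ℝ] Hd) (T : ℝ≥0) {L : ℝ} (hL : 0 ≤ L) (R : ℝ) :
    ∃ K : ℝ, 0 ≤ K ∧ ∀ (g : ℕ → ℝ≥0), Monotone g → (∀ j, g j ≤ T) → ∀ β : ℕ → Hd → Hd,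
      (∀ i, Continuous (β i)) →
      (∀ i x y, ‖x‖ ≤ R → ‖y‖ ≤ R → ‖β i x - β i y‖ ≤ L * ‖x - y‖) →
      ∀ X Y : ℕ → Ω → Hd, (∀ j, StronglyMeasurable[F (g j)] (X j)) →
      (∀ j, StronglyMeasurable[F (g j)] (Y j)) → ∀ (n : ℕ) (η ε : ℝ), 0 < η → 3 * η < ε →
      P {ω | (∀ j ≤ n, ‖X j ω‖ ≤ R ∧ ‖Y j ω‖ ≤ R ∧ ‖residual B W g β X Y j ω‖ ≤ η) ∧
        ∃ j ≤ n, ε ≤ ‖X j ω - Y j ω‖} ≤ ENNReal.ofReal (K * η ^ 2 / ε ^ 2) := by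
  set τ := ∑' m, q m
  have hτ : 0 ≤ τ := tsum_nonneg hq
  set c := τ * ‖B‖ ^ 2
  have hc : 0 ≤ c := by positivity
  set c0 := (T : ℝ) * L ^ 2 + c
  have hc0 : 0 ≤ c0 := by positivity
  refine ⟨27 * c0 * T * Real.exp (3 * c0 * T), by positivity, ?_⟩
  intro g hg hgT β hβ hβL X Y hX hY n η ε hη hηε
  have hε : 0 < ε := by linarith
  set D : ℕ → Ω → Hd := fun j ω => X j ω - Y j ω
  set r := residual B W g β X Y
  have hD : ∀ j, StronglyMeasurable[F (g j)] (D j) := fun j => (hX j).sub (hY j)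
  have hr := stronglyMeasurable_residual hW B hg hβ hX hY
  -- the processes have stayed in the ball, and the residual below `η`, up to the time `g j`
  set A : ℕ → Set Ω := fun j => {ω | ∀ i ≤ j, ‖X i ω‖ ≤ R ∧ ‖Y i ω‖ ≤ R ∧ ‖r i ω‖ ≤ η} with hA
  have hAm : ∀ j, MeasurableSet[F (g j)] (A j) := fun j => by
    have : A j = ⋂ i ≤ j, ({ω | ‖X i ω‖ ≤ R} ∩ ({ω | ‖Y i ω‖ ≤ R} ∩ {ω | ‖r i ω‖ ≤ η})) := by
      ext ω; simp [hA]
    rw [this]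
    refine MeasurableSet.iInter fun i => MeasurableSet.iInter fun hi => ?_
    have hm := F.mono (hg hi)
    exact ((((hX i).mono hm).norm.measurableSet_le stronglyMeasurable_const)).inter
      (((((hY i).mono hm).norm.measurableSet_le stronglyMeasurable_const)).inter
      ((((hr i).mono hm).norm.measurableSet_le stronglyMeasurable_const)))
  have hAanti : ∀ i j, i ≤ j → A j ⊆ A i := fun i j hij ω hω k hk => hω k (hk.trans hij)
  -- the difference, switched off when this fails, is bounded and adapted
  set D' : ℕ → Ω → Hd := fun j => (A j).indicator (D j) with hD'
  have hD'm : ∀ j, StronglyMeasurable[F (g j)] (D' j) := fun j => (hD j).indicator (hAm j)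
  have hD'le : ∀ j ω, ‖D' j ω‖ ≤ 2 * |R| := fun j ω => by
    by_cases hω : ω ∈ A j
    · simp only [hD', Set.indicator_of_mem hω]
      have := hω j le_rfl
      refine (norm_sub_le _ _).trans ?_
      linarith [this.1, this.2.1, le_abs_self R]
    · simp [hD', Set.indicator_of_notMem hω]
  have hD'2 : ∀ j, MemLp (D' j) 2 P := fun j =>
    MemLp.of_bound ((hD'm j).mono (F.le _)).aestronglyMeasurable _ (ae_of_all _ (hD'le j))
  have hD'i := fun j => integrable_normSq_of_memLp (hD'2 j)
  set h : ℕ → ℝ := fun i => (g (i + 1) : ℝ) - g i with hh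
  have hpos : ∀ i, 0 ≤ h i := fun i => sub_nonneg.2 (by exact_mod_cast hg (Nat.le_succ i))
  have hsumh : ∀ j, ∑ i ∈ Finset.range j, h i ≤ T := fun j => by
    rw [Finset.sum_range_sub (fun i => (g i : ℝ))]
    have h1 : (g j : ℝ) ≤ T := by exact_mod_cast hgT j
    have h2 : (0 : ℝ) ≤ g 0 := (g 0).2
    linarith
  set Φ : ℕ → Ω → Hi →L[ℝ] Hd := fun i ω => B (D' i ω)
  have hΦm : ∀ i, StronglyMeasurable[F (g i)] (Φ i) := fun i =>
    B.continuous.comp_stronglyMeasurable (hD'm i)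
  have hΦb : ∀ i ω, hsNormSq f q (Φ i ω) ≤ ENNReal.ofReal (c * ‖D' i ω‖ ^ 2) := fun i ω => by
    refine (hsNormSq_le f hq hq_sum _).trans (ENNReal.ofReal_le_ofReal ?_)
    have : ‖Φ i ω‖ ≤ ‖B‖ * ‖D' i ω‖ := B.le_opNorm _
    calc τ * ‖Φ i ω‖ ^ 2 ≤ τ * (‖B‖ * ‖D' i ω‖) ^ 2 := by gcongr
      _ = c * ‖D' i ω‖ ^ 2 := by simp only [c]; ring
  set ξ : ℕ → Ω → Hd := fun i ω => Φ i ω (W (g (i + 1)) ω - W (g i) ω)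
  set u : ℕ → ℝ := fun j => ∫ ω, ‖D' j ω‖ ^ 2 ∂P
  have hξ := fun i => hW.integral_normSq_apply_le hQ hq (hg (Nat.le_succ i)) (hΦm i)
    ((hD'i i).const_mul c) (fun ω => by positivity) (hΦb i)
  have hmd : IsMartingaleDiff (sampled F hg) P ξ :=
    hW.isMartingaleDiff_apply hQ hq hg hΦm fun i => (hξ i).1
  have hξu : ∀ j, ∑ i ∈ Finset.range j, ∫ ω, ‖ξ i ω‖ ^ 2 ∂P ≤
      c * ∑ i ∈ Finset.range j, h i * u i := fun j => by
    rw [Finset.mul_sum]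
    refine Finset.sum_le_sum fun i _ => (hξ i).2.trans (le_of_eq ?_)
    rw [integral_const_mul]
    simp only [hh, u, Nat.succ_eq_add_one]
    ring
  set M : ℕ → Ω → Hd := fun j ω => ∑ i ∈ Finset.range j, ξ i ω
  set U : ℕ → Ω → ℝ := fun j ω => ∑ i ∈ Finset.range j, h i * (L * ‖D' i ω‖)
  have hU0 : ∀ j ω, 0 ≤ U j ω := fun j ω => Finset.sum_nonneg fun i _ =>
    mul_nonneg (hpos i) (by positivity)
  have hUsq : ∀ j ω, U j ω ^ 2 ≤ T * L ^ 2 * ∑ i ∈ Finset.range j, h i * ‖D' i ω‖ ^ 2 :=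
    fun j ω => by
    have h1 := Finset.sum_sq_le_sum_mul_sum_of_sq_le_mul (Finset.range j)
      (r := fun i => h i * (L * ‖D' i ω‖)) (f := h) (g := fun i => h i * (L * ‖D' i ω‖) ^ 2)
      (fun i _ => hpos i) (fun i _ => mul_nonneg (hpos i) (sq_nonneg _)) (fun i _ => le_of_eq (by ring))
    refine h1.trans ?_
    have h2 : ∑ i ∈ Finset.range j, h i * (L * ‖D' i ω‖) ^ 2 =
        L ^ 2 * ∑ i ∈ Finset.range j, h i * ‖D' i ω‖ ^ 2 := by
      rw [Finset.mul_sum]; exact Finset.sum_congr rfl fun i _ => by ring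
    rw [h2, mul_assoc]
    have h3 : 0 ≤ ∑ i ∈ Finset.range j, h i * ‖D' i ω‖ ^ 2 :=
      Finset.sum_nonneg fun i _ => mul_nonneg (hpos i) (sq_nonneg _)
    exact mul_le_mul_of_nonneg_right (hsumh j) (by positivity)
  have hSi : ∀ j, Integrable (fun ω => ∑ i ∈ Finset.range j, h i * ‖D' i ω‖ ^ 2) P := fun j =>
    integrable_finsetSum _ fun i _ => (hD'i i).const_mul _
  have hSint : ∀ j, ∫ ω, ∑ i ∈ Finset.range j, h i * ‖D' i ω‖ ^ 2 ∂P =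
      ∑ i ∈ Finset.range j, h i * u i := fun j => by
    rw [integral_finsetSum _ fun i _ => (hD'i i).const_mul _]
    simp only [integral_const_mul, u]
  have hUm : ∀ j, AEStronglyMeasurable (fun ω => U j ω ^ 2) P := fun j =>
    ((Finset.stronglyMeasurable_fun_sum _ fun i _ =>
      ((((hD'm i).mono (F.le _)).norm.const_mul L).const_mul (h i))).pow 2).aestronglyMeasurable
  have hUi : ∀ j, Integrable (fun ω => U j ω ^ 2) P := fun j =>
    ((hSi j).const_mul (T * L ^ 2)).mono' (hUm j) (ae_of_all _ fun ω => by
      rw [Real.norm_of_nonneg (sq_nonneg _)]; exact hUsq j ω)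
  have hUint : ∀ j, ∫ ω, U j ω ^ 2 ∂P ≤ T * L ^ 2 * ∑ i ∈ Finset.range j, h i * u i := fun j => by
    rw [← hSint, ← integral_const_mul]
    exact integral_mono (hUi j) ((hSi j).const_mul _) (hUsq j)
  -- on `A j`, the difference is a Lipschitz drift, a martingale and the residual
  have hdecomp : ∀ j ω, ω ∈ A j → ‖D j ω‖ ≤ U j ω + ‖M j ω‖ + η := fun j ω hω => by
    have e : D j ω = (∑ i ∈ Finset.range j, h i • (β i (X i ω) - β i (Y i ω))) + M j ω + r j ω := by
      have hM : M j ω = ∑ i ∈ Finset.range j, B (D i ω) (W (g (i + 1)) ω - W (g i) ω) :=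
        Finset.sum_congr rfl fun i hi => by
          have : ω ∈ A i := hAanti i j (Finset.mem_range.1 hi).le hω
          simp only [ξ, Φ, hD', Set.indicator_of_mem this]
      rw [hM, ← Finset.sum_add_distrib]
      simp only [r, residual, D, hh]
      abel
    rw [e]
    refine norm_add₃_le.trans (add_le_add (add_le_add_left ?_ _) (hω j le_rfl).2.2)
    refine (norm_sum_le _ _).trans (Finset.sum_le_sum fun i hi => ?_)
    have hi' : ω ∈ A i := hAanti i j (Finset.mem_range.1 hi).le hω
    rw [norm_smul, Real.norm_of_nonneg (hpos i)]
    simp only [hD', Set.indicator_of_mem hi']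
    exact mul_le_mul_of_nonneg_left (hβL i _ _ (hi' i le_rfl).1 (hi' i le_rfl).2.1) (hpos i)
  have hM2 := fun j => integrable_normSq_of_memLp (hmd.memLp_sum j)
  have hMint : ∀ j, ∫ ω, ‖M j ω‖ ^ 2 ∂P ≤ c * ∑ i ∈ Finset.range j, h i * u i := fun j => by
    rw [hmd.integral_normSq_sum j]; exact hξu j
  have hsq : ∀ j ω, ‖D' j ω‖ ^ 2 ≤ 3 * (U j ω ^ 2 + ‖M j ω‖ ^ 2 + η ^ 2) := fun j ω => by
    by_cases hω : ω ∈ A j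
    · simp only [hD', Set.indicator_of_mem hω]
      have h1 := pow_le_pow_left₀ (norm_nonneg _) (hdecomp j ω hω) 2
      nlinarith [sq_nonneg (U j ω - ‖M j ω‖), sq_nonneg (U j ω - η), sq_nonneg (‖M j ω‖ - η)]
    · simp only [hD', Set.indicator_of_notMem hω]
      rw [norm_zero, zero_pow two_ne_zero]
      positivity
  have hu : ∀ j, u j ≤ 3 * η ^ 2 + 3 * c0 * ∑ i ∈ Finset.range j, h i * u i := fun j => by
    have i1 : Integrable (fun ω => U j ω ^ 2 + ‖M j ω‖ ^ 2) P := (hUi j).add (hM2 j)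
    have i2 : Integrable (fun ω => U j ω ^ 2 + ‖M j ω‖ ^ 2 + η ^ 2) P :=
      i1.add (integrable_const _)
    have h1 : u j ≤ ∫ ω, 3 * (U j ω ^ 2 + ‖M j ω‖ ^ 2 + η ^ 2) ∂P :=
      integral_mono (hD'i j) (i2.const_mul 3) (hsq j)
    rw [integral_const_mul, integral_add i1 (integrable_const _), integral_add (hUi j) (hM2 j)] at h1
    simp only [integral_const, probReal_univ, smul_eq_mul, one_mul] at h1
    have := hUint j
    have := hMint j
    simp only [c0]
    linarith
  -- Gronwall: the second moment of the switched-off difference is of order `η ^ 2`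
  have hgron := le_mul_exp_of_le_add_sum (by positivity : 0 ≤ 3 * η ^ 2)
    (by positivity : 0 ≤ 3 * c0) hpos hu
  have hub : ∀ j, u j ≤ 3 * η ^ 2 * Real.exp (3 * c0 * T) := fun j =>
    (hgron j).trans (by gcongr; exact hsumh j)
  set S := ∑ i ∈ Finset.range n, h i * u i
  have hS : S ≤ T * (3 * η ^ 2 * Real.exp (3 * c0 * T)) := by
    calc S ≤ ∑ i ∈ Finset.range n, h i * (3 * η ^ 2 * Real.exp (3 * c0 * T)) :=
          Finset.sum_le_sum fun i _ => mul_le_mul_of_nonneg_left (hub i) (hpos i)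
      _ = (∑ i ∈ Finset.range n, h i) * _ := by rw [Finset.sum_mul]
      _ ≤ _ := by gcongr; exact hsumh n
  -- since `η < ε / 3`, a difference of size `ε` forces the drift or the martingale above `ε / 3`
  have hε3 : 0 < ε / 3 := by positivity
  have hp1 := measure_le_ofReal_of_integral_sq (hUi n) hε3 (hUint n)
  have hp2 := hmd.measure_exists_le_norm_sum_le n hε3
  have hsub : {ω | (∀ j ≤ n, ‖X j ω‖ ≤ R ∧ ‖Y j ω‖ ≤ R ∧ ‖residual B W g β X Y j ω‖ ≤ η) ∧
        ∃ j ≤ n, ε ≤ ‖X j ω - Y j ω‖} ⊆ {ω | ε / 3 ≤ U n ω} ∪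
        {ω | ∃ j ≤ n, ε / 3 ≤ ‖∑ i ∈ Finset.range j, ξ i ω‖} := by
    rintro ω ⟨hω, j, hj, hj'⟩
    have hωj : ω ∈ A j := fun i hi => hω i (hi.trans hj)
    have h1 := hdecomp j ω hωj
    by_cases h2 : ε / 3 ≤ ‖M j ω‖
    · exact .inr ⟨j, hj, h2⟩
    · left
      have h3 : U j ω ≤ U n ω := Finset.sum_le_sum_of_subset_of_nonneg (Finset.range_mono hj)
        fun i _ _ => mul_nonneg (hpos i) (by positivity)
      have h4 : ε ≤ ‖D j ω‖ := hj'
      simp only [Set.mem_ofPred_eq]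
      linarith
  refine (measure_mono hsub).trans ((measure_union_le _ _).trans ((add_le_add hp1 hp2).trans ?_))
  have hS0 : 0 ≤ S := Finset.sum_nonneg fun i _ => mul_nonneg (hpos i)
    (integral_nonneg fun _ => by positivity)
  have hξ0 : 0 ≤ ∑ i ∈ Finset.range n, ∫ ω, ‖ξ i ω‖ ^ 2 ∂P :=
    Finset.sum_nonneg fun i _ => integral_nonneg fun _ => by positivity
  rw [← ENNReal.ofReal_add (by positivity) (by positivity)]
  refine ENNReal.ofReal_le_ofReal ?_
  rw [← add_div, div_pow, div_div_eq_mul_div]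
  refine div_le_div_of_nonneg_right ?_ (by positivity)
  have h5 := hξu n
  have h6 : c0 * S ≤ c0 * (T * (3 * η ^ 2 * Real.exp (3 * c0 * T))) := by gcongr
  have h7 : 0 ≤ c0 * (T * (3 * η ^ 2 * Real.exp (3 * c0 * T))) := by positivity
  have h8 : c0 * S = T * L ^ 2 * S + c * S := by simp only [c0]; ring
  calc (T * L ^ 2 * S + ∑ i ∈ Finset.range n, ∫ ω, ‖ξ i ω‖ ^ 2 ∂P) * 3 ^ 2
      ≤ (c0 * S) * 3 ^ 2 := by rw [h8]; gcongr
    _ ≤ (c0 * (T * (3 * η ^ 2 * Real.exp (3 * c0 * T)))) * 3 ^ 2 := by gcongr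
    _ = _ := by ring

end Stability

/-! ### Energy estimate for the Euler recursion -/

section Energy

variable {Hd Hi Ω : Type*} [NormedAddCommGroup Hd] [InnerProductSpace ℝ Hd]
  [NormedAddCommGroup Hi] [InnerProductSpace ℝ Hi] {mΩ : MeasurableSpace Ω}
  {F : Filtration ℝ≥0 mΩ} {P : Measure Ω} [IsProbabilityMeasure P]
  {f : HilbertBasis ℕ ℝ Hi} {Q : Hi →L[ℝ] Hi} {q : ℕ → ℝ} {W : ℝ≥0 → Ω → Hi}
  [MeasurableSpace Hi] [BorelSpace Hi] [FiniteDimensional ℝ Hd] [CompleteSpace Hi]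

set_option maxHeartbeats 1000000 in
/-- Energy estimate for the Euler recursion with a coercive drift: the probability of leaving the
ball of radius `R` is `O(1 / R²)`, uniformly in all grids which are fine enough in terms of the size
of the drift on that ball. -/
lemma exists_measure_exists_lt_norm_le (hW : IsQWiener F P Q W)
    (hQ : ∀ m, Q (f m) = q m • f m) (hq : ∀ m, 0 ≤ q m) (hq_sum : Summable q)
    (A₁ : Hi →L[ℝ] Hd) (B : Hd →L[ℝ] Hi →L[ℝ] Hd) (T : ℝ≥0) {κ cZ : ℝ} (hκ : 0 ≤ κ)
    (hcZ : 0 ≤ cZ) :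
    ∃ K : ℝ, 0 ≤ K ∧ ∀ (g : ℕ → ℝ≥0) (hg : Monotone g), (∀ j, g j ≤ T) → ∀ b : ℕ → Hd → Hd,
      (∀ i, Continuous (b i)) → (∀ i x, ⟪x, b i x⟫ ≤ κ * (1 + ‖x‖ ^ 2)) → ∀ R : ℝ, 0 < R →
      (∀ i x, ‖x‖ ≤ R → ((g (i + 1) : ℝ) - g i) * ‖b i x‖ ^ 2 ≤ 1) →
      ∀ ζ : ℕ → Ω → Hd, IsMartingaleDiff (sampled F hg) P ζ →
      (∀ i, ∫ ω, ‖ζ i ω‖ ^ 2 ∂P ≤ cZ * ((g (i + 1) : ℝ) - g i)) →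
      ∀ X : ℕ → Ω → Hd, (∀ j, StronglyMeasurable[F (g j)] (X j)) → MemLp (X 0) 2 P →
      (∀ j ω, X (j + 1) ω = X j ω + ((g (j + 1) : ℝ) - g j) • b j (X j ω) +
        ((A₁ + B (X j ω)) (W (g (j + 1)) ω - W (g j) ω) + ζ j ω)) → ∀ n,
      P {ω | ∃ j ≤ n, R < ‖X j ω‖} ≤
        ENNReal.ofReal (K * (1 + ∫ ω, ‖X 0 ω‖ ^ 2 ∂P) / R ^ 2) := by
  set τ := ∑' m, q m
  have hτ : 0 ≤ τ := tsum_nonneg hq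
  set C := 2 * κ + 1 + 4 * τ * (‖A₁‖ ^ 2 + ‖B‖ ^ 2) + 2 * cZ with hC
  have hC0 : 0 ≤ C := by positivity
  refine ⟨Real.exp (C * T), by positivity, ?_⟩
  intro g hg hgT b hb hbκ R hR hbR ζ hζ hζ2 X hX hX0 hrec n
  set h : ℕ → ℝ := fun i => (g (i + 1) : ℝ) - g i with hh
  have hpos : ∀ i, 0 ≤ h i := fun i => sub_nonneg.2 (by exact_mod_cast hg (Nat.le_succ i))
  have hsumh : ∀ j, ∑ i ∈ Finset.range j, h i ≤ T := fun j => by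
    rw [Finset.sum_range_sub (fun i => (g i : ℝ))]
    have h1 : (g j : ℝ) ≤ T := by exact_mod_cast hgT j
    have h2 : (0 : ℝ) ≤ g 0 := (g 0).2
    linarith
  -- the process has stayed in the ball up to the time `g j`
  set A : ℕ → Set Ω := fun j => {ω | ∀ i ≤ j, ‖X i ω‖ ≤ R} with hA
  have hAm : ∀ j, MeasurableSet[F (g j)] (A j) := fun j => by
    have : A j = ⋂ i ≤ j, {ω | ‖X i ω‖ ≤ R} := by
      ext ω; simp [hA]
    rw [this]
    exact MeasurableSet.iInter fun i => MeasurableSet.iInter fun hi =>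
      ((hX i).mono (F.mono (hg hi))).norm.measurableSet_le stronglyMeasurable_const
  have hAm' : ∀ j, MeasurableSet (A j) := fun j => F.le _ _ (hAm j)
  have hAanti : ∀ j, A (j + 1) ⊆ A j := fun j ω hω k hk => hω k (by omega)
  set X' : ℕ → Ω → Hd := fun j => (A j).indicator (X j) with hX'
  have hX'm : ∀ j, StronglyMeasurable[F (g j)] (X' j) := fun j => (hX j).indicator (hAm j)
  have hX'le : ∀ j ω, ‖X' j ω‖ ≤ R := fun j ω => by
    by_cases hω : ω ∈ A j
    · simpa only [hX', Set.indicator_of_mem hω] using hω j le_rfl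
    · simpa [hX', Set.indicator_of_notMem hω] using hR.le
  have hX'2 : ∀ j, MemLp (X' j) 2 P := fun j =>
    MemLp.of_bound ((hX'm j).mono (F.le _)).aestronglyMeasurable _ (ae_of_all _ (hX'le j))
  have hX'i := fun j => integrable_normSq_of_memLp (hX'2 j)
  set v : ℕ → ℝ := fun j => ∫ ω, ‖X' j ω‖ ^ 2 ∂P with hv
  have hv0 : ∀ j, 0 ≤ v j := fun j => integral_nonneg fun _ => by positivity
  -- `w j` replaces the second moment of the process stopped at its exit from the ball: a path which
  -- has left the ball counts as `R ^ 2`, less than its true value, whatever the overshoot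
  set w : ℕ → ℝ := fun j => v j + R ^ 2 * P.real (A j)ᶜ with hw
  have hstep : ∀ j, w (j + 1) ≤ w j + C * (h j * (1 + v j)) := by
    intro j
    -- the predictable part of the step
    set p : Ω → Hd := fun ω => X' j ω + (A j).indicator (fun ω => h j • b j (X j ω)) ω with hp
    have hpm : StronglyMeasurable[F (g j)] p := (hX'm j).add
      ((((hb j).comp_stronglyMeasurable (hX j)).const_smul (h j)).indicator (hAm j))
    have hpsq : ∀ ω, ‖p ω‖ ^ 2 ≤ ‖X' j ω‖ ^ 2 + h j * (2 * κ * (1 + ‖X' j ω‖ ^ 2) + 1) := by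
      intro ω
      by_cases hω : ω ∈ A j
      · simp only [hp, hX', Set.indicator_of_mem hω]
        rw [norm_add_sq_real, inner_smul_right, norm_smul, Real.norm_of_nonneg (hpos j)]
        have h1 := mul_le_mul_of_nonneg_left (hbκ j (X j ω)) (hpos j)
        have h2 := mul_le_mul_of_nonneg_left (hbR j (X j ω) (hω j le_rfl)) (hpos j)
        simp only [hh] at h1 h2 ⊢
        nlinarith
      · simp only [hp, hX', Set.indicator_of_notMem hω, add_zero, norm_zero,
          zero_pow (M₀ := ℝ) two_ne_zero]
        have := hpos j
        positivity
    have hpi : Integrable (fun ω => ‖p ω‖ ^ 2) P := by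
      refine Integrable.mono'
        (g := fun ω => ‖X' j ω‖ ^ 2 + h j * (2 * κ * (1 + ‖X' j ω‖ ^ 2) + 1)) ?_
        (((hpm.mono (F.le _)).norm.pow 2).aestronglyMeasurable)
        (ae_of_all _ fun ω => by rw [Real.norm_of_nonneg (by positivity)]; exact hpsq ω)
      exact (hX'i j).add (((((integrable_const _).add (hX'i j)).const_mul _).add
        (integrable_const _)).const_mul _)
    have hp2 : MemLp p 2 P :=
      (memLp_two_iff_integrable_sq_norm (hpm.mono (F.le _)).aestronglyMeasurable).2 hpi
    -- the martingale part of the step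
    set Φ : Ω → Hi →L[ℝ] Hd := (A j).indicator fun ω => A₁ + B (X j ω) with hΦ
    have hΦm : StronglyMeasurable[F (g j)] Φ :=
      (stronglyMeasurable_const.add (B.continuous.comp_stronglyMeasurable (hX j))).indicator (hAm j)
    have hΦb : ∀ ω, hsNormSq f q (Φ ω) ≤
        ENNReal.ofReal (τ * (2 * ‖A₁‖ ^ 2 + 2 * ‖B‖ ^ 2 * ‖X' j ω‖ ^ 2)) := fun ω => by
      refine (hsNormSq_le f hq hq_sum _).trans (ENNReal.ofReal_le_ofReal ?_)
      refine mul_le_mul_of_nonneg_left ?_ hτ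
      by_cases hω : ω ∈ A j
      · simp only [hΦ, hX', Set.indicator_of_mem hω]
        have h1 : ‖A₁ + B (X j ω)‖ ≤ ‖A₁‖ + ‖B‖ * ‖X j ω‖ :=
          (norm_add_le _ _).trans (by gcongr; exact B.le_opNorm _)
        have h2 := pow_le_pow_left₀ (norm_nonneg _) h1 2
        nlinarith [sq_nonneg (‖A₁‖ - ‖B‖ * ‖X j ω‖)]
      · simp only [hΦ, hX', Set.indicator_of_notMem hω, norm_zero, zero_pow (M₀ := ℝ) two_ne_zero]
        positivity
    have hΦi : Integrable (fun ω => τ * (2 * ‖A₁‖ ^ 2 + 2 * ‖B‖ ^ 2 * ‖X' j ω‖ ^ 2)) P :=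
      ((integrable_const _).add ((hX'i j).const_mul _)).const_mul _
    obtain ⟨hfin, hΦ2⟩ := hW.integral_normSq_apply_le hQ hq (hg (Nat.le_succ j)) hΦm hΦi
      (fun ω => by positivity) hΦb
    set N : Ω → Hd := fun ω => Φ ω (W (g (j + 1)) ω - W (g j) ω) with hN
    have hN2 : MemLp N 2 P := hW.memLp_apply hQ hq (hg (Nat.le_succ j)) hΦm hfin
    have hNζ2 : MemLp (fun ω => N ω + ζ j ω) 2 P := hN2.add (hζ.memLp j)
    have hNi := integrable_normSq_of_memLp hN2
    have hζi := integrable_normSq_of_memLp (hζ.memLp j)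
    have hN0 : ∫ ω, ⟪p ω, N ω⟫ ∂P = 0 :=
      hW.integral_inner_apply hQ hq (hg (Nat.le_succ j)) hΦm hfin hpm hp2
    have hζ0 : ∫ ω, ⟪p ω, ζ j ω⟫ ∂P = 0 := hζ.orth j p hpm hp2
    have hcross : ∫ ω, ⟪p ω, N ω + ζ j ω⟫ ∂P = 0 := by
      simp only [inner_add_right]
      rw [integral_add (integrable_inner_of_memLp hp2 hN2)
        (integrable_inner_of_memLp hp2 (hζ.memLp j)), hN0, hζ0, add_zero]
    have hNζi := integrable_normSq_of_memLp hNζ2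
    have hNζ : ∫ ω, ‖N ω + ζ j ω‖ ^ 2 ∂P ≤
        2 * (h j * (τ * (2 * ‖A₁‖ ^ 2 + 2 * ‖B‖ ^ 2 * v j))) + 2 * (cZ * h j) := by
      have h1 : ∫ ω, ‖N ω + ζ j ω‖ ^ 2 ∂P ≤ ∫ ω, (2 * ‖N ω‖ ^ 2 + 2 * ‖ζ j ω‖ ^ 2) ∂P := by
        refine integral_mono hNζi ((hNi.const_mul 2).add (hζi.const_mul 2)) fun ω => ?_
        have h2 := pow_le_pow_left₀ (norm_nonneg _) (norm_add_le (N ω) (ζ j ω)) 2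
        simp only
        nlinarith [sq_nonneg (‖N ω‖ - ‖ζ j ω‖)]
      rw [integral_add (hNi.const_mul 2) (hζi.const_mul 2), integral_const_mul,
        integral_const_mul] at h1
      rw [integral_const_mul, integral_add (integrable_const _) ((hX'i j).const_mul _)] at hΦ2
      simp only [integral_const_mul, integral_const, probReal_univ, smul_eq_mul, one_mul] at hΦ2
      have h3 := hζ2 j
      refine h1.trans (add_le_add ?_ ?_)
      · exact mul_le_mul_of_nonneg_left hΦ2 zero_le_two
      · exact mul_le_mul_of_nonneg_left h3 zero_le_two
    have hpint : ∫ ω, ‖p ω‖ ^ 2 ∂P ≤ v j + h j * (2 * κ * (1 + v j) + 1) := by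
      have i1 : Integrable (fun ω => h j * (2 * κ * (1 + ‖X' j ω‖ ^ 2) + 1)) P :=
        ((((integrable_const _).add (hX'i j)).const_mul _).add (integrable_const _)).const_mul _
      have h1 := integral_mono hpi ((hX'i j).add i1) hpsq
      have i2 : Integrable (fun ω => 1 + ‖X' j ω‖ ^ 2) P := (integrable_const _).add (hX'i j)
      simp only [Pi.add_apply] at h1
      rw [integral_add (hX'i j) i1, integral_const_mul,
        integral_add (i2.const_mul _) (integrable_const _), integral_const_mul,
        integral_add (integrable_const _) (hX'i j)] at h1
      simpa using h1
    have htotal : ∫ ω, ‖p ω + (N ω + ζ j ω)‖ ^ 2 ∂P ≤ v j + C * (h j * (1 + v j)) := by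
      have e : ∀ ω, ‖p ω + (N ω + ζ j ω)‖ ^ 2 =
          ‖p ω‖ ^ 2 + 2 * ⟪p ω, N ω + ζ j ω⟫ + ‖N ω + ζ j ω‖ ^ 2 := fun ω => norm_add_sq_real _ _
      have i1 := (integrable_inner_of_memLp hp2 hNζ2).const_mul 2
      have i2 : Integrable (fun ω => ‖p ω‖ ^ 2 + 2 * ⟪p ω, N ω + ζ j ω⟫) P := hpi.add i1
      simp only [e]
      rw [integral_add i2 hNζi, integral_add hpi i1, integral_const_mul, hcross]
      have hvj := hv0 j
      have hj := hpos j
      have k1 : 0 ≤ h j * v j := by positivity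
      have k2 : 0 ≤ h j * (τ * ‖A₁‖ ^ 2) * v j := by positivity
      have k3 : 0 ≤ h j * (τ * ‖B‖ ^ 2) := by positivity
      have k4 : 0 ≤ cZ * (h j * v j) := by positivity
      simp only [hC]
      nlinarith
    -- leaving the ball in this step costs `R ^ 2`
    have hlow : w (j + 1) - R ^ 2 * P.real (A j)ᶜ ≤ ∫ ω, ‖p ω + (N ω + ζ j ω)‖ ^ 2 ∂P := by
      have hpt : ∀ ω, ‖X' (j + 1) ω‖ ^ 2 + (A j \ A (j + 1)).indicator (fun _ => R ^ 2) ω ≤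
          ‖p ω + (N ω + ζ j ω)‖ ^ 2 := by
        intro ω
        by_cases hω : ω ∈ A j
        · have e : p ω + (N ω + ζ j ω) = X (j + 1) ω := by
            simp only [hp, hN, hΦ, hX', Set.indicator_of_mem hω, hrec j ω, hh]
          rw [e]
          by_cases hω' : ω ∈ A (j + 1)
          · simp [hX', hω']
          · have hlt : R < ‖X (j + 1) ω‖ := by
              by_contra hle
              refine hω' fun i hi => ?_
              rcases Nat.lt_succ_iff_lt_or_eq.1 (Nat.lt_succ_of_le hi) with h1 | h1
              · exact hω i (by omega)
              · rw [h1]; exact not_lt.1 hle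
            simp only [hX', Set.indicator_of_notMem hω',
              Set.indicator_of_mem (show ω ∈ A j \ A (j + 1) from ⟨hω, hω'⟩), norm_zero]
            nlinarith
        · have hω' : ω ∉ A (j + 1) := fun h' => hω (hAanti j h')
          have hω'' : ω ∉ A j \ A (j + 1) := fun h' => hω h'.1
          simp only [hX', Set.indicator_of_notMem hω', Set.indicator_of_notMem hω'', norm_zero,
            zero_pow (M₀ := ℝ) two_ne_zero, add_zero]
          positivity
      have hm := (hAm' j).diff (hAm' (j + 1))
      have i1 : Integrable ((A j \ A (j + 1)).indicator fun _ : Ω => R ^ 2) P :=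
        (integrable_const _).indicator hm
      have h1 := integral_mono ((hX'i (j + 1)).add i1)
        (integrable_normSq_of_memLp (hp2.add hNζ2)) hpt
      simp only [Pi.add_apply] at h1
      rw [integral_add (hX'i (j + 1)) i1, integral_indicator_const _ hm] at h1
      have h2 : P.real (A (j + 1))ᶜ = P.real (A j)ᶜ + P.real (A j \ A (j + 1)) := by
        rw [← measureReal_union ?_ hm]
        · congr 1
          ext ω
          have := @hAanti j ω
          simp only [Set.mem_compl_iff, Set.mem_union, Set.mem_sdiff]
          tauto
        · exact Set.disjoint_left.2 fun ω h1 h2 => h1 h2.1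
      simp only [hw, h2]
      rw [smul_eq_mul] at h1
      simp only [hv]
      linarith
    simp only [hw] at hlow ⊢
    linarith
  have hw0 : w 0 ≤ ∫ ω, ‖X 0 ω‖ ^ 2 ∂P := by
    have hpt : ∀ ω, ‖X' 0 ω‖ ^ 2 + (A 0)ᶜ.indicator (fun _ => R ^ 2) ω ≤ ‖X 0 ω‖ ^ 2 := by
      intro ω
      by_cases hω : ω ∈ A 0
      · simp [hX', hω]
      · have hlt : R < ‖X 0 ω‖ := by
          by_contra hle
          exact hω fun i hi => by rw [Nat.le_zero.1 hi]; exact not_lt.1 hle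
        simp only [hX', Set.indicator_of_notMem hω,
          Set.indicator_of_mem (show ω ∈ (A 0)ᶜ from hω), norm_zero]
        nlinarith
    have i1 : Integrable ((A 0)ᶜ.indicator fun _ : Ω => R ^ 2) P :=
      (integrable_const _).indicator (hAm' 0).compl
    have h1 := integral_mono ((hX'i 0).add i1) (integrable_normSq_of_memLp hX0) hpt
    simp only [Pi.add_apply] at h1
    rw [integral_add (hX'i 0) i1, integral_indicator_const _ (hAm' 0).compl, smul_eq_mul] at h1
    simp only [hw, hv]
    linarith
  have hwsum : ∀ j, 1 + w j ≤ (1 + w 0) + C * ∑ i ∈ Finset.range j, h i * (1 + w i) := by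
    intro j
    induction j with
    | zero => simp
    | succ j ih =>
      rw [Finset.sum_range_succ, mul_add]
      have h1 := hstep j
      have h2 : C * (h j * (1 + v j)) ≤ C * (h j * (1 + w j)) := by
        have := hpos j
        have h3 : v j ≤ w j := by
          simp only [hw]
          have : 0 ≤ R ^ 2 * P.real (A j)ᶜ := by positivity
          linarith
        gcongr
      linarith
  have hw0' : 0 ≤ w 0 := add_nonneg (hv0 0) (by positivity)
  have hgron := le_mul_exp_of_le_add_sum (by positivity : 0 ≤ 1 + w 0) hC0 hpos hwsum n
  have hfinal : R ^ 2 * P.real (A n)ᶜ ≤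
      Real.exp (C * T) * (1 + ∫ ω, ‖X 0 ω‖ ^ 2 ∂P) := by
    have h1 : R ^ 2 * P.real (A n)ᶜ ≤ 1 + w n := by
      simp only [hw]
      have := hv0 n
      linarith
    refine h1.trans (hgron.trans ?_)
    rw [mul_comm]
    have := hsumh n
    gcongr
  have hset : {ω | ∃ j ≤ n, R < ‖X j ω‖} = (A n)ᶜ := by
    ext ω; simp [hA]
  rw [hset, ← ofReal_measureReal]
  refine ENNReal.ofReal_le_ofReal ?_
  rw [le_div_iff₀ (by positivity)]
  linarith

end Energy

/-! ### Uniform convergence in probability -/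

section UniformProbability

variable {E Ω : Type*} [NormedAddCommGroup E] {mΩ : MeasurableSpace Ω} {P : Measure Ω}

lemma measure_le_of_ae_imp {A B : Set Ω} (h : ∀ᵐ ω ∂P, ω ∈ A → ω ∈ B) : P A ≤ P B :=
  measure_mono_ae h

/-- A sequence of processes which is Cauchy in probability, uniformly on `[0, T]`, converges in this
sense, and a subsequence of it converges uniformly on `[0, T]`, almost surely. -/
lemma exists_tendsto_of_cauchy_in_measure [CompleteSpace E] (T : ℝ≥0) (Y : ℕ → ℝ≥0 → Ω → E)
    (hY : ∀ ε : ℝ, 0 < ε → ∃ K, ∀ k ≥ K, ∀ l ≥ K,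
      P {ω | ∃ t ≤ T, ε ≤ ‖Y k t ω - Y l t ω‖} ≤ ENNReal.ofReal ε) :
    ∃ (X : ℝ≥0 → Ω → E) (φ : ℕ → ℕ), StrictMono φ ∧
      (∀ᵐ ω ∂P, TendstoUniformlyOn (fun k t => Y (φ k) t ω) (fun t => X t ω) atTop (Set.Iic T)) ∧
      ∀ δ : ℝ, 0 < δ → Tendsto (fun k => P {ω | ∃ t ≤ T, δ ≤ ‖Y k t ω - X t ω‖}) atTop (𝓝 0) := by
  have hpow : ∀ n : ℕ, (0 : ℝ) < (1 / 2) ^ n := fun n => by positivity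
  obtain ⟨φ, hφ, hφY⟩ := Filter.extraction_forall_of_eventually'
    (P := fun n k => ∀ l ≥ k, P {ω | ∃ t ≤ T, (1 / 2 : ℝ) ^ n ≤ ‖Y k t ω - Y l t ω‖} ≤
      ENNReal.ofReal ((1 / 2) ^ n)) (fun n => by
      obtain ⟨K, hK⟩ := hY _ (hpow n)
      exact ⟨K, fun k hk l hl => hK k hk l (le_trans hk hl)⟩)
  set S : ℕ → Set Ω := fun k =>
    {ω | ∃ t ≤ T, (1 / 2 : ℝ) ^ k ≤ ‖Y (φ k) t ω - Y (φ (k + 1)) t ω‖} with hS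
  have hPS : ∀ k, P (S k) ≤ ENNReal.ofReal ((1 / 2) ^ k) := fun k =>
    hφY k _ (hφ.monotone (Nat.le_succ k))
  have hsum : ∑' k : ℕ, ENNReal.ofReal ((1 / 2 : ℝ) ^ k) ≠ ∞ := by
    rw [← ENNReal.ofReal_tsum_of_nonneg (fun k => (hpow k).le) summable_geometric_two]
    exact ENNReal.ofReal_ne_top
  -- outside `S k` for `k ≥ K`, the subsequence is uniformly Cauchy; `limUnder` is junk elsewhere
  set X : ℝ≥0 → Ω → E := fun t ω => limUnder atTop fun k => Y (φ k) t ω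
  have key : ∀ K ω, (∀ k ≥ K, ω ∉ S k) → ∀ k ≥ K, ∀ t ≤ T,
      ‖Y (φ k) t ω - X t ω‖ ≤ 2 * (1 / 2) ^ k := by
    intro K ω hω k hk t ht
    have hd : ∀ n, dist (Y (φ (n + k)) t ω) (Y (φ (n + 1 + k)) t ω) ≤
        (1 / 2 : ℝ) ^ k * (1 / 2) ^ n := fun n => by
      have h1 := hω (n + k) (by omega)
      simp only [hS, Set.mem_ofPred_eq, not_exists, not_and, not_le] at h1
      rw [dist_eq_norm, ← pow_add, add_comm k n, show n + 1 + k = n + k + 1 by ring]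
      exact (h1 t ht).le
    have hc := cauchySeq_of_le_geometric _ _ (by norm_num) hd
    obtain ⟨x, hx⟩ := cauchySeq_tendsto_of_complete hc
    have hx' : Tendsto (fun n => Y (φ n) t ω) atTop (𝓝 x) := (tendsto_add_atTop_iff_nat k).1 hx
    have hX : X t ω = x := hx'.limUnder_eq
    have h2 := dist_le_of_le_geometric_of_tendsto₀ _ _ (by norm_num) hd hx
    rw [hX, ← dist_eq_norm]
    convert! h2 using 1
    · simp
    · norm_num; ring
  refine ⟨X, φ, hφ, ?_, fun δ hδ => ?_⟩
  · have h1 := ae_eventually_notMem (μ := P) (s := S)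
      (ne_top_of_le_ne_top hsum (ENNReal.tsum_le_tsum hPS))
    filter_upwards [h1] with ω hω
    obtain ⟨K, hK⟩ := eventually_atTop.1 hω
    rw [Metric.tendstoUniformlyOn_iff]
    intro ε hε
    have h2 : Tendsto (fun k : ℕ => 2 * (1 / 2 : ℝ) ^ k) atTop (𝓝 0) := by
      simpa using (tendsto_pow_atTop_nhds_zero_of_lt_one (by norm_num)
        (by norm_num : (1 / 2 : ℝ) < 1)).const_mul 2
    filter_upwards [h2.eventually_lt_const hε, eventually_ge_atTop K] with k hk hkK t ht
    rw [dist_comm, dist_eq_norm]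
    exact (key K ω hK k hkK t ht).trans_lt hk
  · rw [ENNReal.tendsto_nhds_zero]
    intro ε hε
    obtain ⟨ε', hε', hεε⟩ : ∃ ε' : ℝ, 0 < ε' ∧ ENNReal.ofReal ε' ≤ ε / 2 := by
      obtain ⟨r, hr, hr'⟩ := ENNReal.lt_iff_exists_nnreal_btwn.1 (ENNReal.half_pos hε.ne')
      exact ⟨r, by exact_mod_cast hr, by simpa using hr'.le⟩
    have h2 : Tendsto (fun k : ℕ => 2 * (1 / 2 : ℝ) ^ k) atTop (𝓝 0) := by
      simpa using (tendsto_pow_atTop_nhds_zero_of_lt_one (by norm_num)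
        (by norm_num : (1 / 2 : ℝ) < 1)).const_mul 2
    have h3 := ENNReal.tendsto_sum_nat_add _ hsum
    have hmin : 0 < min ε' (δ / 2) := lt_min hε' (by positivity)
    obtain ⟨K, hK⟩ := hY _ hmin
    obtain ⟨m, hm1, hm2, hm3⟩ := ((h2.eventually_lt_const (half_pos hδ)).and
      ((h3.eventually_le_const (ENNReal.half_pos hε.ne')).and (eventually_ge_atTop K))).exists
    filter_upwards [eventually_ge_atTop K] with k hk
    have hφm : K ≤ φ m := hm3.trans (hφ.id_le m)
    have hsub : {ω | ∃ t ≤ T, δ ≤ ‖Y k t ω - X t ω‖} ⊆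
        {ω | ∃ t ≤ T, min ε' (δ / 2) ≤ ‖Y k t ω - Y (φ m) t ω‖} ∪ ⋃ j, S (j + m) := by
      rintro ω ⟨t, ht, htδ⟩
      by_cases hω : ω ∈ ⋃ j, S (j + m)
      · exact .inr hω
      · left
        have h4 := key m ω (fun j hj hjS => hω (Set.mem_iUnion.2
          ⟨j - m, by rwa [Nat.sub_add_cancel hj]⟩)) m le_rfl t ht
        have h5 := norm_sub_le_norm_sub_add_norm_sub (Y k t ω) (Y (φ m) t ω) (X t ω)
        exact ⟨t, ht, (min_le_right _ _).trans (by linarith)⟩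
    calc P {ω | ∃ t ≤ T, δ ≤ ‖Y k t ω - X t ω‖}
        ≤ ENNReal.ofReal (min ε' (δ / 2)) + ∑' j, P (S (j + m)) :=
          (measure_mono hsub).trans ((measure_union_le _ _).trans
            (add_le_add (hK k hk _ hφm) (measure_iUnion_le _)))
      _ ≤ ε / 2 + ε / 2 := by
          refine add_le_add ((ENNReal.ofReal_le_ofReal (min_le_left _ _)).trans hεε) ?_
          exact (ENNReal.tsum_le_tsum fun j => hPS (j + m)).trans hm2
      _ = ε := ENNReal.add_halves ε

/-- Increasing events which exhaust the sample space have small complements eventually. -/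
lemma exists_measure_compl_le [IsFiniteMeasure P] {A : ℕ → Set Ω} (hA : ∀ k, MeasurableSet (A k))
    (hmono : Monotone A) (hU : ∀ᵐ ω ∂P, ∃ k, ω ∈ A k) {ε : ℝ≥0∞} (hε : 0 < ε) :
    ∃ k, P (A k)ᶜ ≤ ε := by
  have h1 : Tendsto (fun k => P (A k)ᶜ) atTop (𝓝 (P (⋂ k, (A k)ᶜ))) :=
    tendsto_measure_iInter_atTop (fun k => (hA k).compl.nullMeasurableSet)
      (fun i j hij => Set.compl_subset_compl.2 (hmono hij)) ⟨0, measure_ne_top _ _⟩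
  have h2 : P (⋂ k, (A k)ᶜ) = 0 := by
    rw [measure_eq_zero_iff_ae_notMem]
    filter_upwards [hU] with ω ⟨k, hk⟩ h
    exact Set.mem_iInter.1 h k hk
  rw [h2] at h1
  exact (h1.eventually_le_const hε).exists

end UniformProbability

/-! ### Dyadic grids -/

section Dyadic

/-- The dyadic grid with step `T / 2 ^ a` on `[0, T]`, stopped at `T`. -/
noncomputable def dyadic (T : ℝ≥0) (a j : ℕ) : ℝ≥0 := min (j * T / 2 ^ a) T

variable (T : ℝ≥0)

lemma dyadic_le (a j : ℕ) : dyadic T a j ≤ T := min_le_right _ _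

lemma dyadic_mono (a : ℕ) : Monotone (dyadic T a) := fun i j hij => by
  unfold dyadic
  gcongr

@[simp] lemma dyadic_zero (a : ℕ) : dyadic T a 0 = 0 := by simp [dyadic]

@[simp] lemma dyadic_two_pow (a : ℕ) : dyadic T a (2 ^ a) = T := by
  simp [dyadic, mul_comm _ T]

lemma dyadic_mul_two_pow (a b j : ℕ) : dyadic T (a + b) (j * 2 ^ b) = dyadic T a j := by
  unfold dyadic
  congr 1
  push_cast
  rw [pow_add]
  field_simp

lemma dyadic_sub_le (a j : ℕ) : (dyadic T a (j + 1) : ℝ) - dyadic T a j ≤ T / 2 ^ a := by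
  have h1 : (((j + 1 : ℕ) : ℝ) * T / 2 ^ a) = j * T / 2 ^ a + T / 2 ^ a := by push_cast; ring
  have h0 : (0 : ℝ) ≤ T / 2 ^ a := by positivity
  simp only [dyadic, NNReal.coe_min, NNReal.coe_div, NNReal.coe_mul, NNReal.coe_natCast,
    NNReal.coe_pow, NNReal.coe_ofNat]
  rw [h1]
  rcases le_total ((j : ℝ) * T / 2 ^ a) T with h2 | h2
  · rw [min_eq_left h2]
    linarith [min_le_left ((j : ℝ) * T / 2 ^ a + T / 2 ^ a) T]
  · rw [min_eq_right h2]
    linarith [min_le_right ((j : ℝ) * T / 2 ^ a + T / 2 ^ a) T]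

lemma exists_dyadic_cell (a : ℕ) {t : ℝ≥0} (ht : t ≤ T) :
    ∃ l < 2 ^ a, dyadic T a l ≤ t ∧ t ≤ dyadic T a (l + 1) := by
  by_contra! hcon
  have h : ∀ l ≤ 2 ^ a, dyadic T a l ≤ t ∧ (0 < l → dyadic T a l < t) := by
    intro l
    induction l with
    | zero => simp
    | succ l ih =>
      intro hl
      have := hcon l (by omega) (ih (by omega)).1
      exact ⟨this.le, fun _ => this⟩
  have := (h (2 ^ a) le_rfl).2 (by positivity)
  rw [dyadic_two_pow] at this
  exact absurd ht (not_le.2 this)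

lemma dist_le_of_mem_cell {a l : ℕ} {s t : ℝ≥0} (hs : dyadic T a l ≤ s)
    (hs' : s ≤ dyadic T a (l + 1)) (ht : dyadic T a l ≤ t) (ht' : t ≤ dyadic T a (l + 1)) :
    dist s t ≤ T / 2 ^ a := by
  have h := dyadic_sub_le T a l
  have h1 : (dyadic T a l : ℝ) ≤ s := by exact_mod_cast hs
  have h2 : (s : ℝ) ≤ dyadic T a (l + 1) := by exact_mod_cast hs'
  have h3 : (dyadic T a l : ℝ) ≤ t := by exact_mod_cast ht
  have h4 : (t : ℝ) ≤ dyadic T a (l + 1) := by exact_mod_cast ht'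
  rw [NNReal.dist_eq, abs_le]
  constructor <;> linarith

lemma tendsto_div_two_pow : Tendsto (fun a : ℕ => (T : ℝ) / 2 ^ a) atTop (𝓝 0) := by
  have := (tendsto_pow_atTop_nhds_zero_of_lt_one (by norm_num)
        (by norm_num : (1 / 2 : ℝ) < 1)).const_mul (T : ℝ)
  simpa [div_eq_mul_inv] using this

/-- Every time in `[0, T]` is a limit of dyadic times. -/
lemma exists_dyadic_tendsto {t : ℝ≥0} (ht : t ≤ T) :
    ∃ l : ℕ → ℕ, (∀ a, l a ≤ 2 ^ a) ∧ Tendsto (fun a => dyadic T a (l a)) atTop (𝓝 t) := by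
  choose l hl h1 h2 using fun a => exists_dyadic_cell T a ht
  refine ⟨l, fun a => (hl a).le, ?_⟩
  rw [tendsto_iff_dist_tendsto_zero]
  refine squeeze_zero (fun _ => dist_nonneg) (fun a => ?_) (tendsto_div_two_pow T)
  exact dist_le_of_mem_cell T le_rfl (dyadic_mono T a (Nat.le_succ _)) (h1 a) (h2 a)

lemma exists_dyadic_tendsto_comp {E : Type*} [TopologicalSpace E] {y : ℝ≥0 → E}
    (hy : ContinuousOn y (Set.Iic T)) {t : ℝ≥0} (ht : t ≤ T) :
    ∃ l : ℕ → ℕ, (∀ a, l a ≤ 2 ^ a) ∧ Tendsto (fun a => dyadic T a (l a)) atTop (𝓝 t) ∧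
      Tendsto (fun a => y (dyadic T a (l a))) atTop (𝓝 (y t)) := by
  obtain ⟨l, hl, h⟩ := exists_dyadic_tendsto T ht
  refine ⟨l, hl, h, (hy t ht).tendsto.comp ?_⟩
  exact tendsto_nhdsWithin_iff.2 ⟨h, .of_forall fun a => dyadic_le T a _⟩

variable {E Ω : Type*} [NormedAddCommGroup E] {mΩ : MeasurableSpace Ω} {P : Measure Ω}

/-- For a process with continuous paths, a bound on the dyadic grids is a bound on `[0, T]`. -/
lemma measure_exists_lt_le_of_dyadic {Y : ℝ≥0 → Ω → E}
    (hcont : ∀ᵐ ω ∂P, ContinuousOn (fun t => Y t ω) (Set.Iic T)) {ε : ℝ} {p : ℝ≥0∞} {a₀ : ℕ}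
    (h : ∀ a ≥ a₀, P {ω | ∃ j ≤ 2 ^ a, ε ≤ ‖Y (dyadic T a j) ω‖} ≤ p) :
    P {ω | ∃ t ≤ T, ε < ‖Y t ω‖} ≤ p := by
  set S : ℕ → Set Ω := fun a => {ω | ∃ j ≤ 2 ^ a, ε ≤ ‖Y (dyadic T a j) ω‖}
  have hmono : Monotone S := by
    refine monotone_nat_of_le_succ fun a ω ⟨j, hj, hj'⟩ => ⟨j * 2 ^ 1, ?_, ?_⟩
    · rw [pow_succ]; omega
    · rwa [dyadic_mul_two_pow]
  refine (measure_le_of_ae_imp (B := ⋃ a, S a) ?_).trans ?_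
  · filter_upwards [hcont] with ω hω ⟨t, ht, hlt⟩
    obtain ⟨l, hl, -, hlim⟩ := exists_dyadic_tendsto_comp T hω ht
    obtain ⟨a, ha⟩ := (hlim.norm.eventually_const_lt hlt).exists
    exact Set.mem_iUnion.2 ⟨a, l a, hl a, ha.le⟩
  · rw [hmono.measure_iUnion]
    refine iSup_le fun a => ?_
    exact (measure_mono (hmono (le_max_left a a₀))).trans (h _ (le_max_right a a₀))

/-- A process with continuous paths has a modulus of continuity in probability. -/
lemma exists_modulus [IsFiniteMeasure P] {Y : ℝ≥0 → Ω → E}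
    (hmeas : ∀ t ≤ T, AEStronglyMeasurable (Y t) P)
    (hcont : ∀ᵐ ω ∂P, ContinuousOn (fun t => Y t ω) (Set.Iic T)) {δ : ℝ} (hδ : 0 < δ)
    {ε : ℝ≥0∞} (hε : 0 < ε) :
    ∃ a₀ : ℕ, ∀ a ≥ a₀, P {ω | ∃ s ≤ T, ∃ t ≤ T, dist s t ≤ T / 2 ^ a ∧
      δ ≤ ‖Y s ω - Y t ω‖} ≤ ε := by
  choose Y' hY'm hY' using fun a j => hmeas (dyadic T a j) (dyadic_le T a j)
  set A : ℕ → Set Ω := fun k => {ω | ∀ a i b j,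
    dist (dyadic T a i) (dyadic T b j) < 1 / ((k : ℝ) + 1) → ‖Y' a i ω - Y' b j ω‖ ≤ δ / 2} with hA
  have hAm : ∀ k, MeasurableSet (A k) := fun k => by
    simp only [hA, Set.ofPred_forall]
    refine MeasurableSet.iInter fun a => .iInter fun i => .iInter fun b => .iInter fun j =>
      .iInter fun _ => ?_
    exact ((hY'm a i).sub (hY'm b j)).norm.measurableSet_le stronglyMeasurable_const
  have hmono : Monotone A := fun k l hkl ω hω a i b j hd => by
    refine hω a i b j (hd.trans_le ?_)
    have : (k : ℝ) ≤ l := by exact_mod_cast hkl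
    gcongr
  have hae : ∀ᵐ ω ∂P, ∀ a i, Y (dyadic T a i) ω = Y' a i ω :=
    ae_all_iff.2 fun a => ae_all_iff.2 fun i => hY' a i
  have hU : ∀ᵐ ω ∂P, ∃ k, ω ∈ A k := by
    filter_upwards [hcont, hae] with ω hω hω'
    have huc := (isCompact_Icc (a := (0 : ℝ≥0)) (b := T)).uniformContinuousOn_of_continuous
      (hω.mono fun t ht => ht.2)
    obtain ⟨r, hr, hrY⟩ := Metric.uniformContinuousOn_iff.1 huc (δ / 2) (half_pos hδ)
    obtain ⟨k, hk⟩ := exists_nat_one_div_lt hr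
    refine ⟨k, fun a i b j hd => ?_⟩
    rw [← hω', ← hω', ← dist_eq_norm]
    exact (hrY _ ⟨zero_le, dyadic_le T a i⟩ _ ⟨zero_le, dyadic_le T b j⟩ (hd.trans hk)).le
  obtain ⟨k, hk⟩ := exists_measure_compl_le hAm hmono hU hε
  have hk0 : (0 : ℝ) < 1 / ((k : ℝ) + 1) := by positivity
  obtain ⟨a₀, ha₀⟩ := eventually_atTop.1 ((tendsto_div_two_pow T).eventually_lt_const hk0)
  refine ⟨a₀, fun a ha => le_trans (measure_le_of_ae_imp ?_) hk⟩
  filter_upwards [hcont, hae] with ω hω hω' ⟨s, hs, t, ht, hd, hle⟩ hωA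
  obtain ⟨l, -, hl1, hl2⟩ := exists_dyadic_tendsto_comp T hω hs
  obtain ⟨m, -, hm1, hm2⟩ := exists_dyadic_tendsto_comp T hω ht
  have h1 : ∀ᶠ b in atTop, dist (dyadic T b (l b)) (dyadic T b (m b)) < 1 / ((k : ℝ) + 1) :=
    (hl1.dist hm1).eventually_lt_const (hd.trans_lt (ha₀ a ha))
  have h2 : ‖Y s ω - Y t ω‖ ≤ δ / 2 := by
    refine le_of_tendsto (hl2.sub hm2).norm ?_
    filter_upwards [h1] with b hb
    rw [hω', hω']
    exact hωA _ _ _ _ hb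
  linarith

/-- A process with continuous paths is bounded in probability. -/
lemma exists_bound [IsFiniteMeasure P] {Y : ℝ≥0 → Ω → E}
    (hmeas : ∀ t ≤ T, AEStronglyMeasurable (Y t) P)
    (hcont : ∀ᵐ ω ∂P, ContinuousOn (fun t => Y t ω) (Set.Iic T)) {ε : ℝ≥0∞} (hε : 0 < ε) :
    ∃ ρ : ℝ, 0 < ρ ∧ P {ω | ∃ t ≤ T, ρ < ‖Y t ω‖} ≤ ε := by
  choose Y' hY'm hY' using fun a j => hmeas (dyadic T a j) (dyadic_le T a j)
  set A : ℕ → Set Ω := fun k => {ω | ∀ a i, ‖Y' a i ω‖ ≤ k} with hA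
  have hAm : ∀ k, MeasurableSet (A k) := fun k => by
    simp only [hA, Set.ofPred_forall]
    exact MeasurableSet.iInter fun a => .iInter fun i =>
      (hY'm a i).norm.measurableSet_le stronglyMeasurable_const
  have hmono : Monotone A := fun k l hkl ω hω a i => (hω a i).trans (by exact_mod_cast hkl)
  have hae : ∀ᵐ ω ∂P, ∀ a i, Y (dyadic T a i) ω = Y' a i ω :=
    ae_all_iff.2 fun a => ae_all_iff.2 fun i => hY' a i
  have hU : ∀ᵐ ω ∂P, ∃ k, ω ∈ A k := by
    filter_upwards [hcont, hae] with ω hω hω'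
    obtain ⟨C, hC⟩ := (isCompact_Icc (a := (0 : ℝ≥0)) (b := T)).exists_bound_of_continuousOn
      (hω.mono fun t ht => ht.2)
    obtain ⟨k, hk⟩ := exists_nat_ge C
    exact ⟨k, fun a i => by rw [← hω']; exact (hC _ ⟨zero_le, dyadic_le T a i⟩).trans hk⟩
  obtain ⟨k, hk⟩ := exists_measure_compl_le hAm hmono hU hε
  refine ⟨k + 1, by positivity, le_trans (measure_le_of_ae_imp ?_) hk⟩
  filter_upwards [hcont, hae] with ω hω hω' ⟨t, ht, hlt⟩ hωA
  obtain ⟨l, -, -, hl2⟩ := exists_dyadic_tendsto_comp T hω ht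
  have : ‖Y t ω‖ ≤ k := by
    refine le_of_tendsto hl2.norm (.of_forall fun b => ?_)
    rw [hω']
    exact hωA _ _
  linarith

/-- A step function which is uniformly close to `φ` on the cells of the dyadic grid has an integral
close to that of `φ`. -/
lemma norm_integral_sub_sum_le [NormedSpace ℝ E] [CompleteSpace E] {a : ℕ} {φ : ℝ → E}
    (hφ : ContinuousOn φ (Set.Icc 0 (T : ℝ))) {v : ℕ → E} {θ : ℝ} (hθ : 0 ≤ θ)
    (hv : ∀ l < 2 ^ a, ∀ s : ℝ, dyadic T a l ≤ s → s ≤ dyadic T a (l + 1) → ‖φ s - v l‖ ≤ θ)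
    {t : ℝ≥0} (ht : t ≤ T) :
    ‖(∫ s in (0 : ℝ)..t, φ s) - ∑ l ∈ Finset.range (2 ^ a),
      (((min (dyadic T a (l + 1)) t : ℝ≥0) : ℝ) - (min (dyadic T a l) t : ℝ≥0)) • v l‖ ≤ T * θ := by
  set c : ℕ → ℝ := fun l => (min (dyadic T a l) t : ℝ≥0) with hc
  have hcm : Monotone c := fun i j hij => by
    simp only [hc]
    have := dyadic_mono T a hij
    exact_mod_cast min_le_min this le_rfl
  have hc0 : c 0 = 0 := by simp [hc]
  have hcn : c (2 ^ a) = t := by simp [hc, ht]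
  have hcle : ∀ l, c l ∈ Set.Icc (0 : ℝ) T := fun l =>
    ⟨NNReal.coe_nonneg _, by exact_mod_cast (min_le_right _ _).trans ht⟩
  have hint : ∀ i j, IntervalIntegrable φ volume (c i) (c j) := fun i j => by
    refine (hφ.mono ?_).intervalIntegrable
    exact Set.uIcc_subset_Icc (hcle i) (hcle j)
  have h1 : ∫ s in (0 : ℝ)..t, φ s = ∑ l ∈ Finset.range (2 ^ a), ∫ s in (c l)..(c (l + 1)), φ s := by
    rw [intervalIntegral.sum_integral_adjacent_intervals fun k _ => hint k (k + 1), hc0, hcn]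
  rw [h1, ← Finset.sum_sub_distrib]
  have h2 : ∀ l ∈ Finset.range (2 ^ a),
      ‖(∫ s in (c l)..(c (l + 1)), φ s) - (c (l + 1) - c l) • v l‖ ≤ θ * (c (l + 1) - c l) := by
    intro l hl
    rw [← intervalIntegral.integral_const, ← intervalIntegral.integral_sub (hint _ _) (by simp)]
    have hle := hcm (Nat.le_succ l)
    rw [← abs_of_nonneg (sub_nonneg.2 hle)]
    refine intervalIntegral.norm_integral_le_of_norm_le_const fun s hs => ?_
    rw [Set.uIoc_of_le hle] at hs
    refine hv l (Finset.mem_range.1 hl) s ?_ ?_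
    · by_contra hcon
      have h3 : s < dyadic T a l := not_le.1 hcon
      have h4 : c l < s := hs.1
      have h5 : s ≤ c (l + 1) := hs.2
      have h6 : c (l + 1) ≤ t := by simp [hc]
      simp only [hc, NNReal.coe_min] at h4
      rcases min_lt_iff.1 h4 with h7 | h7 <;> linarith
    · exact hs.2.trans (by simp [hc])
  refine (norm_sum_le _ _).trans ((Finset.sum_le_sum h2).trans ?_)
  rw [← Finset.mul_sum, Finset.sum_range_sub, hc0, hcn, sub_zero, mul_comm]
  have : (t : ℝ) ≤ T := by exact_mod_cast ht
  gcongr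

end Dyadic

/-! ### The additive noise -/

section AdditiveNoise

variable {E Hi Ω : Type*} [NormedAddCommGroup E] [InnerProductSpace ℝ E]
  [NormedAddCommGroup Hi] [InnerProductSpace ℝ Hi] {mΩ : MeasurableSpace Ω}

/-- Almost sure limits preserve measurability up to null sets with respect to a sub-σ-algebra. -/
lemma aestronglyMeasurable_of_tendsto [CompleteSpace E] {P : Measure Ω} {m : MeasurableSpace Ω}
    {Y : ℕ → Ω → E} {X : Ω → E} (hY : ∀ k, AEStronglyMeasurable[m] (Y k) P)
    (h : ∀ᵐ ω ∂P, Tendsto (fun k => Y k ω) atTop (𝓝 (X ω))) : AEStronglyMeasurable[m] X P := by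
  choose Y' hY' hYY' using hY
  refine ⟨fun ω => limUnder atTop fun k => Y' k ω, StronglyMeasurable.limUnder hY', ?_⟩
  filter_upwards [h, ae_all_iff.2 hYY'] with ω h1 h2
  simp only [h2] at h1
  exact h1.limUnder_eq.symm

lemma eLpNorm_two_le_ofReal_sqrt {P : Measure Ω} {u : Ω → E} (hu : MemLp u 2 P) {C : ℝ}
    (h : ∫ ω, ‖u ω‖ ^ 2 ∂P ≤ C) : eLpNorm u 2 P ≤ ENNReal.ofReal (Real.sqrt C) := by
  rw [hu.eLpNorm_eq_integral_rpow_norm (by norm_num) (by norm_num)]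
  refine ENNReal.ofReal_le_ofReal ?_
  rw [Real.sqrt_eq_rpow]
  simp only [ENNReal.toReal_ofNat, Real.rpow_ofNat, one_div]
  gcongr

lemma integral_normSq_le_of_eLpNorm_two_le {P : Measure Ω} {u : Ω → E} (hu : MemLp u 2 P) {C : ℝ}
    (hC : 0 ≤ C) (h : eLpNorm u 2 P ≤ ENNReal.ofReal (Real.sqrt C)) :
    ∫ ω, ‖u ω‖ ^ 2 ∂P ≤ C := by
  rw [hu.eLpNorm_eq_integral_rpow_norm (by norm_num) (by norm_num),
    ENNReal.ofReal_le_ofReal_iff (Real.sqrt_nonneg _)] at h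
  simp only [ENNReal.toReal_ofNat, Real.rpow_ofNat] at h
  rw [← one_div, ← Real.sqrt_eq_rpow] at h
  exact (Real.sqrt_le_sqrt_iff hC).1 h

lemma abs_integral_inner_le {P : Measure Ω} {u v : Ω → E} (hu : MemLp u 2 P) (hv : MemLp v 2 P) :
    |∫ ω, ⟪u ω, v ω⟫ ∂P| ≤ (eLpNorm u 2 P).toReal * (eLpNorm v 2 P).toReal := by
  have h1 := norm_inner_le_norm (𝕜 := ℝ) (hu.toLp u) (hv.toLp v)
  rw [L2.inner_def, Lp.norm_toLp, Lp.norm_toLp, Real.norm_eq_abs] at h1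
  convert h1 using 2
  refine integral_congr_ae ?_
  filter_upwards [hu.coeFn_toLp, hv.coeFn_toLp] with ω h1 h2
  rw [h1, h2]

variable {F : Filtration ℝ≥0 mΩ} {P : Measure Ω} [IsProbabilityMeasure P]
  {Q : Hi →L[ℝ] Hi} {W : ℝ≥0 → Ω → Hi} {Wb : ℕ × ℕ → ℝ≥0 → Ω → ℝ}
  [MeasurableSpace Hi]

namespace IsNoise

lemma hasLaw_increment (hW : IsNoise F P Q W Wb) (p : ℕ × ℕ) {s t : ℝ≥0} (hst : s ≤ t) :
    HasLaw (fun ω => Wb p t ω - Wb p s ω) (gaussianReal 0 (t - s)) P := by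
  have h := (hW.brownian p).toIsPreBrownianReal.hasLaw_sub t s
  have e : nndist (t : ℝ) (s : ℝ) = t - s := by
    have h1 : (s : ℝ) ≤ t := by exact_mod_cast hst
    ext
    rw [coe_nndist, Real.dist_eq, NNReal.coe_sub hst, abs_of_nonneg (by linarith)]
  exact e ▸ h

lemma memLp_increment (hW : IsNoise F P Q W Wb) (p : ℕ × ℕ) {s t : ℝ≥0} (hst : s ≤ t) :
    MemLp (fun ω => Wb p t ω - Wb p s ω) 2 P := by
  have hl := hW.hasLaw_increment p hst
  have := memLp_id_gaussianReal (μ := 0) (v := t - s) 2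
  rw [← hl.map_eq] at this
  exact this.comp_of_map hl.aemeasurable

lemma integral_increment (hW : IsNoise F P Q W Wb) (p : ℕ × ℕ) {s t : ℝ≥0} (hst : s ≤ t) :
    ∫ ω, (Wb p t ω - Wb p s ω) ∂P = 0 := by
  have hm := (hW.hasLaw_increment p hst).integral_eq
  rwa [integral_id_gaussianReal] at hm

/-- Increments of different processes of the family are uncorrelated, since they are independent. -/
lemma integral_increment_mul (hW : IsNoise F P Q W Wb) (p r : ℕ × ℕ) {s t : ℝ≥0} (hst : s ≤ t) :
    ∫ ω, (Wb p t ω - Wb p s ω) * (Wb r t ω - Wb r s ω) ∂P =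
      if p = r then (t : ℝ) - s else 0 := by
  split_ifs with h
  · subst h
    have hl := hW.hasLaw_increment p hst
    have hv := hl.variance_eq
    rw [variance_id_gaussianReal,
      variance_of_integral_eq_zero hl.aemeasurable (hW.integral_increment p hst)] at hv
    rw [NNReal.coe_sub hst] at hv
    rw [← hv]
    simp only [sq]
  · have hi : IndepFun (fun ω => Wb p t ω - Wb p s ω) (fun ω => Wb r t ω - Wb r s ω) P := by
      have h1 := hW.indep_family.indepFun h
      have hm : Measurable fun x : ℝ≥0 → ℝ => x t - x s := by fun_prop
      exact h1.comp hm hm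
    rw [hi.integral_fun_mul_eq_mul_integral (hW.memLp_increment p hst).1
      (hW.memLp_increment r hst).1, hW.integral_increment p hst, zero_mul]

end IsNoise

/-- The finite partial sums of the additive noise. -/
def partialNoise (Wb : ℕ × ℕ → ℝ≥0 → Ω → ℝ) (b : ℕ × ℕ → E) (N : Finset (ℕ × ℕ)) (t : ℝ≥0)
    (ω : Ω) : E := ∑ p ∈ N, Wb p t ω • b p

lemma partialNoise_sub (b : ℕ × ℕ → E) (N : Finset (ℕ × ℕ)) (s t : ℝ≥0) (ω : Ω) :
    partialNoise Wb b N t ω - partialNoise Wb b N s ω =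
      ∑ p ∈ N, (Wb p t ω - Wb p s ω) • b p := by
  simp only [partialNoise, ← Finset.sum_sub_distrib, sub_smul]

lemma partialNoise_sub_of_subset (b : ℕ × ℕ → E) {N M : Finset (ℕ × ℕ)} (h : M ⊆ N) (t : ℝ≥0)
    (ω : Ω) : partialNoise Wb b N t ω - partialNoise Wb b M t ω = partialNoise Wb b (N \ M) t ω := by
  rw [partialNoise, partialNoise, partialNoise, ← Finset.sum_sdiff h, add_sub_cancel_right]

namespace IsNoise

lemma memLp_partialNoise_sub (hW : IsNoise F P Q W Wb) (b : ℕ × ℕ → E) (N : Finset (ℕ × ℕ))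
    {s t : ℝ≥0} (hst : s ≤ t) :
    MemLp (fun ω => partialNoise Wb b N t ω - partialNoise Wb b N s ω) 2 P := by
  simp only [partialNoise_sub]
  exact memLp_finsetSum _ fun p _ =>
    (ContinuousLinearMap.toSpanSingleton ℝ (b p)).comp_memLp' (hW.memLp_increment p hst)

lemma integral_normSq_partialNoise_sub (hW : IsNoise F P Q W Wb) (b : ℕ × ℕ → E)
    (N : Finset (ℕ × ℕ)) {s t : ℝ≥0} (hst : s ≤ t) :
    ∫ ω, ‖partialNoise Wb b N t ω - partialNoise Wb b N s ω‖ ^ 2 ∂P =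
      ((t : ℝ) - s) * ∑ p ∈ N, ‖b p‖ ^ 2 := by
  have e : ∀ ω, ‖partialNoise Wb b N t ω - partialNoise Wb b N s ω‖ ^ 2 =
      ∑ p ∈ N, ∑ r ∈ N, ((Wb p t ω - Wb p s ω) * (Wb r t ω - Wb r s ω)) * ⟪b p, b r⟫ := fun ω => by
    rw [partialNoise_sub, ← real_inner_self_eq_norm_sq, sum_inner]
    refine Finset.sum_congr rfl fun p _ => ?_
    rw [inner_sum]
    refine Finset.sum_congr rfl fun r _ => ?_
    rw [real_inner_smul_left, real_inner_smul_right]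
    ring
  have hi : ∀ p r, Integrable (fun ω =>
      ((Wb p t ω - Wb p s ω) * (Wb r t ω - Wb r s ω)) * ⟪b p, b r⟫) P := fun p r =>
    ((hW.memLp_increment p hst).integrable_mul (hW.memLp_increment r hst)).mul_const _
  simp only [e]
  rw [integral_finsetSum _ fun p _ => integrable_finsetSum _ fun r _ => hi p r, Finset.mul_sum]
  refine Finset.sum_congr rfl fun p hp => ?_
  rw [integral_finsetSum _ fun r _ => hi p r]
  simp only [integral_mul_const, hW.integral_increment_mul _ _ hst]
  simp [ite_mul, hp]

lemma integral_inner_partialNoise_sub (hW : IsNoise F P Q W Wb) (b : ℕ × ℕ → E)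
    (N : Finset (ℕ × ℕ)) {s t : ℝ≥0} (hst : s ≤ t) {η : Ω → E} (hη : StronglyMeasurable[F s] η)
    (hη2 : MemLp η 2 P) :
    ∫ ω, ⟪η ω, partialNoise Wb b N t ω - partialNoise Wb b N s ω⟫ ∂P = 0 := by
  have hm : ∀ p, MemLp (fun ω => (Wb p t ω - Wb p s ω) • b p) 2 P := fun p =>
    (ContinuousLinearMap.toSpanSingleton ℝ (b p)).comp_memLp' (hW.memLp_increment p hst)
  simp only [partialNoise_sub, inner_sum]
  rw [integral_finsetSum _ fun p _ => integrable_inner_of_memLp hη2 (hm p)]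
  refine Finset.sum_eq_zero fun p _ => ?_
  have hi : IndepFun (fun ω => Wb p t ω - Wb p s ω) (fun ω => ⟪η ω, b p⟫) P := by
    rw [IndepFun_iff_Indep]
    have h1 : StronglyMeasurable[F s] fun ω => ⟪η ω, b p⟫ :=
      (continuous_id.inner continuous_const).comp_stronglyMeasurable hη
    refine indep_of_indep_of_le_right (indep_of_indep_of_le_left (hW.indep_past s t hst) ?_)
      h1.measurable.comap_le
    have h2 : Measurable fun x : Hi × (ℕ × ℕ → ℝ) => x.2 p := by fun_prop
    have h3 : (fun ω => Wb p t ω - Wb p s ω) = (fun x : Hi × (ℕ × ℕ → ℝ) => x.2 p) ∘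
      fun ω => (W t ω - W s ω, fun i => Wb i t ω - Wb i s ω) := rfl
    rw [h3, ← MeasurableSpace.comap_comp]
    exact MeasurableSpace.comap_mono h2.comap_le
  simp only [real_inner_smul_right]
  rw [hi.integral_fun_mul_eq_mul_integral (hW.memLp_increment p hst).1
    (hη2.1.inner aestronglyMeasurable_const), hW.integral_increment p hst, zero_mul]

lemma stronglyMeasurable_partialNoise (hW : IsNoise F P Q W Wb) (b : ℕ × ℕ → E)
    (N : Finset (ℕ × ℕ)) (t : ℝ≥0) : StronglyMeasurable[F t] (partialNoise Wb b N t) :=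
  Finset.stronglyMeasurable_fun_sum _ fun p _ => (hW.adapted p t).smul_const (b p)

lemma partialNoise_zero (hW : IsNoise F P Q W Wb) (b : ℕ × ℕ → E) :
    ∀ᵐ ω ∂P, ∀ N, partialNoise Wb b N 0 ω = 0 := by
  have h := ae_all_iff.2 fun p => (hW.brownian p).toIsPreBrownianReal.eval_zero_ae_eq_zero
  filter_upwards [h] with ω hω N
  simp [partialNoise, hω]

lemma isMartingaleDiff_partialNoise (hW : IsNoise F P Q W Wb) (b : ℕ × ℕ → E)
    (N : Finset (ℕ × ℕ)) {g : ℕ → ℝ≥0} (hg : Monotone g) :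
    IsMartingaleDiff (sampled F hg) P
      fun i ω => partialNoise Wb b N (g (i + 1)) ω - partialNoise Wb b N (g i) ω where
  meas i := (hW.stronglyMeasurable_partialNoise b N _).sub
    ((hW.stronglyMeasurable_partialNoise b N _).mono (F.mono (hg (Nat.le_succ i))))
  memLp i := hW.memLp_partialNoise_sub b N (hg (Nat.le_succ i))
  orth i _ hη hη2 := hW.integral_inner_partialNoise_sub b N (hg (Nat.le_succ i)) hη hη2

lemma continuous_partialNoise (hW : IsNoise F P Q W Wb) (b : ℕ × ℕ → E) :
    ∀ᵐ ω ∂P, ∀ N, Continuous fun t => partialNoise Wb b N t ω := by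
  have h := ae_all_iff.2 fun p => (hW.brownian p).cont
  filter_upwards [h] with ω hω N
  exact continuous_finsetSum _ fun p _ => (hω p).smul continuous_const

/-- Kolmogorov's inequality for the partial sums of the additive noise, uniformly on `[0, T]`. -/
lemma measure_exists_lt_norm_partialNoise_le (hW : IsNoise F P Q W Wb) (b : ℕ × ℕ → E)
    (N : Finset (ℕ × ℕ)) (T : ℝ≥0) {ε : ℝ} (hε : 0 < ε) :
    P {ω | ∃ t ≤ T, ε < ‖partialNoise Wb b N t ω‖} ≤
      ENNReal.ofReal (T * (∑ p ∈ N, ‖b p‖ ^ 2) / ε ^ 2) := by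
  refine measure_exists_lt_le_of_dyadic T (a₀ := 0) ?_ fun a _ => ?_
  · filter_upwards [hW.continuous_partialNoise b] with ω hω using (hω N).continuousOn
  have h := (hW.isMartingaleDiff_partialNoise b N
    (dyadic_mono T a)).measure_exists_le_norm_sum_le (2 ^ a) hε
  have hsum : ∑ i ∈ Finset.range (2 ^ a), ∫ ω, ‖partialNoise Wb b N (dyadic T a (i + 1)) ω -
      partialNoise Wb b N (dyadic T a i) ω‖ ^ 2 ∂P = T * ∑ p ∈ N, ‖b p‖ ^ 2 := by
    simp only [hW.integral_normSq_partialNoise_sub b N (dyadic_mono T a (Nat.le_succ _)),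
      ← Finset.sum_mul, Nat.succ_eq_add_one]
    rw [Finset.sum_range_sub (fun i => (dyadic T a i : ℝ))]
    simp
  rw [hsum] at h
  refine le_trans (measure_le_of_ae_imp ?_) h
  filter_upwards [hW.partialNoise_zero b] with ω hω ⟨j, hj, hle⟩
  refine ⟨j, hj, ?_⟩
  rw [Finset.sum_range_sub (fun i => partialNoise Wb b N (dyadic T a i) ω)]
  simpa [hω] using hle

lemma eLpNorm_partialNoise_le (hW : IsNoise F P Q W Wb) (b : ℕ × ℕ → E) (N : Finset (ℕ × ℕ))
    (t : ℝ≥0) :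
    eLpNorm (partialNoise Wb b N t) 2 P ≤
      ENNReal.ofReal (Real.sqrt (t * ∑ p ∈ N, ‖b p‖ ^ 2)) := by
  have h0 : (fun ω => partialNoise Wb b N t ω - partialNoise Wb b N 0 ω) =ᵐ[P]
      partialNoise Wb b N t := by
    filter_upwards [hW.partialNoise_zero b] with ω hω
    simp [hω]
  rw [← eLpNorm_congr_ae h0]
  refine eLpNorm_two_le_ofReal_sqrt (hW.memLp_partialNoise_sub b N zero_le) ?_
  rw [hW.integral_normSq_partialNoise_sub b N zero_le]
  simp

lemma stronglyMeasurable_noiseSigma_partialNoise (b : ℕ × ℕ → E) (N : Finset (ℕ × ℕ)) (t : ℝ≥0) :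
    StronglyMeasurable[noiseSigma W Wb t] (partialNoise Wb b N t) := by
  refine Finset.stronglyMeasurable_fun_sum _ fun p _ => StronglyMeasurable.smul_const ?_ (b p)
  refine Measurable.stronglyMeasurable (Measurable.of_comap_le ?_)
  refine le_trans ?_ (le_iSup₂_of_le (f := fun s (_ : s ∈ Set.Iic t) =>
    (MeasurableSpace.comap (W s) inferInstance ⊔
      ⨆ i, MeasurableSpace.comap (Wb i s) inferInstance)) t (Set.mem_Iic.2 le_rfl) le_rfl)
  exact le_trans (le_iSup (fun i => MeasurableSpace.comap (Wb i t) inferInstance) p) le_sup_right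

/-- The additive noise has a version with continuous paths, known from the noise. -/
lemma exists_additiveNoise [CompleteSpace E] (hW : IsNoise F P Q W Wb) {b : ℕ × ℕ → E}
    (hb : Summable fun p => ‖b p‖ ^ 2) (T : ℝ≥0) :
    ∃ Z : ℝ≥0 → Ω → E,
      (∀ t ≤ T, AEStronglyMeasurable[noiseSigma W Wb t] (Z t) P) ∧
      (∀ᵐ ω ∂P, ContinuousOn (fun t => Z t ω) (Set.Iic T)) ∧
      ∀ t ≤ T, Tendsto (fun N : Finset (ℕ × ℕ) =>
        eLpNorm (fun ω => partialNoise Wb b N t ω - Z t ω) 2 P) atTop (𝓝 0) := by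
  -- the mass of `b` outside a large finite set is small
  have htail : ∀ ε : ℝ, 0 < ε → ∃ s : Finset (ℕ × ℕ), ∀ N, Disjoint N s →
      ∑ p ∈ N, ‖b p‖ ^ 2 < ε := fun ε hε => by
    obtain ⟨s, hs⟩ := summable_iff_vanishing_norm.1 hb ε hε
    exact ⟨s, fun N hN => (le_abs_self _).trans_lt (hs N hN)⟩
  set D : ℕ → Finset (ℕ × ℕ) := fun k => Finset.range k ×ˢ Finset.range k with hD
  have hDm : Monotone D := fun i j hij =>
    Finset.product_subset_product (Finset.range_mono hij) (Finset.range_mono hij)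
  have hDt : Tendsto D atTop atTop := by
    refine tendsto_atTop_finset_of_monotone hDm fun p => ⟨max p.1 p.2 + 1, ?_⟩
    simp only [hD, Finset.mem_product, Finset.mem_range]
    omega
  have hcauchy : ∀ ε : ℝ, 0 < ε → ∃ K, ∀ k ≥ K, ∀ l ≥ K,
      P {ω | ∃ t ≤ T, ε ≤ ‖partialNoise Wb b (D k) t ω - partialNoise Wb b (D l) t ω‖} ≤
        ENNReal.ofReal ε := by
    intro ε hε
    set θ := ε * (ε / 2) ^ 2 / (T + 1) with hθ
    have hT1 : (0 : ℝ) < T + 1 := by positivity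
    obtain ⟨s, hs⟩ := htail θ (by positivity)
    obtain ⟨K, hK⟩ := (hDt.eventually_ge_atTop s).exists
    have main : ∀ k ≥ K, ∀ l ≥ k,
        P {ω | ∃ t ≤ T, ε ≤ ‖partialNoise Wb b (D l) t ω - partialNoise Wb b (D k) t ω‖} ≤
        ENNReal.ofReal ε := by
      intro k hk l hl
      have hdis : Disjoint (D l \ D k) s :=
        Finset.disjoint_of_subset_right (hK.trans (hDm hk)) Finset.sdiff_disjoint
      simp only [partialNoise_sub_of_subset b (hDm hl)]
      refine le_trans (measure_mono ?_)
        ((hW.measure_exists_lt_norm_partialNoise_le b (D l \ D k) T (half_pos hε)).trans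
          (ENNReal.ofReal_le_ofReal ?_))
      · rintro ω ⟨t, ht, hle⟩
        exact ⟨t, ht, by linarith⟩
      · rw [div_le_iff₀ (by positivity)]
        have h1 := (hs _ hdis).le
        calc T * ∑ p ∈ D l \ D k, ‖b p‖ ^ 2 ≤ (T + 1) * θ := by
              gcongr; linarith
          _ = ε * (ε / 2) ^ 2 := by rw [hθ]; field_simp
    refine ⟨K, fun k hk l hl => ?_⟩
    rcases le_total k l with h | h
    · simp only [norm_sub_rev (partialNoise Wb b (D k) _ _)]
      exact main k hk l h
    · exact main l hl k h
  obtain ⟨Z, φ, hφ, hae, -⟩ := exists_tendsto_of_cauchy_in_measure T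
    (fun k => partialNoise Wb b (D k)) hcauchy
  have hlim : ∀ t ≤ T, ∀ᵐ ω ∂P, Tendsto (fun k => partialNoise Wb b (D (φ k)) t ω) atTop
      (𝓝 (Z t ω)) := fun t ht => by
    filter_upwards [hae] with ω hω using hω.tendsto_at ht
  refine ⟨Z, fun t ht => ?_, ?_, fun t ht => ?_⟩
  · exact aestronglyMeasurable_of_tendsto (fun k =>
      (stronglyMeasurable_noiseSigma_partialNoise b (D (φ k)) t).aestronglyMeasurable) (hlim t ht)
  · filter_upwards [hae, hW.continuous_partialNoise b] with ω h1 h2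
    exact h1.continuousOn (.of_forall fun k => (h2 _).continuousOn)
  · have hm : ∀ N, AEStronglyMeasurable (partialNoise Wb b N t) P := fun N =>
      ((hW.stronglyMeasurable_partialNoise b N t).mono (F.le t)).aestronglyMeasurable
    rw [ENNReal.tendsto_nhds_zero]
    intro ε hε
    obtain ⟨r, hr, hrε⟩ := ENNReal.lt_iff_exists_nnreal_btwn.1 hε
    have hr0 : (0 : ℝ) < r := by exact_mod_cast hr
    have hT1 : (0 : ℝ) < T + 1 := by positivity
    obtain ⟨s, hs⟩ := htail ((r / 2) ^ 2 / (T + 1)) (by positivity)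
    have hsmall : ∀ N, s ⊆ N →
        eLpNorm (fun ω => partialNoise Wb b N t ω - partialNoise Wb b s t ω) 2 P ≤
          ENNReal.ofReal (r / 2) := by
      intro N hN
      simp only [partialNoise_sub_of_subset b hN]
      refine (hW.eLpNorm_partialNoise_le b (N \ s) t).trans (ENNReal.ofReal_le_ofReal ?_)
      rw [Real.sqrt_le_left (by positivity)]
      have h1 := (hs (N \ s) Finset.sdiff_disjoint).le
      have h2 : (t : ℝ) ≤ T + 1 := by
        have : (t : ℝ) ≤ T := by exact_mod_cast ht
        linarith
      calc (t : ℝ) * ∑ p ∈ N \ s, ‖b p‖ ^ 2 ≤ (T + 1) * ((r / 2) ^ 2 / (T + 1)) := by gcongr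
        _ = (r / 2) ^ 2 := by field_simp
    filter_upwards [eventually_ge_atTop s] with N hN
    have hle : ∀ᶠ k in atTop, eLpNorm (fun ω => partialNoise Wb b N t ω -
        partialNoise Wb b (D (φ k)) t ω) 2 P ≤ ENNReal.ofReal r := by
      filter_upwards [(hDt.comp hφ.tendsto_atTop).eventually_ge_atTop s] with k hk
      have e : (fun ω => partialNoise Wb b N t ω - partialNoise Wb b (D (φ k)) t ω) =
          (fun ω => partialNoise Wb b N t ω - partialNoise Wb b s t ω) -
          fun ω => partialNoise Wb b (D (φ k)) t ω - partialNoise Wb b s t ω := by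
        ext ω; simp
      rw [e]
      refine (eLpNorm_sub_le ((hm N).sub (hm s)) ((hm _).sub (hm s)) (by norm_num)).trans
        ((add_le_add (hsmall N hN) (hsmall _ hk)).trans ?_)
      rw [← ENNReal.ofReal_add (by positivity) (by positivity), add_halves]
    -- Fatou's lemma identifies the pathwise limit of a subsequence with the mean square limit
    have h1 := Lp.eLpNorm_lim_le_liminf_eLpNorm (p := 2) (μ := P)
      (f := fun k ω => partialNoise Wb b N t ω - partialNoise Wb b (D (φ k)) t ω)
      (fun k => (hm N).sub (hm _)) (fun ω => partialNoise Wb b N t ω - Z t ω) (by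
        filter_upwards [hlim t ht] with ω hω using hω.const_sub _)
    refine h1.trans (le_trans ?_ (ENNReal.ofReal_coe_nnreal.trans_le hrε.le))
    exact liminf_le_of_frequently_le' hle.frequently

/-- Increments of the additive noise are small in `L²` and orthogonal to the past. -/
lemma additiveNoise_increment (hW : IsNoise F P Q W Wb) {b : ℕ × ℕ → E}
    (hb : Summable fun p => ‖b p‖ ^ 2) {T : ℝ≥0} {Z : ℝ≥0 → Ω → E}
    (hZ : ∀ t ≤ T, AEStronglyMeasurable (Z t) P)
    (hZlim : ∀ t ≤ T, Tendsto (fun N : Finset (ℕ × ℕ) =>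
        eLpNorm (fun ω => partialNoise Wb b N t ω - Z t ω) 2 P) atTop (𝓝 0))
    {s t : ℝ≥0} (hst : s ≤ t) (ht : t ≤ T) :
    MemLp (fun ω => Z t ω - Z s ω) 2 P ∧
    ∫ ω, ‖Z t ω - Z s ω‖ ^ 2 ∂P ≤ (∑' p, ‖b p‖ ^ 2) * ((t : ℝ) - s) ∧
    ∀ η : Ω → E, StronglyMeasurable[F s] η → MemLp η 2 P → ∫ ω, ⟪η ω, Z t ω - Z s ω⟫ ∂P = 0 := by
  have hs := hst.trans ht
  have hm : ∀ N t, AEStronglyMeasurable (partialNoise Wb b N t) P := fun N t =>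
      ((hW.stronglyMeasurable_partialNoise b N t).mono (F.le t)).aestronglyMeasurable
  set u : Finset (ℕ × ℕ) → Ω → E := fun N ω =>
    (partialNoise Wb b N t ω - partialNoise Wb b N s ω) - (Z t ω - Z s ω) with hu
  have hum : ∀ N, AEStronglyMeasurable (u N) P := fun N =>
    ((hm N t).sub (hm N s)).sub ((hZ t ht).sub (hZ s hs))
  have hu0 : Tendsto (fun N => eLpNorm (u N) 2 P) atTop (𝓝 0) := by
    have h1 := (hZlim t ht).add (hZlim s hs)
    rw [add_zero] at h1
    refine tendsto_of_tendsto_of_tendsto_of_le_of_le tendsto_const_nhds h1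
      (fun _ => zero_le) fun N => ?_
    have e : u N = (fun ω => partialNoise Wb b N t ω - Z t ω) -
        fun ω => partialNoise Wb b N s ω - Z s ω := by
      ext ω; simp only [hu, Pi.sub_apply]; abel
    simp only [e]
    exact eLpNorm_sub_le ((hm N t).sub (hZ t ht)) ((hm N s).sub (hZ s hs)) (by norm_num)
  have hdec : ∀ N, (fun ω => Z t ω - Z s ω) =
      (fun ω => partialNoise Wb b N t ω - partialNoise Wb b N s ω) - u N := fun N => by
    ext ω; simp [hu]
  obtain ⟨N₀, hN₀⟩ := eventually_atTop.1
    (hu0.eventually_lt_const (ENNReal.zero_lt_top : (0 : ℝ≥0∞) < ∞))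
  have huL : ∀ N, N₀ ≤ N → MemLp (u N) 2 P := fun N hN => ⟨hum N, hN₀ N hN⟩
  have hL : MemLp (fun ω => Z t ω - Z s ω) 2 P := by
    rw [hdec N₀]
    exact (hW.memLp_partialNoise_sub b N₀ hst).sub (huL N₀ le_rfl)
  have hts : (0 : ℝ) ≤ t - s := sub_nonneg.2 (by exact_mod_cast hst)
  have hc : 0 ≤ (∑' p, ‖b p‖ ^ 2) * ((t : ℝ) - s) :=
    mul_nonneg (tsum_nonneg fun _ => by positivity) hts
  refine ⟨hL, ?_, fun η hη hη2 => ?_⟩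
  · refine integral_normSq_le_of_eLpNorm_two_le hL hc ?_
    have h1 : Tendsto (fun N => ENNReal.ofReal (Real.sqrt ((∑' p, ‖b p‖ ^ 2) * ((t : ℝ) - s))) +
        eLpNorm (u N) 2 P) atTop
        (𝓝 (ENNReal.ofReal (Real.sqrt ((∑' p, ‖b p‖ ^ 2) * ((t : ℝ) - s))) + 0)) :=
      tendsto_const_nhds.add hu0
    rw [add_zero] at h1
    refine ge_of_tendsto' h1 fun N => ?_
    rw [hdec N]
    refine (eLpNorm_sub_le ((hm N t).sub (hm N s)) (hum N) (by norm_num)).trans ?_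
    gcongr
    refine eLpNorm_two_le_ofReal_sqrt (hW.memLp_partialNoise_sub b N hst) ?_
    rw [hW.integral_normSq_partialNoise_sub b N hst, mul_comm]
    gcongr
    exact hb.sum_le_tsum _ fun _ _ => by positivity
  · have h1 : Tendsto (fun N => (eLpNorm η 2 P).toReal * (eLpNorm (u N) 2 P).toReal) atTop
        (𝓝 ((eLpNorm η 2 P).toReal * (0 : ℝ≥0∞).toReal)) :=
      ((ENNReal.tendsto_toReal ENNReal.zero_ne_top).comp hu0).const_mul _
    rw [ENNReal.toReal_zero, mul_zero] at h1
    have h2 : |∫ ω, ⟪η ω, Z t ω - Z s ω⟫ ∂P| ≤ 0 := by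
      refine ge_of_tendsto h1 ?_
      filter_upwards [eventually_ge_atTop N₀] with N hN
      refine le_trans (le_of_eq ?_) (abs_integral_inner_le hη2 (huL N hN))
      have h3 : ∫ ω, ⟪η ω, u N ω⟫ ∂P = - ∫ ω, ⟪η ω, Z t ω - Z s ω⟫ ∂P := by
        have e : ∀ ω, ⟪η ω, u N ω⟫ =
            ⟪η ω, partialNoise Wb b N t ω - partialNoise Wb b N s ω⟫ - ⟪η ω, Z t ω - Z s ω⟫ :=
          fun ω => inner_sub_right _ _ _
        simp only [e]
        rw [integral_sub (integrable_inner_of_memLp hη2 (hW.memLp_partialNoise_sub b N hst))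
          (integrable_inner_of_memLp hη2 hL), hW.integral_inner_partialNoise_sub b N hst hη hη2,
          zero_sub]
      rw [h3, abs_neg]
    exact abs_eq_zero.1 (le_antisymm h2 (abs_nonneg _))

end IsNoise

end AdditiveNoise

/-! ### Properties of the coefficients -/

section Coefficients

variable {Hd Hi : Type*} [NormedAddCommGroup Hd] [InnerProductSpace ℝ Hd]
  [NormedAddCommGroup Hi] [InnerProductSpace ℝ Hi]
  {d : ℕ} (c : Coefficients Hd Hi) (e : OrthonormalBasis (Fin d) ℝ Hd)
  (f : HilbertBasis ℕ ℝ Hi) {q : ℕ → ℝ}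

lemma bvec_eq (p : ℕ × ℕ) :
    bvec c e f q p = Real.sqrt (q p.1 * q p.2 / 2) • c.B122 (f p.1) (f p.2) := by
  conv_rhs => rw [← e.sum_repr (c.B122 (f p.1) (f p.2)), Finset.smul_sum]
  refine Finset.sum_congr rfl fun i _ => ?_
  rw [e.repr_apply_apply, smul_smul, real_inner_comm, mul_comm]

lemma summable_normSq_bvec (hq : ∀ m, 0 ≤ q m) (hq_sum : Summable q) :
    Summable fun p => ‖bvec c e f q p‖ ^ 2 := by
  have h1 : Summable fun p : ℕ × ℕ => q p.1 * q p.2 :=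
    hq_sum.mul_of_nonneg hq_sum hq hq
  refine Summable.of_nonneg_of_le (fun p => by positivity) (fun p => ?_)
    (h1.mul_right (‖c.B122‖ ^ 2))
  have h2 : 0 ≤ q p.1 * q p.2 := mul_nonneg (hq _) (hq _)
  have h3 : ‖c.B122 (f p.1) (f p.2)‖ ≤ ‖c.B122‖ := by
    simpa [f.orthonormal.1] using c.B122.le_opNorm₂ (f p.1) (f p.2)
  rw [bvec_eq, norm_smul, mul_pow, Real.norm_eq_abs, sq_abs, Real.sq_sqrt (by positivity)]
  have h4 := pow_le_pow_left₀ (norm_nonneg _) h3 2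
  have h5 : q p.1 * q p.2 / 2 ≤ q p.1 * q p.2 := by linarith
  gcongr

lemma summable_stratonovich (hq : ∀ m, 0 ≤ q m) (hq_sum : Summable q) (x : Hd) (i : Fin d) :
    Summable fun m => q m * ∑ j, ⟪c.B112 (e j) (f m), e i⟫ * ⟪c.B112 x (f m), e j⟫ := by
  have hb : ∀ (y : Hd) (m : ℕ) (j : Fin d), |⟪c.B112 y (f m), e j⟫| ≤ ‖c.B112‖ * ‖y‖ :=
    fun y m j => by
    refine (abs_real_inner_le_norm _ _).trans ?_
    simpa [f.orthonormal.1, e.orthonormal.1] using c.B112.le_opNorm₂ y (f m)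
  refine Summable.of_norm_bounded
    (hq_sum.mul_right (∑ j : Fin d, ‖c.B112‖ * ‖e j‖ * (‖c.B112‖ * ‖x‖))) fun m => ?_
  rw [norm_mul, Real.norm_of_nonneg (hq m)]
  refine mul_le_mul_of_nonneg_left ((norm_sum_le _ _).trans (Finset.sum_le_sum fun j _ => ?_)) (hq m)
  rw [norm_mul]
  exact mul_le_mul (hb _ _ _) (hb _ _ _) (abs_nonneg _) (by positivity)

/-- The Stratonovich correction is a linear operator. -/
lemma exists_stratonovich_eq (hq : ∀ m, 0 ≤ q m) (hq_sum : Summable q) :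
    ∃ S : Hd →L[ℝ] Hd, ∀ x, stratonovich c e f q x = S x := by
  have : FiniteDimensional ℝ Hd := e.toBasis.finiteDimensional_of_finite
  have hlin : IsLinearMap ℝ (stratonovich c e f q) := by
    constructor
    · intro x y
      simp only [stratonovich, ← Finset.sum_add_distrib, ← add_smul, ← mul_add]
      refine Finset.sum_congr rfl fun i _ => ?_
      rw [← (summable_stratonovich c e f hq hq_sum x i).tsum_add
        (summable_stratonovich c e f hq hq_sum y i)]
      congr 3
      ext m
      rw [← mul_add, ← Finset.sum_add_distrib]
      simp only [map_add, add_apply, inner_add_left, mul_add]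
    · intro a x
      simp only [stratonovich, Finset.smul_sum, smul_smul]
      refine Finset.sum_congr rfl fun i _ => ?_
      congr 1
      rw [mul_left_comm a]
      congr 1
      rw [← tsum_mul_left]
      refine tsum_congr fun m => ?_
      simp only [map_smul, smul_apply, real_inner_smul_left, Finset.mul_sum]
      exact Finset.sum_congr rfl fun j _ => by ring
  exact ⟨LinearMap.toContinuousLinearMap (hlin.mk' _), fun x => rfl⟩

/-- The part of the drift which depends on the state only. -/
noncomputable def stateDrift (q : ℕ → ℝ) (x : Hd) : Hd :=
  c.A11 x + c.B111 x x + c.A12 (c.A21 x + c.B211 x x)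
    + c.B112 x (c.A21 x + c.B211 x x) + stratonovich c e f q x

lemma drift_eq (s : ℝ) (x : Hd) : drift c e f q s x = c.F1 s + stateDrift c e f q x := by
  simp only [drift, stateDrift]
  abel

lemma contDiff_stateDrift (hq : ∀ m, 0 ≤ q m) (hq_sum : Summable q) :
    ContDiff ℝ 1 (stateDrift c e f q) := by
  obtain ⟨S, hS⟩ := exists_stratonovich_eq c e f hq hq_sum
  have h1 : ContDiff ℝ 1 fun x => c.A21 x + c.B211 x x :=
    c.A21.contDiff.add (c.B211.contDiff.clm_apply contDiff_id)
  have h2 : stateDrift c e f q = fun x => c.A11 x + c.B111 x x + c.A12 (c.A21 x + c.B211 x x)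
    + c.B112 x (c.A21 x + c.B211 x x) + S x := by
    ext x; rw [stateDrift, hS]
  rw [h2]
  exact (((c.A11.contDiff.add (c.B111.contDiff.clm_apply contDiff_id)).add
    (c.A12.contDiff.comp h1)).add (c.B112.contDiff.clm_apply h1)).add S.contDiff

lemma exists_lipschitz_stateDrift (hq : ∀ m, 0 ≤ q m) (hq_sum : Summable q) (R : ℝ) :
    ∃ L : ℝ, 0 ≤ L ∧ ∀ x y, ‖x‖ ≤ R → ‖y‖ ≤ R →
      ‖stateDrift c e f q x - stateDrift c e f q y‖ ≤ L * ‖x - y‖ := by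
  have : FiniteDimensional ℝ Hd := e.toBasis.finiteDimensional_of_finite
  have : ProperSpace Hd := FiniteDimensional.proper ℝ Hd
  have h := contDiff_stateDrift c e f hq hq_sum
  obtain ⟨L, hL⟩ := (isCompact_closedBall (0 : Hd) R).exists_bound_of_continuousOn
    (h.continuous_fderiv one_ne_zero).continuousOn
  refine ⟨|L|, abs_nonneg _, fun x y hx hy => ?_⟩
  refine (convex_closedBall (0 : Hd) R).norm_image_sub_le_of_norm_fderiv_le
    (fun z _ => h.differentiable one_ne_zero z) (fun z hz => (hL z hz).trans (le_abs_self L))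
    (by simpa using hy) (by simpa using hx)

/-- Coercivity: the energy which the quadratic and cubic terms exchange with the fast variables
combines to `‖A²₁ x‖² - ‖B²₁₁(x, x)‖²`. -/
lemma exists_coercive [CompleteSpace Hd] [CompleteSpace Hi] (hq : ∀ m, 0 ≤ q m)
    (hq_sum : Summable q)
    (hC1 : c.A21 = ContinuousLinearMap.adjoint c.A12)
    (hC2 : ∀ x x' : Hd, ⟪c.B111 x' x, x⟫ = 0)
    (hC3 : ∀ (x x' : Hd) (y : Hi), ⟪c.B112 x' y, x⟫ = -⟪c.B211 x' x, y⟫) (M : ℝ) :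
    ∃ κ : ℝ, 0 ≤ κ ∧ ∀ x φ : Hd, ‖φ‖ ≤ M → ⟪x, φ + stateDrift c e f q x⟫ ≤ κ * (1 + ‖x‖ ^ 2) := by
  obtain ⟨S, hS⟩ := exists_stratonovich_eq c e f hq hq_sum
  refine ⟨|M| + ‖c.A11‖ + ‖c.A21‖ ^ 2 + ‖S‖, by positivity, fun x φ hφ => ?_⟩
  have h1 : ⟪x, φ⟫ ≤ |M| * (1 + ‖x‖ ^ 2) := by
    have h := (real_inner_le_norm x φ).trans (mul_le_mul_of_nonneg_left
      (hφ.trans (le_abs_self M)) (norm_nonneg x))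
    nlinarith [abs_nonneg M, sq_nonneg (‖x‖ - 1)]
  have hop : ∀ A : Hd →L[ℝ] Hd, ⟪x, A x⟫ ≤ ‖A‖ * (1 + ‖x‖ ^ 2) := fun A => by
    have h := (real_inner_le_norm x (A x)).trans (mul_le_mul_of_nonneg_left
      (A.le_opNorm x) (norm_nonneg x))
    nlinarith [norm_nonneg A]
  have h2 : ⟪x, c.B111 x x⟫ = 0 := by rw [real_inner_comm, hC2]
  set u := c.A21 x
  set v := c.B211 x x
  have h3 : ⟪x, c.A12 (u + v)⟫ = ⟪u, u + v⟫ := by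
    rw [← ContinuousLinearMap.adjoint_inner_left, ← hC1]
  have h4 : ⟪x, c.B112 x (u + v)⟫ = -⟪v, u + v⟫ := by rw [real_inner_comm, hC3]
  have h5 : ⟪u, u + v⟫ + -⟪v, u + v⟫ ≤ ‖c.A21‖ ^ 2 * (1 + ‖x‖ ^ 2) := by
    have h6 : ⟪u, u + v⟫ + -⟪v, u + v⟫ = ‖u‖ ^ 2 - ‖v‖ ^ 2 := by
      rw [inner_add_right, inner_add_right, real_inner_self_eq_norm_sq, real_inner_self_eq_norm_sq,
        real_inner_comm u v]
      ring
    have h7 : ‖u‖ ^ 2 ≤ (‖c.A21‖ * ‖x‖) ^ 2 :=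
      pow_le_pow_left₀ (norm_nonneg _) (c.A21.le_opNorm x) 2
    rw [h6]
    nlinarith [sq_nonneg ‖v‖, sq_nonneg ‖c.A21‖]
  have h8 := hop c.A11
  have h9 := hop S
  simp only [stateDrift, inner_add_right, hS] at *
  linarith

end Coefficients

/-! ### Comparison of elementary integrals -/

section Elementary

/-- Finitely many times in `[0, T]` are covered by a monotone grid from `0` to `T`. -/
lemma exists_monotone_grid (T : ℝ≥0) (E : Finset ℝ≥0) :
    ∃ (g : ℕ → ℝ≥0) (N : ℕ), Monotone g ∧ g 0 = 0 ∧ (∀ j, g j ≤ T) ∧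
      ∀ x ∈ E, x ≤ T → ∃ j ≤ N, g j = x := by
  classical
  set E' : Finset ℝ≥0 := insert 0 (E.filter (· ≤ T)) with hE'
  have hle : ∀ x ∈ E', x ≤ T := fun x hx => by
    rcases Finset.mem_insert.1 hx with rfl | hx
    · exact zero_le
    · exact (Finset.mem_filter.1 hx).2
  set o := E'.orderEmbOfFin rfl
  set g : ℕ → ℝ≥0 := fun j => if h : j < E'.card then o ⟨j, h⟩ else T with hg
  have hgT : ∀ j, g j ≤ T := fun j => by
    simp only [hg]
    split_ifs with h
    · exact hle _ (E'.orderEmbOfFin_mem rfl _)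
    · exact le_rfl
  have hmono : Monotone g := fun i j hij => by
    by_cases hj : j < E'.card
    · have hi : i < E'.card := by omega
      simp only [hg, dif_pos hi, dif_pos hj]
      exact o.monotone (by simpa using hij)
    · have : g j = T := by simp [hg, hj]
      exact this ▸ hgT i
  have hrange : ∀ x ∈ E', ∃ j < E'.card, g j = x := fun x hx => by
    have h1 : x ∈ Set.range o := by
      rw [Finset.range_orderEmbOfFin]; exact hx
    obtain ⟨i, hi⟩ := h1
    exact ⟨i, i.2, by simp [hg, hi]⟩
  refine ⟨g, E'.card, hmono, ?_, hgT, fun x hx hxT => ?_⟩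
  · obtain ⟨j, -, hj⟩ := hrange 0 (Finset.mem_insert_self _ _)
    exact le_antisymm (hj ▸ hmono (Nat.zero_le j)) zero_le
  · obtain ⟨j, hj, hj'⟩ := hrange x
      (Finset.mem_insert_of_mem (Finset.mem_filter.2 ⟨hx, hxT⟩))
    exact ⟨j, hj.le, hj'⟩

variable {Hd Hi Ω : Type*} [NormedAddCommGroup Hd] [InnerProductSpace ℝ Hd]
  [NormedAddCommGroup Hi] [InnerProductSpace ℝ Hi] {mΩ : MeasurableSpace Ω}
  {F : Filtration ℝ≥0 mΩ} {P : Measure Ω}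
  {f : HilbertBasis ℕ ℝ Hi} {Q : Hi →L[ℝ] Hi} {q : ℕ → ℝ} {W : ℝ≥0 → Ω → Hi}

lemma hsNormSq_add_le (hq : ∀ m, 0 ≤ q m) (Φ Ψ : Hi →L[ℝ] Hd) :
    hsNormSq f q (Φ + Ψ) ≤ 2 * hsNormSq f q Φ + 2 * hsNormSq f q Ψ := by
  simp only [hsNormSq]
  rw [← ENNReal.tsum_mul_left, ← ENNReal.tsum_mul_left, ← ENNReal.tsum_add]
  refine ENNReal.tsum_le_tsum fun m => ?_
  rw [← ENNReal.ofReal_ofNat, ← ENNReal.ofReal_mul (by norm_num), ← ENNReal.ofReal_mul (by norm_num),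
    ← ENNReal.ofReal_add (mul_nonneg (by norm_num) (mul_nonneg (hq m) (by positivity)))
      (mul_nonneg (by norm_num) (mul_nonneg (hq m) (by positivity)))]
  refine ENNReal.ofReal_le_ofReal ?_
  have h1 := pow_le_pow_left₀ (norm_nonneg _) (norm_add_le (Φ (f m)) (Ψ (f m))) 2
  have h2 : ‖(Φ + Ψ) (f m)‖ ^ 2 ≤ 2 * ‖Φ (f m)‖ ^ 2 + 2 * ‖Ψ (f m)‖ ^ 2 := by
    rw [add_apply]
    nlinarith [sq_nonneg (‖Φ (f m)‖ - ‖Ψ (f m)‖)]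
  have := mul_le_mul_of_nonneg_left h2 (hq m)
  linarith

namespace SimpleIntegrand

/-- The grid `g` contains all jump times of `S` up to `T`. -/
def IsAdaptedGrid (S : SimpleIntegrand F Hi Hd) (T : ℝ≥0) (g : ℕ → ℝ≥0) : Prop :=
  ∀ i ≤ S.n, S.τ i ≤ T → ∃ j, g j = S.τ i

variable {S : SimpleIntegrand F Hi Hd} {T : ℝ≥0} {g : ℕ → ℝ≥0}

lemma IsAdaptedGrid.le_of_lt (h : S.IsAdaptedGrid T g) (hg : Monotone g) (hgT : ∀ j, g j ≤ T)
    {i j : ℕ} (hi : i ≤ S.n) (hlt : S.τ i < g (j + 1)) : S.τ i ≤ g j := by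
  obtain ⟨l, hl⟩ := h i hi (hlt.le.trans (hgT _))
  rw [← hl] at hlt ⊢
  have : l < j + 1 := by
    by_contra hcon
    exact absurd (hg (not_lt.1 hcon)) (not_le.2 hlt)
  exact hg (by omega)

lemma process_eq_of_mem_Ioc (h : S.IsAdaptedGrid T g) (hg : Monotone g) (hgT : ∀ j, g j ≤ T)
    {j : ℕ} {s : ℝ≥0} (hs : g j < s) (hs' : s ≤ g (j + 1)) (ω : Ω) :
    S.process s ω = S.process (g (j + 1)) ω := by
  refine Finset.sum_congr rfl fun i hi => ?_
  have hi' := Finset.mem_range.1 hi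
  have h1 : ∀ k ≤ S.n, (S.τ k < s ↔ S.τ k < g (j + 1)) := fun k hk =>
    ⟨fun hlt => hlt.trans_le hs', fun hlt => (h.le_of_lt hg hgT hk hlt).trans_lt hs⟩
  have h2 : s ∈ Set.Ioc (S.τ i) (S.τ (i + 1)) ↔ g (j + 1) ∈ Set.Ioc (S.τ i) (S.τ (i + 1)) := by
    rw [Set.mem_Ioc, Set.mem_Ioc, h1 i (by omega), ← not_lt, ← not_lt, h1 (i + 1) (by omega)]
  by_cases hm : s ∈ Set.Ioc (S.τ i) (S.τ (i + 1))
  · rw [Set.indicator_of_mem hm, Set.indicator_of_mem (h2.1 hm)]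
  · rw [Set.indicator_of_notMem hm, Set.indicator_of_notMem (fun h' => hm (h2.2 h'))]

lemma stronglyMeasurable_process (h : S.IsAdaptedGrid T g) (hg : Monotone g)
    (hgT : ∀ j, g j ≤ T) (j : ℕ) : StronglyMeasurable[F (g j)] (S.process (g (j + 1))) := by
  refine Finset.stronglyMeasurable_fun_sum _ fun i hi => ?_
  have hi' := Finset.mem_range.1 hi
  by_cases hm : g (j + 1) ∈ Set.Ioc (S.τ i) (S.τ (i + 1))
  · simp only [Set.indicator_of_mem hm]
    exact (S.meas i).mono (F.mono (h.le_of_lt hg hgT (by omega) hm.1))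
  · simp only [Set.indicator_of_notMem hm]
    exact stronglyMeasurable_const

/-- The increment of `w` up to a time `a`, which is a grid point or lies beyond `T`, is the sum
of the increments over the cells of the grid before `a`. -/
lemma sub_eq_sum_ite (hg : Monotone g) (hg0 : g 0 = 0) (hgT : ∀ j, g j ≤ T)
    {a : ℝ≥0} (ha : a ≤ T → ∃ j, g j = a) (w : ℝ≥0 → Hi) (J : ℕ) :
    w (min a (g J)) - w 0 =
      ∑ j ∈ Finset.range J, if g (j + 1) ≤ a then w (g (j + 1)) - w (g j) else 0 := by
  induction J with
  | zero => simp [hg0]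
  | succ J ih =>
    rw [Finset.sum_range_succ, ← ih]
    have hle := hg (Nat.le_succ J)
    split_ifs with h
    · rw [min_eq_right h, min_eq_right (hle.trans h)]
      abel
    · have hlt := not_le.1 h
      obtain ⟨l, hl⟩ := ha (hlt.le.trans (hgT _))
      have hl' : l < J + 1 := by
        by_contra hcon
        exact h (hl ▸ hg (not_lt.1 hcon))
      have : a ≤ g J := hl ▸ hg (by omega)
      rw [min_eq_left hlt.le, min_eq_left this, add_zero]

/-- On a grid adapted to it, the integral of a simple integrand is a sum over the grid. -/
lemma integral_eq_sum (h : S.IsAdaptedGrid T g) (hg : Monotone g) (hg0 : g 0 = 0)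
    (hgT : ∀ j, g j ≤ T) (J : ℕ) (ω : Ω) :
    S.integral W (g J) ω =
      ∑ j ∈ Finset.range J, S.process (g (j + 1)) ω (W (g (j + 1)) ω - W (g j) ω) := by
  simp only [SimpleIntegrand.integral, SimpleIntegrand.process, sum_apply]
  rw [Finset.sum_comm]
  refine Finset.sum_congr rfl fun i hi => ?_
  have hi' := Finset.mem_range.1 hi
  have h1 := sub_eq_sum_ite hg hg0 hgT (h i (by omega)) (fun t => W t ω) J
  have h2 := sub_eq_sum_ite hg hg0 hgT (h (i + 1) (by omega)) (fun t => W t ω) J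
  rw [← sub_sub_sub_cancel_right _ _ (W 0 ω), h1, h2, ← Finset.sum_sub_distrib, map_sum]
  refine Finset.sum_congr rfl fun j _ => ?_
  have hm := S.mono (Nat.le_succ i)
  by_cases ha : g (j + 1) ≤ S.τ i
  · have hb := ha.trans hm
    rw [if_pos ha, if_pos hb, Set.indicator_of_notMem (fun h' => not_lt.2 ha h'.1)]
    simp
  · rw [if_neg ha, sub_zero]
    by_cases hb : g (j + 1) ≤ S.τ (i + 1)
    · rw [if_pos hb, Set.indicator_of_mem
        (show g (j + 1) ∈ Set.Ioc (S.τ i) (S.τ (i + 1)) from ⟨not_le.1 ha, hb⟩)]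
    · rw [if_neg hb, Set.indicator_of_notMem (fun h' => hb h'.2)]
      simp

variable [IsProbabilityMeasure P] [MeasurableSpace Hi] [BorelSpace Hi] [FiniteDimensional ℝ Hd]
  [CompleteSpace Hi]

/-- Two elementary integrals are close at the times of a finite set if their integrands are close. -/
lemma measure_exists_le_integral_sub_le (hW : IsQWiener F P Q W) (hQ : ∀ m, Q (f m) = q m • f m)
    (hq : ∀ m, 0 ≤ q m) (S S' : SimpleIntegrand F Hi Hd) (T : ℝ≥0) (E : Finset ℝ≥0)
    {ε N : ℝ} (hε : 0 < ε) :
    P {ω | ∃ t ∈ E, t ≤ T ∧ ε ≤ ‖S.integral W t ω - S'.integral W t ω‖} ≤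
      ENNReal.ofReal (N / ε ^ 2) + P {ω | ENNReal.ofReal N < ∫⁻ s in Set.Icc (0 : ℝ) T,
        hsNormSq f q (S.process s.toNNReal ω - S'.process s.toNNReal ω)} := by
  classical
  obtain ⟨g, n, hg, hg0, hgT, hgE⟩ := exists_monotone_grid T
    (E ∪ ((Finset.range (S.n + 1)).image S.τ ∪ (Finset.range (S'.n + 1)).image S'.τ))
  have hS : S.IsAdaptedGrid T g := fun i hi hT => by
    obtain ⟨j, -, hj⟩ := hgE (S.τ i) (by
      simp only [Finset.mem_union, Finset.mem_image, Finset.mem_range]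
      exact .inr (.inl ⟨i, by omega, rfl⟩)) hT
    exact ⟨j, hj⟩
  have hS' : S'.IsAdaptedGrid T g := fun i hi hT => by
    obtain ⟨j, -, hj⟩ := hgE (S'.τ i) (by
      simp only [Finset.mem_union, Finset.mem_image, Finset.mem_range]
      exact .inr (.inr ⟨i, by omega, rfl⟩)) hT
    exact ⟨j, hj⟩
  set Φ : ℕ → Ω → Hi →L[ℝ] Hd := fun j ω => S.process (g (j + 1)) ω - S'.process (g (j + 1)) ω
  have hΦ : ∀ j, StronglyMeasurable[F (g j)] (Φ j) := fun j =>
    (stronglyMeasurable_process hS hg hgT j).sub (stronglyMeasurable_process hS' hg hgT j)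
  -- both integrals are sums over the common grid, to which the Lenglart-type inequality applies
  have hmain := hW.measure_exists_le_norm_sum_apply_le hQ hq hg hΦ n (N := N) hε
  have hV : ∀ k ω, ∑ i ∈ Finset.range k,
      ENNReal.ofReal ((g (i + 1) : ℝ) - g i) * hsNormSq f q (Φ i ω) ≤
      ∫⁻ s in Set.Ioc (0 : ℝ) (g k),
        hsNormSq f q (S.process s.toNNReal ω - S'.process s.toNNReal ω) := by
    intro k ω
    induction k with
    | zero => simp
    | succ k ih =>
      have hle : (g k : ℝ) ≤ g (k + 1) := by exact_mod_cast hg (Nat.le_succ k)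
      rw [Finset.sum_range_succ, ← Set.Ioc_union_Ioc_eq_Ioc (NNReal.coe_nonneg (g k)) hle,
        lintegral_union measurableSet_Ioc (Set.Ioc_disjoint_Ioc_of_le le_rfl)]
      refine add_le_add ih (le_of_eq ?_)
      rw [setLIntegral_congr_fun measurableSet_Ioc (g := fun _ => hsNormSq f q (Φ k ω))]
      · rw [setLIntegral_const, Real.volume_Ioc, mul_comm]
      · intro s hs
        have h1 : g k < s.toNNReal := by
          rw [← NNReal.coe_lt_coe, Real.coe_toNNReal _ ((NNReal.coe_nonneg _).trans hs.1.le)]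
          exact hs.1
        have h2 : s.toNNReal ≤ g (k + 1) := Real.toNNReal_le_iff_le_coe.2 hs.2
        simp only [Φ]
        rw [process_eq_of_mem_Ioc hS hg hgT h1 h2, process_eq_of_mem_Ioc hS' hg hgT h1 h2]
  refine le_trans (measure_mono ?_) ((measure_union_le _ _).trans (add_le_add_left hmain _))
  rintro ω ⟨t, ht, htT, hle⟩
  by_cases hω : ∫⁻ s in Set.Icc (0 : ℝ) T,
      hsNormSq f q (S.process s.toNNReal ω - S'.process s.toNNReal ω) ≤ ENNReal.ofReal N
  · left
    obtain ⟨j, hj, rfl⟩ := hgE t (Finset.mem_union_left _ ht) htT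
    refine ⟨⟨j, hj, ?_⟩, (hV n ω).trans (le_trans (lintegral_mono_set ?_) hω)⟩
    · rw [integral_eq_sum hS hg hg0 hgT, integral_eq_sum hS' hg hg0 hgT,
        ← Finset.sum_sub_distrib] at hle
      simpa [Φ] using hle
    · exact Set.Ioc_subset_Icc_self.trans
        (Set.Icc_subset_Icc le_rfl (by exact_mod_cast hgT n))
  · exact .inr (not_le.1 hω)

end SimpleIntegrand

end Elementary

/-! ### Riemann sums for the Itô integral -/

section RiemannSums

lemma ofNat_mul_ofReal_div (n : ℕ) [n.AtLeastTwo] (ε : ℝ) :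
    (ofNat(n) : ℝ≥0∞) * ENNReal.ofReal (ε / ofNat(n)) = ENNReal.ofReal ε := by
  rw [← ENNReal.ofReal_ofNat, ← ENNReal.ofReal_mul (Nat.ofNat_nonneg n),
    mul_div_cancel₀ _ (NeZero.ne _)]

lemma exists_dyadic_Ioc (T : ℝ≥0) (a : ℕ) {s : ℝ≥0} (hs : 0 < s) (hsT : s ≤ T) :
    ∃ l < 2 ^ a, dyadic T a l < s ∧ s ≤ dyadic T a (l + 1) := by
  by_contra! hcon
  have h : ∀ l ≤ 2 ^ a, dyadic T a l < s := by
    intro l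
    induction l with
    | zero => simpa using hs
    | succ l ih => exact fun hl => hcon l (by omega) (ih (by omega))
  have := h (2 ^ a) le_rfl
  rw [dyadic_two_pow] at this
  exact absurd hsT (not_le.2 this)

/-- A sum over the cells of a grid of increments stopped at a grid point `g j` is a sum over the
cells before `g j`. -/
lemma sum_range_min_eq {E : Type*} [AddCommMonoid E] {g : ℕ → ℝ≥0} (hg : Monotone g)
    (G : ℕ → ℝ≥0 → ℝ≥0 → E) (hG : ∀ i t, G i t t = 0) {j n : ℕ} (hj : j ≤ n) :
    ∑ i ∈ Finset.range n, G i (min (g i) (g j)) (min (g (i + 1)) (g j)) =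
      ∑ i ∈ Finset.range j, G i (g i) (g (i + 1)) := by
  rw [← Finset.sum_subset (Finset.range_mono hj)]
  · refine Finset.sum_congr rfl fun i hi => ?_
    have := Finset.mem_range.1 hi
    rw [min_eq_left (hg (by omega)), min_eq_left (hg (by omega))]
  · intro i _ hi
    have : j ≤ i := by simpa using hi
    rw [min_eq_right (hg this), min_eq_right (hg (by omega)), hG]

variable {Hd Hi Ω : Type*} [NormedAddCommGroup Hd] [InnerProductSpace ℝ Hd]
  [NormedAddCommGroup Hi] [InnerProductSpace ℝ Hi] {mΩ : MeasurableSpace Ω}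
  {F : Filtration ℝ≥0 mΩ} {P : Measure Ω} [IsProbabilityMeasure P]
  {f : HilbertBasis ℕ ℝ Hi} {Q : Hi →L[ℝ] Hi} {q : ℕ → ℝ} {W : ℝ≥0 → Ω → Hi}
  [MeasurableSpace Hi] [BorelSpace Hi] [FiniteDimensional ℝ Hd] [CompleteSpace Hi]

/-- The simple integrand which uses `B (X t)`, evaluated at the left end points `t` of the dyadic
grid, as long as `‖X t‖ ≤ k`; the cut-off makes it bounded. -/
noncomputable def riemannIntegrand (B : Hd →L[ℝ] Hi →L[ℝ] Hd) (T : ℝ≥0) (a : ℕ) (k : ℝ)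
    {X : ℝ≥0 → Ω → Hd} (hX : ∀ t ≤ T, StronglyMeasurable[F t] (X t)) :
    SimpleIntegrand F Hi Hd where
  n := 2 ^ a
  τ := dyadic T a
  Φ i := {ω | ‖X (dyadic T a i) ω‖ ≤ k}.indicator fun ω => B (X (dyadic T a i) ω)
  mono := dyadic_mono T a
  meas i := (B.continuous.comp_stronglyMeasurable (hX _ (dyadic_le T a i))).indicator
    ((hX _ (dyadic_le T a i)).norm.measurableSet_le stronglyMeasurable_const)
  bdd := by
    refine ⟨‖B‖ * |k|, fun i ω => ?_⟩
    by_cases hω : ‖X (dyadic T a i) ω‖ ≤ k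
    · rw [Set.indicator_of_mem (show ω ∈ {ω | ‖X (dyadic T a i) ω‖ ≤ k} from hω)]
      refine (B.le_opNorm _).trans ?_
      have := hω.trans (le_abs_self k)
      gcongr
    · rw [Set.indicator_of_notMem (show ω ∉ {ω | ‖X (dyadic T a i) ω‖ ≤ k} from hω), norm_zero]
      positivity

variable {B : Hd →L[ℝ] Hi →L[ℝ] Hd} {T : ℝ≥0} {a : ℕ} {k : ℝ} {X : ℝ≥0 → Ω → Hd}
  {hX : ∀ t ≤ T, StronglyMeasurable[F t] (X t)} {ω : Ω}

lemma riemannIntegrand_process (hω : ∀ t ≤ T, ‖X t ω‖ ≤ k) {l : ℕ} (hl : l < 2 ^ a) {s : ℝ≥0}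
    (hs : dyadic T a l < s) (hs' : s ≤ dyadic T a (l + 1)) :
    (riemannIntegrand B T a k hX).process s ω = B (X (dyadic T a l) ω) := by
  rw [SimpleIntegrand.process, Finset.sum_eq_single l]
  · rw [Set.indicator_of_mem (show s ∈ Set.Ioc ((riemannIntegrand B T a k hX).τ l)
      ((riemannIntegrand B T a k hX).τ (l + 1)) from ⟨hs, hs'⟩)]
    exact Set.indicator_of_mem (s := {ω | ‖X (dyadic T a l) ω‖ ≤ k}) (hω _ (dyadic_le T a l))
      fun ω => B (X (dyadic T a l) ω)
  · intro i _ hil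
    refine Set.indicator_of_notMem (fun h => hil ?_) _
    have h1 : dyadic T a i < s := h.1
    have h2 : s ≤ dyadic T a (i + 1) := h.2
    by_contra hne
    rcases Nat.lt_or_gt_of_ne hne with h3 | h3
    · exact absurd (h2.trans (dyadic_mono T a h3)) (not_le.2 hs)
    · exact absurd (hs'.trans (dyadic_mono T a h3)) (not_le.2 h1)
  · intro h
    exact absurd (Finset.mem_range.2 hl) h

lemma riemannIntegrand_integral (hω : ∀ t ≤ T, ‖X t ω‖ ≤ k) (t : ℝ≥0) :
    (riemannIntegrand B T a k hX).integral W t ω = ∑ i ∈ Finset.range (2 ^ a),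
      B (X (dyadic T a i) ω) (W (min (dyadic T a (i + 1)) t) ω - W (min (dyadic T a i) t) ω) := by
  refine Finset.sum_congr rfl fun i _ => ?_
  have : (riemannIntegrand B T a k hX).Φ i ω = B (X (dyadic T a i) ω) :=
    Set.indicator_of_mem (s := {ω | ‖X (dyadic T a i) ω‖ ≤ k}) (hω _ (dyadic_le T a i))
      fun ω => B (X (dyadic T a i) ω)
  rw [this]
  rfl

lemma riemannIntegrand_integral_dyadic (hω : ∀ t ≤ T, ‖X t ω‖ ≤ k) {j : ℕ} (hj : j ≤ 2 ^ a) :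
    (riemannIntegrand B T a k hX).integral W (dyadic T a j) ω = ∑ i ∈ Finset.range j,
      B (X (dyadic T a i) ω) (W (dyadic T a (i + 1)) ω - W (dyadic T a i) ω) := by
  rw [riemannIntegrand_integral hω]
  exact sum_range_min_eq (dyadic_mono T a)
    (fun i s t => B (X (dyadic T a i) ω) (W t ω - W s ω)) (fun i t => by simp) hj

/-- If `Y` is pathwise close to the values which the simple integrand uses, the integrands are close
in the Hilbert–Schmidt sense. -/
lemma hsNormSq_riemann_sub_le (hq : ∀ m, 0 ≤ q m) (hq_sum : Summable q)
    (hω : ∀ t ≤ T, ‖X t ω‖ ≤ k) {Y : ℝ≥0 → Hd} {θ : ℝ}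
    (hY : ∀ l < 2 ^ a, ∀ s : ℝ≥0, dyadic T a l ≤ s → s ≤ dyadic T a (l + 1) →
      ‖X (dyadic T a l) ω - Y s‖ ≤ θ) {s : ℝ} (hs : s ∈ Set.Ioc (0 : ℝ) T) :
    hsNormSq f q ((riemannIntegrand B T a k hX).process s.toNNReal ω - B (Y s.toNNReal)) ≤
      ENNReal.ofReal ((∑' m, q m) * (‖B‖ * θ) ^ 2) := by
  have hτ : 0 ≤ ∑' m, q m := tsum_nonneg hq
  obtain ⟨l, hl, h1, h2⟩ := exists_dyadic_Ioc T a (Real.toNNReal_pos.2 hs.1)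
    (Real.toNNReal_le_iff_le_coe.2 hs.2)
  rw [riemannIntegrand_process hω hl h1 h2, ← map_sub]
  refine (hsNormSq_le f hq hq_sum _).trans (ENNReal.ofReal_le_ofReal ?_)
  refine mul_le_mul_of_nonneg_left ?_ hτ
  refine pow_le_pow_left₀ (norm_nonneg _) ((B.le_opNorm _).trans ?_) 2
  exact mul_le_mul_of_nonneg_left (hY l hl _ h1.le h2) (norm_nonneg _)

/-- The Itô integral of `B (X)` for a continuous adapted process `X` is the limit in probability of
its Riemann sums along the dyadic grids. -/
lemma exists_measure_riemannSum_sub_le (hW : IsQWiener F P Q W) (hQ : ∀ m, Q (f m) = q m • f m)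
    (hq : ∀ m, 0 ≤ q m) (hq_sum : Summable q)
    (hX : ∀ t ≤ T, StronglyMeasurable[F t] (X t))
    (hXc : ∀ᵐ ω ∂P, ContinuousOn (fun t => X t ω) (Set.Iic T)) {I : ℝ≥0 → Ω → Hd}
    (hI : IsItoIntegral F P f q W T (fun s ω => B (X s ω)) I) {δ ε : ℝ} (hδ : 0 < δ)
    (hε : 0 < ε) :
    ∃ a₀ : ℕ, ∀ a ≥ a₀, P {ω | ∃ j ≤ 2 ^ a, δ ≤ ‖(∑ i ∈ Finset.range j,
      B (X (dyadic T a i) ω) (W (dyadic T a (i + 1)) ω - W (dyadic T a i) ω)) -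
        I (dyadic T a j) ω‖} ≤ ENNReal.ofReal ε := by
  classical
  have hXm : ∀ t ≤ T, AEStronglyMeasurable (X t) P := fun t ht =>
    ((hX t ht).mono (F.le t)).aestronglyMeasurable
  have hε' : 0 < ε / 6 := by positivity
  have hεe : 0 < ENNReal.ofReal (ε / 6) := ENNReal.ofReal_pos.2 hε'
  obtain ⟨ρ, hρ, hPρ⟩ := exists_bound T hXm hXc hεe
  set N : ℝ := ε / 6 * (δ / 2) ^ 2 with hN
  have hN0 : 0 < N := by positivity
  have hτ : 0 ≤ ∑' m, q m := tsum_nonneg hq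
  -- a modulus of continuity whose contribution to the integrand is at most `N / 4`
  obtain ⟨θ, hθ, hθN⟩ : ∃ θ : ℝ, 0 < θ ∧ (∑' m, q m) * (‖B‖ * θ) ^ 2 * T ≤ N / 4 := by
    have hc : ContinuousAt (fun θ : ℝ => (∑' m, q m) * (‖B‖ * θ) ^ 2 * T) 0 := by fun_prop
    have h0 : (∑' m, q m) * (‖B‖ * 0) ^ 2 * T < N / 4 := by simpa using hN0
    have h1 : ∀ᶠ θ in 𝓝[>] (0 : ℝ), (∑' m, q m) * (‖B‖ * θ) ^ 2 * T < N / 4 :=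
      (hc.tendsto.mono_left nhdsWithin_le_nhds).eventually_lt_const h0
    obtain ⟨θ, h2, h3⟩ := (h1.and self_mem_nhdsWithin).exists
    exact ⟨θ, h3, h2.le⟩
  obtain ⟨a₀, ha₀⟩ := exists_modulus T hXm hXc hθ hεe
  obtain ⟨S, hS1, hS2⟩ := hI
  obtain ⟨m, hm1, hm2⟩ := (((hS1 _ (ENNReal.ofReal_pos.2 (show 0 < N / 4 by
    positivity))).eventually_le_const hεe).and
    ((hS2 (δ / 2) (half_pos hδ)).eventually_le_const hεe)).exists
  refine ⟨a₀, fun a ha => ?_⟩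
  set R := riemannIntegrand B T a ρ hX with hR
  have hcmp := SimpleIntegrand.measure_exists_le_integral_sub_le hW hQ hq R (S m) T
    ((Finset.range (2 ^ a + 1)).image (dyadic T a)) (N := N) (half_pos hδ)
  set bad₁ := {ω | ∃ t ≤ T, ρ < ‖X t ω‖}
  set bad₂ := {ω | ∃ s ≤ T, ∃ t ≤ T, dist s t ≤ T / 2 ^ a ∧ θ ≤ ‖X s ω - X t ω‖}
  set bad₃ := {ω | ENNReal.ofReal (N / 4) ≤ ∫⁻ s in Set.Icc (0 : ℝ) T,
        hsNormSq f q ((S m).process s.toNNReal ω - B (X s.toNNReal ω))}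
  set bad₄ := {ω | ∃ t ≤ T, δ / 2 ≤ ‖(S m).integral W t ω - I t ω‖}
  -- on the good event, the two simple integrands are close
  have hgood : {ω | ENNReal.ofReal N < ∫⁻ s in Set.Icc (0 : ℝ) T,
        hsNormSq f q (R.process s.toNNReal ω - (S m).process s.toNNReal ω)} ⊆
      bad₁ ∪ (bad₂ ∪ bad₃) := by
    intro ω hω
    by_contra hcon
    simp only [Set.mem_union, not_or] at hcon
    obtain ⟨h1, h2, h3⟩ := hcon
    have hb : ∀ t ≤ T, ‖X t ω‖ ≤ ρ := fun t ht => by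
      by_contra h; exact h1 ⟨t, ht, not_le.1 h⟩
    have hmod : ∀ l < 2 ^ a, ∀ s : ℝ≥0, dyadic T a l ≤ s → s ≤ dyadic T a (l + 1) →
        ‖X (dyadic T a l) ω - X s ω‖ ≤ θ := fun l _ s hs hs' => by
      by_contra h
      exact h2 ⟨_, dyadic_le T a l, s, hs'.trans (dyadic_le T a _), dist_le_of_mem_cell T le_rfl
        (dyadic_mono T a (Nat.le_succ l)) hs hs', (not_le.1 h).le⟩
    have h3' : ∫⁻ s in Set.Icc (0 : ℝ) T,
        hsNormSq f q ((S m).process s.toNNReal ω - B (X s.toNNReal ω)) ≤ ENNReal.ofReal (N / 4) :=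
      (not_le.1 (show ¬ ENNReal.ofReal (N / 4) ≤ _ from h3)).le
    have hsymm : ∀ Φ Ψ : Hi →L[ℝ] Hd, hsNormSq f q (Φ - Ψ) = hsNormSq f q (Ψ - Φ) := fun Φ Ψ => by
      simp only [hsNormSq, sub_apply, norm_sub_rev]
    refine absurd (show ENNReal.ofReal N < _ from hω) (not_lt.2 ?_)
    rw [← setLIntegral_congr (Ioc_ae_eq_Icc (a := (0 : ℝ)) (b := T))] at h3' ⊢
    set κ := (∑' m, q m) * (‖B‖ * θ) ^ 2
    calc ∫⁻ s in Set.Ioc (0 : ℝ) T,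
          hsNormSq f q (R.process s.toNNReal ω - (S m).process s.toNNReal ω)
        ≤ ∫⁻ s in Set.Ioc (0 : ℝ) T, (2 * ENNReal.ofReal κ +
            2 * hsNormSq f q ((S m).process s.toNNReal ω - B (X s.toNNReal ω))) := by
          refine setLIntegral_mono' measurableSet_Ioc fun s hs => ?_
          rw [← sub_add_sub_cancel _ (B (X s.toNNReal ω))]
          refine (hsNormSq_add_le hq _ _).trans (add_le_add ?_ (le_of_eq ?_))
          · exact mul_le_mul_right (hsNormSq_riemann_sub_le (Y := fun s => X s ω) hq hq_sum hb hmod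
              hs) _
          · rw [hsymm]
      _ = 2 * ENNReal.ofReal (κ * T) + 2 * ∫⁻ s in Set.Ioc (0 : ℝ) T,
            hsNormSq f q ((S m).process s.toNNReal ω - B (X s.toNNReal ω)) := by
          rw [lintegral_add_left measurable_const, setLIntegral_const, Real.volume_Ioc, sub_zero,
            lintegral_const_mul' _ _ (by simp), mul_assoc, ← ENNReal.ofReal_mul (by positivity)]
      _ ≤ 2 * ENNReal.ofReal (N / 4) + 2 * ENNReal.ofReal (N / 4) := by gcongr
      _ = ENNReal.ofReal N := by
          rw [← ENNReal.ofReal_ofNat, ← ENNReal.ofReal_mul (by norm_num),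
            ← ENNReal.ofReal_add (by positivity) (by positivity)]
          congr 1; ring
  have hsub : {ω | ∃ j ≤ 2 ^ a, δ ≤ ‖(∑ i ∈ Finset.range j,
      B (X (dyadic T a i) ω) (W (dyadic T a (i + 1)) ω - W (dyadic T a i) ω)) -
        I (dyadic T a j) ω‖} ⊆
      {ω | ∃ t ∈ (Finset.range (2 ^ a + 1)).image (dyadic T a), t ≤ T ∧
        δ / 2 ≤ ‖R.integral W t ω - (S m).integral W t ω‖} ∪ (bad₄ ∪ bad₁) := by
    rintro ω ⟨j, hj, hle⟩
    by_contra hcon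
    simp only [Set.mem_union, not_or] at hcon
    obtain ⟨h1, h2, h3⟩ := hcon
    have hb : ∀ t ≤ T, ‖X t ω‖ ≤ ρ := fun t ht => by
      by_contra h; exact h3 ⟨t, ht, not_le.1 h⟩
    have h4 : ‖R.integral W (dyadic T a j) ω - (S m).integral W (dyadic T a j) ω‖ < δ / 2 := by
      by_contra h
      exact h1 ⟨_, Finset.mem_image_of_mem _ (Finset.mem_range.2 (by omega)), dyadic_le T a j,
        not_lt.1 h⟩
    have h5 : ‖(S m).integral W (dyadic T a j) ω - I (dyadic T a j) ω‖ < δ / 2 := by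
      by_contra h
      exact h2 ⟨_, dyadic_le T a j, not_lt.1 h⟩
    rw [hR, riemannIntegrand_integral_dyadic hb hj] at h4
    have h6 := norm_sub_le_norm_sub_add_norm_sub (∑ i ∈ Finset.range j,
      B (X (dyadic T a i) ω) (W (dyadic T a (i + 1)) ω - W (dyadic T a i) ω))
      ((S m).integral W (dyadic T a j) ω) (I (dyadic T a j) ω)
    linarith
  have hNe : N / (δ / 2) ^ 2 = ε / 6 := by rw [hN]; field_simp
  rw [hNe] at hcmp
  calc P _ ≤ _ := (measure_mono hsub).trans (measure_union_le _ _)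
    _ ≤ (ENNReal.ofReal (ε / 6) + (ENNReal.ofReal (ε / 6) + (ENNReal.ofReal (ε / 6) +
          ENNReal.ofReal (ε / 6)))) + (ENNReal.ofReal (ε / 6) + ENNReal.ofReal (ε / 6)) := by
        refine add_le_add (hcmp.trans (add_le_add le_rfl ((measure_mono hgood).trans ?_)))
          ((measure_union_le _ _).trans (add_le_add hm2 hPρ))
        exact (measure_union_le _ _).trans
          (add_le_add hPρ ((measure_union_le _ _).trans (add_le_add (ha₀ a ha) hm1)))
    _ = ENNReal.ofReal ε := by
        rw [← ofNat_mul_ofReal_div 6 ε]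
        ring

end RiemannSums

/-! ### Processes which almost satisfy the Euler recursion -/

section Defect

variable {Hd Hi Ω : Type*} [NormedAddCommGroup Hd] [InnerProductSpace ℝ Hd]
  [NormedAddCommGroup Hi] [InnerProductSpace ℝ Hi] {mΩ : MeasurableSpace Ω}

/-- The defect of the process `X`, at the point `g j` of the grid `g`, as a solution of the Euler
scheme for `dX = β(t, X) dt + (A + B(X)) dW + dZ`, `X 0 = x₀ + Z 0`. -/
noncomputable def eulerDefect (β : ℝ → Hd → Hd) (A : Hi →L[ℝ] Hd) (B : Hd →L[ℝ] Hi →L[ℝ] Hd)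
    (W : ℝ≥0 → Ω → Hi) (Z : ℝ≥0 → Ω → Hd) (x₀ : Hd) (g : ℕ → ℝ≥0) (X : ℝ≥0 → Ω → Hd) (j : ℕ)
    (ω : Ω) : Hd :=
  X (g j) ω - (x₀ + Z (g j) ω + ∑ i ∈ Finset.range j,
    (((g (i + 1) : ℝ) - g i) • β (g i) (X (g i) ω) +
      (A + B (X (g i) ω)) (W (g (i + 1)) ω - W (g i) ω)))

variable {β : ℝ → Hd → Hd} {A : Hi →L[ℝ] Hd} {B : Hd →L[ℝ] Hi →L[ℝ] Hd}
  {W : ℝ≥0 → Ω → Hi} {x₀ : Hd} {T : ℝ≥0} {Z : ℝ≥0 → Ω → Hd}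

lemma residual_eq_eulerDefect_sub (g : ℕ → ℝ≥0) (X Y : ℝ≥0 → Ω → Hd) (j : ℕ) (ω : Ω) :
    residual B W g (fun i => β (g i)) (fun i => X (g i)) (fun i => Y (g i)) j ω =
      eulerDefect β A B W Z x₀ g X j ω - eulerDefect β A B W Z x₀ g Y j ω := by
  have h : ∀ u v S₁ S₂ D a : Hd, S₁ - S₂ = D → u - v - D = u - (a + S₁) - (v - (a + S₂)) := by
    rintro u v S₁ S₂ D a rfl; abel
  refine h _ _ _ _ _ _ ?_
  rw [← Finset.sum_sub_distrib]
  refine Finset.sum_congr rfl fun i _ => ?_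
  simp only [map_sub, smul_sub, add_apply, sub_apply]
  abel

variable {F : Filtration ℝ≥0 mΩ} {P : Measure Ω} [IsProbabilityMeasure P]
  {f : HilbertBasis ℕ ℝ Hi} {Q : Hi →L[ℝ] Hi} {q : ℕ → ℝ}
  [MeasurableSpace Hi] [BorelSpace Hi] [FiniteDimensional ℝ Hd] [CompleteSpace Hi]

lemma continuous_of_uncurry_continuousOn (hβ : ContinuousOn (Function.uncurry β)
    (Set.Icc 0 (T : ℝ) ×ˢ Set.univ)) {t : ℝ≥0} (ht : t ≤ T) : Continuous (β t) := by
  have : (β t) = Function.uncurry β ∘ fun x => ((t : ℝ), x) := rfl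
  rw [this]
  refine hβ.comp_continuous (by fun_prop) fun x => ⟨⟨t.2, by exact_mod_cast ht⟩, trivial⟩

/-- Stability: two adapted continuous processes whose Euler defects are small on the fine grids are
close in probability, uniformly on `[0, T]`. -/
lemma exists_eulerDefect_bound (hW : IsQWiener F P Q W) (hQ : ∀ m, Q (f m) = q m • f m)
    (hq : ∀ m, 0 ≤ q m) (hq_sum : Summable q)
    (hβ : ContinuousOn (Function.uncurry β) (Set.Icc 0 (T : ℝ) ×ˢ Set.univ)) {R L : ℝ} (hL : 0 ≤ L)
    (hLip : ∀ s ∈ Set.Icc 0 (T : ℝ), ∀ x y, ‖x‖ ≤ R → ‖y‖ ≤ R →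
      ‖β s x - β s y‖ ≤ L * ‖x - y‖) {δ ε : ℝ} (hδ : 0 < δ) (hε : 0 < ε) :
    ∃ η : ℝ, 0 < η ∧ ∀ X Y : ℝ≥0 → Ω → Hd,
      (∀ t ≤ T, StronglyMeasurable[F t] (X t)) → (∀ t ≤ T, StronglyMeasurable[F t] (Y t)) →
      (∀ᵐ ω ∂P, ContinuousOn (fun t => X t ω) (Set.Iic T)) →
      (∀ᵐ ω ∂P, ContinuousOn (fun t => Y t ω) (Set.Iic T)) →
      P {ω | ∃ t ≤ T, R < ‖X t ω‖} ≤ ENNReal.ofReal ε →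
      P {ω | ∃ t ≤ T, R < ‖Y t ω‖} ≤ ENNReal.ofReal ε → ∀ M₀ : ℕ,
      (∀ M ≥ M₀, P {ω | ∃ j ≤ 2 ^ M, η ≤ ‖eulerDefect β A B W Z x₀ (dyadic T M) X j ω‖} ≤
        ENNReal.ofReal ε) →
      (∀ M ≥ M₀, P {ω | ∃ j ≤ 2 ^ M, η ≤ ‖eulerDefect β A B W Z x₀ (dyadic T M) Y j ω‖} ≤
        ENNReal.ofReal ε) →
      P {ω | ∃ t ≤ T, δ < ‖X t ω - Y t ω‖} ≤ 5 * ENNReal.ofReal ε := by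
  obtain ⟨K, hK, hst⟩ := exists_measure_le_of_residual_le hW hQ hq hq_sum B T hL R
  obtain ⟨η, hη, hη1, hη2⟩ : ∃ η : ℝ, 0 < η ∧ 3 * (2 * η) < δ ∧ K * (2 * η) ^ 2 / δ ^ 2 < ε := by
    have h1 : ∀ᶠ η in 𝓝[>] (0 : ℝ), 3 * (2 * η) < δ :=
      ((show Continuous fun η : ℝ => 3 * (2 * η) by fun_prop).tendsto 0 |>.mono_left
        nhdsWithin_le_nhds).eventually_lt_const (by simpa using hδ)
    have h2 : ∀ᶠ η in 𝓝[>] (0 : ℝ), K * (2 * η) ^ 2 / δ ^ 2 < ε :=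
      ((show Continuous fun η : ℝ => K * (2 * η) ^ 2 / δ ^ 2 by fun_prop).tendsto 0 |>.mono_left
        nhdsWithin_le_nhds).eventually_lt_const (by simpa using hε)
    obtain ⟨η, ⟨h3, h4⟩, h5⟩ := ((h1.and h2).and self_mem_nhdsWithin).exists
    exact ⟨η, h5, h3, h4⟩
  refine ⟨η, hη, fun X Y hX hY hXc hYc hXR hYR M₀ hXd hYd => ?_⟩
  refine measure_exists_lt_le_of_dyadic T (Y := fun t ω => X t ω - Y t ω) (a₀ := M₀) ?_
    fun M hM => ?_
  · filter_upwards [hXc, hYc] with ω h1 h2 using h1.sub h2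
  have hmem : ∀ i, ((dyadic T M i : ℝ≥0) : ℝ) ∈ Set.Icc 0 (T : ℝ) := fun i =>
    ⟨NNReal.coe_nonneg _, by exact_mod_cast dyadic_le T M i⟩
  have h5 := hst (dyadic T M) (dyadic_mono T M) (dyadic_le T M) (fun i => β (dyadic T M i))
    (fun i => continuous_of_uncurry_continuousOn hβ (dyadic_le T M i))
    (fun i x y hx hy => hLip _ (hmem i) x y hx hy)
    (fun i => X (dyadic T M i)) (fun i => Y (dyadic T M i)) (fun i => hX _ (dyadic_le T M i))
    (fun i => hY _ (dyadic_le T M i)) (2 ^ M) (2 * η) δ (by positivity) hη1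
  have h5' := h5.trans (ENNReal.ofReal_le_ofReal hη2.le)
  have hsub : {ω | ∃ j ≤ 2 ^ M, δ ≤ ‖X (dyadic T M j) ω - Y (dyadic T M j) ω‖} ⊆
      ({ω | ∃ t ≤ T, R < ‖X t ω‖} ∪ {ω | ∃ t ≤ T, R < ‖Y t ω‖}) ∪
      ({ω | ∃ j ≤ 2 ^ M, η ≤ ‖eulerDefect β A B W Z x₀ (dyadic T M) X j ω‖} ∪
      {ω | ∃ j ≤ 2 ^ M, η ≤ ‖eulerDefect β A B W Z x₀ (dyadic T M) Y j ω‖}) ∪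
      {ω | (∀ j ≤ 2 ^ M, ‖X (dyadic T M j) ω‖ ≤ R ∧ ‖Y (dyadic T M j) ω‖ ≤ R ∧
        ‖residual B W (dyadic T M) (fun i => β (dyadic T M i)) (fun i => X (dyadic T M i))
          (fun i => Y (dyadic T M i)) j ω‖ ≤ 2 * η) ∧
        ∃ j ≤ 2 ^ M, δ ≤ ‖X (dyadic T M j) ω - Y (dyadic T M j) ω‖} := by
    intro ω hω
    by_contra hcon
    simp only [Set.mem_union, not_or, Set.mem_ofPred_eq, not_exists, not_and, not_lt,
      not_le] at hcon
    obtain ⟨⟨⟨h1, h2⟩, h3, h4⟩, h6⟩ := hcon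
    obtain ⟨j, hj, hj'⟩ := hω
    refine absurd hj' (not_le.2 (h6 (fun i hi => ⟨h1 _ (dyadic_le T M i), h2 _ (dyadic_le T M i),
      ?_⟩) j hj))
    rw [residual_eq_eulerDefect_sub (A := A) (Z := Z) (x₀ := x₀)]
    refine (norm_sub_le _ _).trans ?_
    linarith [h3 i hi, h4 i hi]
  refine (measure_mono hsub).trans ?_
  calc _ ≤ _ := (measure_union_le _ _).trans (add_le_add ((measure_union_le _ _).trans
        (add_le_add (measure_union_le _ _) (measure_union_le _ _))) le_rfl)
    _ ≤ ((ENNReal.ofReal ε + ENNReal.ofReal ε) + (ENNReal.ofReal ε + ENNReal.ofReal ε)) +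
        ENNReal.ofReal ε := by
        gcongr
        · exact hXd M hM
        · exact hYd M hM
    _ = 5 * ENNReal.ofReal ε := by ring

lemma continuousOn_comp_path (hβ : ContinuousOn (Function.uncurry β)
    (Set.Icc 0 (T : ℝ) ×ˢ Set.univ)) {x : ℝ≥0 → Hd} (hx : ContinuousOn x (Set.Iic T)) :
    ContinuousOn (fun t : ℝ≥0 => β t (x t)) (Set.Iic T) := by
  refine hβ.comp (f := fun t : ℝ≥0 => ((t : ℝ), x t)) (by fun_prop) fun t ht => ?_
  exact ⟨⟨t.2, by exact_mod_cast (show t ≤ T from ht)⟩, trivial⟩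

lemma toNNReal_mem_Iic {s : ℝ} (hs : s ∈ Set.Icc 0 (T : ℝ)) : s.toNNReal ∈ Set.Iic T :=
  Real.toNNReal_le_iff_le_coe.2 hs.2

lemma continuousOn_comp_toNNReal (hβ : ContinuousOn (Function.uncurry β)
    (Set.Icc 0 (T : ℝ) ×ˢ Set.univ)) {x : ℝ≥0 → Hd} (hx : ContinuousOn x (Set.Iic T)) :
    ContinuousOn (fun s : ℝ => β s (x s.toNNReal)) (Set.Icc 0 (T : ℝ)) := by
  refine hβ.comp (f := fun s : ℝ => (s, x s.toNNReal)) ?_ fun s hs => ⟨hs, trivial⟩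
  exact continuousOn_id.prodMk (hx.comp continuous_real_toNNReal.continuousOn
    fun s hs => toNNReal_mem_Iic hs)

/-- A solution of the equation has small Euler defect on the fine grids. -/
lemma exists_measure_eulerDefect_le (hW : IsQWiener F P Q W) (hQ : ∀ m, Q (f m) = q m • f m)
    (hq : ∀ m, 0 ≤ q m) (hq_sum : Summable q)
    (hβ : ContinuousOn (Function.uncurry β) (Set.Icc 0 (T : ℝ) ×ˢ Set.univ))
    {X I Z' : ℝ≥0 → Ω → Hd} (hX : ∀ t ≤ T, StronglyMeasurable[F t] (X t))
    (hXc : ∀ᵐ ω ∂P, ContinuousOn (fun t => X t ω) (Set.Iic T))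
    (hI : IsItoIntegral F P f q W T (fun s ω => B (X s ω)) I)
    (hZ : ∀ t ≤ T, Z t =ᵐ[P] Z' t)
    (hXeq : ∀ᵐ ω ∂P, ∀ t ≤ T, X t ω = x₀ + (∫ s in (0 : ℝ)..t, β s (X s.toNNReal ω))
        + A (W t ω) + I t ω + Z' t ω) {δ ε : ℝ} (hδ : 0 < δ) (hε : 0 < ε) :
    ∃ M₀ : ℕ, ∀ M ≥ M₀, P {ω | ∃ j ≤ 2 ^ M,
      δ ≤ ‖eulerDefect β A B W Z x₀ (dyadic T M) X j ω‖} ≤ ENNReal.ofReal ε := by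
  have hε2 : 0 < ENNReal.ofReal (ε / 2) := ENNReal.ofReal_pos.2 (half_pos hε)
  obtain ⟨a₁, ha₁⟩ := exists_measure_riemannSum_sub_le hW hQ hq hq_sum hX hXc hI (half_pos hδ)
    (half_pos hε)
  set θ : ℝ := δ / (4 * (T + 1)) with hθ
  have hT1 : (0 : ℝ) < T + 1 := by positivity
  have hθ0 : 0 < θ := by positivity
  have hTθ : T * θ < δ / 2 := by
    have : (T + 1) * θ = δ / 4 := by rw [hθ]; field_simp
    nlinarith
  obtain ⟨a₂, ha₂⟩ := exists_modulus (P := P) T (Y := fun t ω => β t (X t ω)) (fun t ht =>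
    (continuous_of_uncurry_continuousOn hβ ht).comp_aestronglyMeasurable
      ((hX t ht).mono (F.le t)).aestronglyMeasurable)
    (by filter_upwards [hXc] with ω hω using continuousOn_comp_path hβ hω) hθ0 hε2
  refine ⟨max a₁ a₂, fun M hM => ?_⟩
  have hZg : ∀ᵐ ω ∂P, ∀ j, Z (dyadic T M j) ω = Z' (dyadic T M j) ω :=
    ae_all_iff.2 fun j => hZ _ (dyadic_le T M j)
  refine (measure_le_of_ae_imp (B := {ω | ∃ j ≤ 2 ^ M, δ / 2 ≤ ‖(∑ i ∈ Finset.range j,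
      B (X (dyadic T M i) ω) (W (dyadic T M (i + 1)) ω - W (dyadic T M i) ω)) -
        I (dyadic T M j) ω‖} ∪
      {ω | ∃ s ≤ T, ∃ t ≤ T, dist s t ≤ T / 2 ^ M ∧ θ ≤ ‖β s (X s ω) - β t (X t ω)‖})
      ?_).trans ((measure_union_le _ _).trans ((add_le_add
        (ha₁ M ((le_max_left _ _).trans hM)) (ha₂ M ((le_max_right _ _).trans hM))).trans
        (le_of_eq ?_)))
  · filter_upwards [hXc, hXeq, hZg, hW.zero] with ω h1 h2 h3 h4 ⟨j, hj, hle⟩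
    by_contra hcon
    simp only [Set.mem_union, not_or, Set.mem_ofPred_eq, not_exists, not_and, not_le] at hcon
    obtain ⟨h5, h6⟩ := hcon
    have hint := norm_integral_sub_sum_le T (a := M) (continuousOn_comp_toNNReal hβ h1)
      (v := fun l => β (dyadic T M l) (X (dyadic T M l) ω)) hθ0.le (fun l _ s hs hs' => by
        have hs0 : 0 ≤ s := (NNReal.coe_nonneg _).trans hs
        lift s to ℝ≥0 using hs0
        simp only [Real.toNNReal_coe]
        have hs1 : dyadic T M l ≤ s := by exact_mod_cast hs
        have hs2 : s ≤ dyadic T M (l + 1) := by exact_mod_cast hs'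
        exact (h6 s (hs2.trans (dyadic_le T M _)) _ (dyadic_le T M l) (dist_le_of_mem_cell T hs1 hs2
          le_rfl (dyadic_mono T M (Nat.le_succ l)))).le) (dyadic_le T M j)
    have hsum := sum_range_min_eq (dyadic_mono T M) (fun l s t : _ => ((t : ℝ) - (s : ℝ≥0)) •
      β (dyadic T M l) (X (dyadic T M l) ω)) (fun i t => by simp) hj
    beta_reduce at hsum
    rw [hsum] at hint
    have h7 := h5 j hj
    have hAW : ∑ i ∈ Finset.range j, A (W (dyadic T M (i + 1)) ω - W (dyadic T M i) ω) =
        A (W (dyadic T M j) ω) := by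
      rw [← map_sum, Finset.sum_range_sub (fun i => W (dyadic T M i) ω), dyadic_zero, h4, sub_zero]
    refine absurd hle (not_le.2 ?_)
    have hdef : eulerDefect β A B W Z x₀ (dyadic T M) X j ω =
        ((∫ s in (0 : ℝ)..(dyadic T M j), β s (X s.toNNReal ω)) -
          ∑ i ∈ Finset.range j, ((dyadic T M (i + 1) : ℝ) - dyadic T M i) •
            β (dyadic T M i) (X (dyadic T M i) ω)) -
        ((∑ i ∈ Finset.range j,
          B (X (dyadic T M i) ω) (W (dyadic T M (i + 1)) ω - W (dyadic T M i) ω)) -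
          I (dyadic T M j) ω) := by
      simp only [eulerDefect, add_apply, Finset.sum_add_distrib]
      rw [hAW, h2 _ (dyadic_le T M j), h3]
      abel
    rw [hdef]
    exact (norm_sub_le _ _).trans_lt (by linarith)
  · rw [← ENNReal.ofReal_add (half_pos hε).le (half_pos hε).le, add_halves]

/-- Pathwise uniqueness. -/
lemma ae_forall_eq_of_equation (hW : IsQWiener F P Q W) (hQ : ∀ m, Q (f m) = q m • f m)
    (hq : ∀ m, 0 ≤ q m) (hq_sum : Summable q)
    (hβ : ContinuousOn (Function.uncurry β) (Set.Icc 0 (T : ℝ) ×ˢ Set.univ))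
    (hLip : ∀ R : ℝ, ∃ L, 0 ≤ L ∧ ∀ s ∈ Set.Icc 0 (T : ℝ), ∀ x y, ‖x‖ ≤ R → ‖y‖ ≤ R →
      ‖β s x - β s y‖ ≤ L * ‖x - y‖)
    {X I Y J Z' : ℝ≥0 → Ω → Hd} (hX : ∀ t ≤ T, StronglyMeasurable[F t] (X t))
    (hXc : ∀ᵐ ω ∂P, ContinuousOn (fun t => X t ω) (Set.Iic T))
    (hI : IsItoIntegral F P f q W T (fun s ω => B (X s ω)) I)
    (hXeq : ∀ᵐ ω ∂P, ∀ t ≤ T, X t ω = x₀ + (∫ s in (0 : ℝ)..t, β s (X s.toNNReal ω))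
        + A (W t ω) + I t ω + Z t ω)
    (hY : ∀ t ≤ T, StronglyMeasurable[F t] (Y t))
    (hYc : ∀ᵐ ω ∂P, ContinuousOn (fun t => Y t ω) (Set.Iic T))
    (hJ : IsItoIntegral F P f q W T (fun s ω => B (Y s ω)) J)
    (hYeq : ∀ᵐ ω ∂P, ∀ t ≤ T, Y t ω = x₀ + (∫ s in (0 : ℝ)..t, β s (Y s.toNNReal ω))
        + A (W t ω) + J t ω + Z' t ω)
    (hZ : ∀ t ≤ T, Z t =ᵐ[P] Z' t) :
    ∀ᵐ ω ∂P, ∀ t ≤ T, X t ω = Y t ω := by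
  have key : ∀ δ : ℝ, 0 < δ → P {ω | ∃ t ≤ T, δ < ‖X t ω - Y t ω‖} = 0 := by
    intro δ hδ
    refine le_antisymm (ENNReal.le_of_forall_pos_le_add fun ε' hε' _ => ?_) zero_le
    rw [zero_add]
    set ε : ℝ := ε' / 5 with hε
    have hε0 : 0 < ε := by positivity
    have hεe : 0 < ENNReal.ofReal ε := ENNReal.ofReal_pos.2 hε0
    obtain ⟨R₁, -, hR₁⟩ := exists_bound (P := P) T
      (fun t ht => ((hX t ht).mono (F.le t)).aestronglyMeasurable) hXc hεe
    obtain ⟨R₂, -, hR₂⟩ := exists_bound (P := P) T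
      (fun t ht => ((hY t ht).mono (F.le t)).aestronglyMeasurable) hYc hεe
    obtain ⟨L, hL, hLip'⟩ := hLip (max R₁ R₂)
    obtain ⟨η, hη, h⟩ := exists_eulerDefect_bound (A := A) (B := B) (Z := Z) (x₀ := x₀) hW hQ hq
      hq_sum hβ hL hLip' hδ hε0
    obtain ⟨M₁, hM₁⟩ := exists_measure_eulerDefect_le (Z := Z) hW hQ hq hq_sum hβ hX hXc hI
      (fun _ _ => .rfl) hXeq hη hε0
    obtain ⟨M₂, hM₂⟩ := exists_measure_eulerDefect_le hW hQ hq hq_sum hβ hY hYc hJ hZ hYeq hη hε0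
    refine (h X Y hX hY hXc hYc ((measure_mono ?_).trans hR₁) ((measure_mono ?_).trans hR₂)
      (max M₁ M₂) (fun M hM => hM₁ M ((le_max_left _ _).trans hM))
      (fun M hM => hM₂ M ((le_max_right _ _).trans hM))).trans (le_of_eq ?_)
    · exact fun ω ⟨t, ht, hlt⟩ => ⟨t, ht, (le_max_left _ _).trans_lt hlt⟩
    · exact fun ω ⟨t, ht, hlt⟩ => ⟨t, ht, (le_max_right _ _).trans_lt hlt⟩
    · rw [hε, ofNat_mul_ofReal_div, ENNReal.ofReal_coe_nnreal]
  have hall : ∀ᵐ ω ∂P, ∀ n : ℕ, ¬ ∃ t ≤ T, (1 : ℝ) / (n + 1) < ‖X t ω - Y t ω‖ :=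
    ae_all_iff.2 fun n => measure_eq_zero_iff_ae_notMem.1 (key _ (by positivity))
  filter_upwards [hall] with ω hω t ht
  by_contra hne
  obtain ⟨n, hn⟩ := exists_nat_one_div_lt (norm_pos_iff.2 (sub_ne_zero.2 hne))
  exact hω n ⟨t, ht, hn⟩

end Defect

/-! ### The Euler scheme -/

lemma dyadic_mem_Icc (T : ℝ≥0) (a i : ℕ) : ((dyadic T a i : ℝ≥0) : ℝ) ∈ Set.Icc 0 (T : ℝ) :=
  ⟨NNReal.coe_nonneg _, by exact_mod_cast dyadic_le T a i⟩

lemma dyadic_div_le (T : ℝ≥0) (a b i : ℕ) : dyadic T a (i / 2 ^ b) ≤ dyadic T (a + b) i := by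
  rw [← dyadic_mul_two_pow T a b]
  exact dyadic_mono T _ (Nat.div_mul_le_self i _)

lemma dyadic_succ_le_div_succ (T : ℝ≥0) (a b i : ℕ) :
    dyadic T (a + b) (i + 1) ≤ dyadic T a (i / 2 ^ b + 1) := by
  rw [← dyadic_mul_two_pow T a b]
  refine dyadic_mono T _ ?_
  have := Nat.lt_mul_div_succ i (show 0 < 2 ^ b by positivity)
  rw [mul_comm]
  exact this

lemma dyadic_le_div_succ (T : ℝ≥0) (a b i : ℕ) :
    dyadic T (a + b) i ≤ dyadic T a (i / 2 ^ b + 1) :=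
  (dyadic_mono T _ (Nat.le_succ i)).trans (dyadic_succ_le_div_succ T a b i)

lemma exists_forall_div_two_pow_mul_le (T : ℝ≥0) (C : ℝ) {θ : ℝ} (hθ : 0 < θ) :
    ∃ a₀ : ℕ, ∀ a ≥ a₀, (T : ℝ) / 2 ^ a * C ≤ θ := by
  have := ((tendsto_div_two_pow T).mul_const C).eventually_le_const (u := θ) (by simpa using hθ)
  exact eventually_atTop.1 this

section Euler

variable {Hd Hi Ω : Type*} [NormedAddCommGroup Hd] [InnerProductSpace ℝ Hd]
  [NormedAddCommGroup Hi] [InnerProductSpace ℝ Hi]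

/-- The values at the grid points `g j` of the Euler scheme for
`dX = β(t, X) dt + (A + B(X)) dW + dZ`, `X 0 = x₀ + Z 0`. -/
noncomputable def eulerNode (β : ℝ → Hd → Hd) (A : Hi →L[ℝ] Hd) (B : Hd →L[ℝ] Hi →L[ℝ] Hd)
    (W : ℝ≥0 → Ω → Hi) (Z : ℝ≥0 → Ω → Hd) (x₀ : Hd) (g : ℕ → ℝ≥0) : ℕ → Ω → Hd
  | 0, ω => x₀ + Z (g 0) ω
  | j + 1, ω => eulerNode β A B W Z x₀ g j ω +
      ((g (j + 1) : ℝ) - g j) • β (g j) (eulerNode β A B W Z x₀ g j ω) +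
      ((A + B (eulerNode β A B W Z x₀ g j ω)) (W (g (j + 1)) ω - W (g j) ω) +
        (Z (g (j + 1)) ω - Z (g j) ω))

/-- The increment over `[s, t]`, except for that of `Z`, of a process whose coefficients are frozen
at the value of the Euler scheme at `g l`. -/
noncomputable def eulerCell (β : ℝ → Hd → Hd) (A : Hi →L[ℝ] Hd) (B : Hd →L[ℝ] Hi →L[ℝ] Hd)
    (W : ℝ≥0 → Ω → Hi) (Z : ℝ≥0 → Ω → Hd) (x₀ : Hd) (g : ℕ → ℝ≥0) (ω : Ω) (l : ℕ) (s t : ℝ≥0) :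
    Hd :=
  ((t : ℝ) - s) • β (g l) (eulerNode β A B W Z x₀ g l ω) +
    (A + B (eulerNode β A B W Z x₀ g l ω)) (W t ω - W s ω)

/-- The Euler scheme in continuous time, along a grid with `n` cells. -/
noncomputable def eulerScheme (β : ℝ → Hd → Hd) (A : Hi →L[ℝ] Hd) (B : Hd →L[ℝ] Hi →L[ℝ] Hd)
    (W : ℝ≥0 → Ω → Hi) (Z : ℝ≥0 → Ω → Hd) (x₀ : Hd) (g : ℕ → ℝ≥0) (n : ℕ) (t : ℝ≥0) (ω : Ω) :
    Hd :=
  x₀ + Z t ω + ∑ l ∈ Finset.range n,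
    eulerCell β A B W Z x₀ g ω l (min (g l) t) (min (g (l + 1)) t)

variable {β : ℝ → Hd → Hd} {A : Hi →L[ℝ] Hd} {B : Hd →L[ℝ] Hi →L[ℝ] Hd}
  {W : ℝ≥0 → Ω → Hi} {x₀ : Hd} {Z : ℝ≥0 → Ω → Hd} {g : ℕ → ℝ≥0}

lemma eulerCell_self (ω : Ω) (l : ℕ) (t : ℝ≥0) : eulerCell β A B W Z x₀ g ω l t t = 0 := by
  simp [eulerCell]

lemma eulerCell_sub (ω : Ω) (l : ℕ) (r s t : ℝ≥0) :
    eulerCell β A B W Z x₀ g ω l r t - eulerCell β A B W Z x₀ g ω l r s =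
      eulerCell β A B W Z x₀ g ω l s t := by
  simp only [eulerCell]
  rw [add_sub_add_comm, ← sub_smul, ← map_sub]
  congr 2 <;> abel

lemma eulerScheme_sub (hg : Monotone g) {l n : ℕ} (hl : l < n) {s t : ℝ≥0} (hs : g l ≤ s)
    (hst : s ≤ t) (ht : t ≤ g (l + 1)) (ω : Ω) :
    eulerScheme β A B W Z x₀ g n t ω - eulerScheme β A B W Z x₀ g n s ω =
      (Z t ω - Z s ω) + eulerCell β A B W Z x₀ g ω l s t := by
  rw [eulerScheme, eulerScheme, add_sub_add_comm, add_sub_add_left_eq_sub,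
    ← Finset.sum_sub_distrib, Finset.sum_eq_single l]
  · rw [min_eq_left hs, min_eq_left (hs.trans hst), min_eq_right ht, min_eq_right (hst.trans ht),
      eulerCell_sub]
  · intro i _ hil
    rcases Nat.lt_or_gt_of_ne hil with h | h
    · have h1 : g (i + 1) ≤ s := (hg h).trans hs
      have h2 : g i ≤ s := (hg (Nat.le_succ i)).trans h1
      rw [min_eq_left h1, min_eq_left h2, min_eq_left (h1.trans hst), min_eq_left (h2.trans hst),
        sub_self]
    · have h1 : t ≤ g i := ht.trans (hg h)
      have h2 : t ≤ g (i + 1) := h1.trans (hg (Nat.le_succ i))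
      rw [min_eq_right h1, min_eq_right h2, min_eq_right (hst.trans h1),
        min_eq_right (hst.trans h2), eulerCell_self, eulerCell_self, sub_self]
  · intro h
    exact absurd (Finset.mem_range.2 hl) h

lemma eulerScheme_node (hg : Monotone g) {n : ℕ} (ω : Ω) {l : ℕ} (hl : l ≤ n) :
    eulerScheme β A B W Z x₀ g n (g l) ω = eulerNode β A B W Z x₀ g l ω := by
  induction l with
  | zero =>
    rw [eulerScheme, eulerNode, Finset.sum_eq_zero, add_zero]
    intro i _
    rw [min_eq_right (hg (Nat.zero_le _)), min_eq_right (hg (Nat.zero_le _)), eulerCell_self]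
  | succ l ih =>
    have h := eulerScheme_sub (β := β) (A := A) (B := B) (W := W) (x₀ := x₀) (Z := Z) hg
      (show l < n by omega) le_rfl (hg (Nat.le_succ l)) le_rfl ω
    rw [ih (by omega), sub_eq_iff_eq_add] at h
    rw [h, eulerNode, eulerCell]
    abel

/-- The Euler scheme as a Riemann sum for the integral equation. -/
lemma eulerScheme_eq (ω : Ω) (n : ℕ) (t : ℝ≥0) :
    eulerScheme β A B W Z x₀ g n t ω = x₀ + Z t ω +
      ∑ l ∈ Finset.range n, (((min (g (l + 1)) t : ℝ≥0) : ℝ) - (min (g l) t : ℝ≥0)) •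
        β (g l) (eulerNode β A B W Z x₀ g l ω) +
      A (W (min (g n) t) ω - W (min (g 0) t) ω) +
      ∑ l ∈ Finset.range n, B (eulerNode β A B W Z x₀ g l ω)
        (W (min (g (l + 1)) t) ω - W (min (g l) t) ω) := by
  simp only [eulerScheme, eulerCell, add_apply, Finset.sum_add_distrib]
  rw [← map_sum, Finset.sum_range_sub (fun l => W (min (g l) t) ω)]
  abel

lemma continuousOn_eulerScheme {T : ℝ≥0} {n : ℕ} {ω : Ω} (hWc : Continuous fun t => W t ω)
    (hZc : ContinuousOn (fun t => Z t ω) (Set.Iic T)) :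
    ContinuousOn (fun t => eulerScheme β A B W Z x₀ g n t ω) (Set.Iic T) := by
  refine ContinuousOn.add (continuousOn_const.add hZc) (Continuous.continuousOn ?_)
  refine continuous_finsetSum _ fun l _ => ?_
  simp only [eulerCell]
  have h1 : Continuous fun t : ℝ≥0 => W (min (g (l + 1)) t) ω := hWc.comp (by fun_prop)
  have h2 : Continuous fun t : ℝ≥0 => W (min (g l) t) ω := hWc.comp (by fun_prop)
  fun_prop

/-- The Euler scheme is known from the past of `W` and `Z`. -/
lemma aestronglyMeasurable_eulerNode {mΩ : MeasurableSpace Ω} {P : Measure Ω}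
    {m : ℝ≥0 → MeasurableSpace Ω} (hm : Monotone m) {T : ℝ≥0} (hg : Monotone g)
    (hgT : ∀ j, g j ≤ T) (hβ : ∀ t ≤ T, Continuous (β t))
    (hW : ∀ t ≤ T, AEStronglyMeasurable[m t] (W t) P)
    (hZ : ∀ t ≤ T, AEStronglyMeasurable[m t] (Z t) P) (j : ℕ) :
    AEStronglyMeasurable[m (g j)] (eulerNode β A B W Z x₀ g j) P := by
  induction j with
  | zero => exact aestronglyMeasurable_const.add (hZ _ (hgT 0))
  | succ j ih =>
    have hle := hm (hg (Nat.le_succ j))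
    have ih' := ih.mono hle
    refine (ih'.add (((hβ _ (hgT j)).comp_aestronglyMeasurable ih').const_smul _)).add ?_
    refine AEStronglyMeasurable.add ?_ ((hZ _ (hgT _)).sub ((hZ _ (hgT j)).mono hle))
    refine isBoundedBilinearMap_apply.continuous.comp_aestronglyMeasurable (AEStronglyMeasurable.prodMk
      (f := fun ω => A + B (eulerNode β A B W Z x₀ g j ω)) ?_
      ((hW _ (hgT _)).sub ((hW _ (hgT j)).mono hle)))
    exact aestronglyMeasurable_const.add (B.continuous.comp_aestronglyMeasurable ih')

lemma aestronglyMeasurable_eulerScheme {mΩ : MeasurableSpace Ω} {P : Measure Ω}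
    {m : ℝ≥0 → MeasurableSpace Ω} (hm : Monotone m) {T : ℝ≥0} (hg : Monotone g)
    (hgT : ∀ j, g j ≤ T) (hβ : ∀ t ≤ T, Continuous (β t))
    (hW : ∀ t ≤ T, AEStronglyMeasurable[m t] (W t) P)
    (hZ : ∀ t ≤ T, AEStronglyMeasurable[m t] (Z t) P) (n : ℕ) {t : ℝ≥0} (ht : t ≤ T) :
    AEStronglyMeasurable[m t] (eulerScheme β A B W Z x₀ g n t) P := by
  suffices h : ∀ l, AEStronglyMeasurable[m t]
      (fun ω => eulerCell β A B W Z x₀ g ω l (min (g l) t) (min (g (l + 1)) t)) P by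
    refine (aestronglyMeasurable_const.add (hZ t ht)).add ?_
    induction n with
    | zero => exact aestronglyMeasurable_const
    | succ n ih =>
      simp only [Finset.sum_range_succ]
      exact ih.add (h n)
  intro l
  rcases le_total (g l) t with h | h
  · have hN := (aestronglyMeasurable_eulerNode (β := β) (A := A) (B := B) (x₀ := x₀) hm hg hgT hβ
      hW hZ l).mono (hm h)
    have hWt : ∀ s, AEStronglyMeasurable[m t] (W (min s t)) P := fun s =>
      (hW _ ((min_le_right s t).trans ht)).mono (hm (min_le_right s t))
    refine (((hβ _ (hgT l)).comp_aestronglyMeasurable hN).const_smul _).add ?_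
    refine isBoundedBilinearMap_apply.continuous.comp_aestronglyMeasurable (AEStronglyMeasurable.prodMk
      (f := fun ω => A + B (eulerNode β A B W Z x₀ g l ω)) ?_ ((hWt _).sub (hWt _)))
    exact aestronglyMeasurable_const.add (B.continuous.comp_aestronglyMeasurable hN)
  · rw [min_eq_right h, min_eq_right (h.trans (hg (Nat.le_succ l)))]
    simp only [eulerCell_self]
    exact aestronglyMeasurable_const

/-- If all null sets are measurable, measurability up to null sets is measurability. -/
lemma stronglyMeasurable_of_aestronglyMeasurable {E : Type*} [NormedAddCommGroup E]
    [SecondCountableTopology E] {m : MeasurableSpace Ω} {mΩ : MeasurableSpace Ω} {P : Measure Ω}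
    (hP : ∀ A : Set Ω, P A = 0 → MeasurableSet[m] A) {X : Ω → E}
    (hX : AEStronglyMeasurable[m] X P) : StronglyMeasurable[m] X := by
  borelize E
  obtain ⟨X', hX', hXX'⟩ := hX
  refine Measurable.stronglyMeasurable fun s hs => ?_
  have hN : P {ω | ¬ X ω = X' ω} = 0 := hXX'
  have : X ⁻¹' s = (X' ⁻¹' s \ {ω | ¬ X ω = X' ω}) ∪ (X ⁻¹' s ∩ {ω | ¬ X ω = X' ω}) := by
    ext ω
    by_cases h : X ω = X' ω <;> simp [h]
  rw [this]
  exact ((hX'.measurable hs).diff (hP _ hN)).union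
    (hP _ (measure_mono_null Set.inter_subset_right hN))

/-- On a refinement of the grid of the Euler scheme, its defect stems from the coefficients only. -/
lemma eulerDefect_eulerScheme (T : ℝ≥0) (a b : ℕ) (ω : Ω) {j : ℕ} (hj : j ≤ 2 ^ (a + b)) :
    eulerDefect β A B W Z x₀ (dyadic T (a + b))
        (eulerScheme β A B W Z x₀ (dyadic T a) (2 ^ a)) j ω =
      ∑ i ∈ Finset.range j,
        ((dyadic T (a + b) (i + 1) : ℝ) - dyadic T (a + b) i) •
          (β (dyadic T a (i / 2 ^ b)) (eulerScheme β A B W Z x₀ (dyadic T a) (2 ^ a)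
            (dyadic T a (i / 2 ^ b)) ω) -
          β (dyadic T (a + b) i) (eulerScheme β A B W Z x₀ (dyadic T a) (2 ^ a)
            (dyadic T (a + b) i) ω)) +
      ∑ i ∈ Finset.range j, B (eulerScheme β A B W Z x₀ (dyadic T a) (2 ^ a)
            (dyadic T a (i / 2 ^ b)) ω - eulerScheme β A B W Z x₀ (dyadic T a) (2 ^ a)
            (dyadic T (a + b) i) ω) (W (dyadic T (a + b) (i + 1)) ω - W (dyadic T (a + b) i) ω) := by
  rw [← Finset.sum_add_distrib, eulerDefect, sub_eq_iff_eq_add]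
  induction j with
  | zero =>
    simp only [Finset.range_zero, Finset.sum_empty, add_zero, zero_add, dyadic_zero]
    have := eulerScheme_node (β := β) (A := A) (B := B) (W := W) (x₀ := x₀) (Z := Z)
      (dyadic_mono T a) ω (Nat.zero_le (2 ^ a))
    rw [dyadic_zero] at this
    rw [this, eulerNode, dyadic_zero]
  | succ j ih =>
    have hl : j / 2 ^ b < 2 ^ a := by
      rw [Nat.div_lt_iff_lt_mul (by positivity), ← pow_add]; omega
    have h := eulerScheme_sub (β := β) (A := A) (B := B) (W := W) (x₀ := x₀) (Z := Z)
      (dyadic_mono T a) hl (dyadic_div_le T a b j) (dyadic_mono T (a + b) (Nat.le_succ j))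
      (dyadic_succ_le_div_succ T a b j) ω
    rw [sub_eq_iff_eq_add, ih (by omega)] at h
    rw [h, Finset.sum_range_succ, Finset.sum_range_succ, eulerCell,
      eulerScheme_node (dyadic_mono T a) ω hl.le]
    simp only [map_sub, smul_sub, add_apply, sub_apply]
    abel

end Euler

/-! ### Tightness and consistency of the Euler scheme -/

section Tightness

variable {Hd Hi Ω : Type*} [NormedAddCommGroup Hd] [InnerProductSpace ℝ Hd]
  [NormedAddCommGroup Hi] [InnerProductSpace ℝ Hi] {mΩ : MeasurableSpace Ω}

/-- Drifts on `[0, T]` which are locally Lipschitz and satisfy the one-sided growth condition that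
prevents explosion. -/
structure IsCoerciveDrift (T : ℝ≥0) (β : ℝ → Hd → Hd) : Prop where
  continuousOn : ContinuousOn (Function.uncurry β) (Set.Icc 0 (T : ℝ) ×ˢ Set.univ)
  lipschitz : ∀ R : ℝ, ∃ L, 0 ≤ L ∧ ∀ s ∈ Set.Icc 0 (T : ℝ), ∀ x y, ‖x‖ ≤ R → ‖y‖ ≤ R →
    ‖β s x - β s y‖ ≤ L * ‖x - y‖
  coercive : ∃ κ : ℝ, 0 ≤ κ ∧ ∀ s ∈ Set.Icc 0 (T : ℝ), ∀ x, ⟪x, β s x⟫ ≤ κ * (1 + ‖x‖ ^ 2)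

/-- Continuous square integrable processes on `[0, T]` with martingale increments, the variance of
which over `[s, t]` is at most `cZ * (t - s)`. -/
structure IsAdditiveNoise (F : Filtration ℝ≥0 mΩ) (P : Measure Ω) (T : ℝ≥0) (cZ : ℝ)
    (Z : ℝ≥0 → Ω → Hd) : Prop where
  adapted : ∀ t ≤ T, StronglyMeasurable[F t] (Z t)
  cont : ∀ᵐ ω ∂P, ContinuousOn (fun t => Z t ω) (Set.Iic T)
  memLp_zero : MemLp (Z 0) 2 P
  increment : ∀ s t, s ≤ t → t ≤ T → MemLp (fun ω => Z t ω - Z s ω) 2 P ∧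
    ∫ ω, ‖Z t ω - Z s ω‖ ^ 2 ∂P ≤ cZ * ((t : ℝ) - s) ∧
    ∀ η : Ω → Hd, StronglyMeasurable[F s] η → MemLp η 2 P → ∫ ω, ⟪η ω, Z t ω - Z s ω⟫ ∂P = 0

section Drift

variable {T : ℝ≥0} {β : ℝ → Hd → Hd} [FiniteDimensional ℝ Hd]

lemma IsCoerciveDrift.continuous (h : IsCoerciveDrift T β) {t : ℝ≥0} (ht : t ≤ T) :
    Continuous (β t) :=
  continuous_of_uncurry_continuousOn h.continuousOn ht

lemma isCompact_Icc_prod_closedBall (T : ℝ≥0) (R : ℝ) :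
    IsCompact (Set.Icc 0 (T : ℝ) ×ˢ Metric.closedBall (0 : Hd) R) := by
  have : ProperSpace Hd := FiniteDimensional.proper ℝ Hd
  exact isCompact_Icc.prod (isCompact_closedBall _ _)

lemma IsCoerciveDrift.exists_bound (h : IsCoerciveDrift T β) (R : ℝ) :
    ∃ C : ℝ, 0 ≤ C ∧ ∀ s ∈ Set.Icc 0 (T : ℝ), ∀ x, ‖x‖ ≤ R → ‖β s x‖ ≤ C := by
  obtain ⟨C, hC⟩ := (isCompact_Icc_prod_closedBall (Hd := Hd) T R).exists_bound_of_continuousOn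
    (h.continuousOn.mono (Set.prod_mono_right (Set.subset_univ _)))
  exact ⟨|C|, abs_nonneg _, fun s hs x hx =>
    (hC (s, x) ⟨hs, by simpa using hx⟩).trans (le_abs_self _)⟩

lemma IsCoerciveDrift.exists_modulus (h : IsCoerciveDrift T β) (R : ℝ) {θ : ℝ} (hθ : 0 < θ) :
    ∃ δ : ℝ, 0 < δ ∧ ∀ s ∈ Set.Icc 0 (T : ℝ), ∀ t ∈ Set.Icc 0 (T : ℝ), ∀ x y, ‖x‖ ≤ R → ‖y‖ ≤ R →
      dist s t ≤ δ → ‖x - y‖ ≤ δ → ‖β s x - β t y‖ ≤ θ := by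
  have hu := (isCompact_Icc_prod_closedBall (Hd := Hd) T R).uniformContinuousOn_of_continuous
    (h.continuousOn.mono (Set.prod_mono_right (Set.subset_univ _)))
  obtain ⟨δ, hδ, hδ'⟩ := Metric.uniformContinuousOn_iff.1 hu θ hθ
  refine ⟨δ / 2, half_pos hδ, fun s hs t ht x y hx hy hst hxy => ?_⟩
  have := hδ' (s, x) ⟨hs, by simpa using hx⟩ (t, y) ⟨ht, by simpa using hy⟩ (by
    rw [Prod.dist_eq]
    exact max_lt (by linarith) (by rw [dist_eq_norm]; linarith))
  rw [dist_eq_norm] at this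
  exact this.le

end Drift

variable {F : Filtration ℝ≥0 mΩ} {P : Measure Ω} [IsProbabilityMeasure P]
  {f : HilbertBasis ℕ ℝ Hi} {Q : Hi →L[ℝ] Hi} {q : ℕ → ℝ} {W : ℝ≥0 → Ω → Hi}
  [MeasurableSpace Hi] [BorelSpace Hi] [FiniteDimensional ℝ Hd] [CompleteSpace Hi]
  {T : ℝ≥0} {β : ℝ → Hd → Hd} {Z : ℝ≥0 → Ω → Hd} {cZ : ℝ}

lemma stronglyMeasurable_eulerScheme (hF : ∀ A : Set Ω, P A = 0 → MeasurableSet[F 0] A)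
    (hW : IsQWiener F P Q W) (hβ : IsCoerciveDrift T β)
    (hZ : IsAdditiveNoise F P T cZ Z) (A : Hi →L[ℝ] Hd) (B : Hd →L[ℝ] Hi →L[ℝ] Hd) (x₀ : Hd)
    (a : ℕ) {t : ℝ≥0} (ht : t ≤ T) :
    StronglyMeasurable[F t] (eulerScheme β A B W Z x₀ (dyadic T a) (2 ^ a) t) :=
  stronglyMeasurable_of_aestronglyMeasurable (P := P) (fun A hA => F.mono zero_le _ (hF A hA))
    (aestronglyMeasurable_eulerScheme (m := F) F.mono' (dyadic_mono T a) (dyadic_le T a)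
      (fun _ ht => hβ.continuous ht) (fun t _ => (hW.adapted t).aestronglyMeasurable)
      (fun t ht => (hZ.adapted t ht).aestronglyMeasurable) _ ht)

/-- The Euler scheme is bounded in probability at the grid points, uniformly for all fine grids. -/
lemma exists_measure_exists_lt_norm_eulerScheme_le
    (hF : ∀ A : Set Ω, P A = 0 → MeasurableSet[F 0] A) (hW : IsQWiener F P Q W)
    (hQ : ∀ m, Q (f m) = q m • f m) (hq : ∀ m, 0 ≤ q m) (hq_sum : Summable q)
    (hβ : IsCoerciveDrift T β) (hZ : IsAdditiveNoise F P T cZ Z) (hcZ : 0 ≤ cZ)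
    (A : Hi →L[ℝ] Hd) (B : Hd →L[ℝ] Hi →L[ℝ] Hd) (x₀ : Hd) {ε : ℝ} (hε : 0 < ε) :
    ∃ R : ℝ, 0 < R ∧ ∃ a₀ : ℕ, ∀ a ≥ a₀, P {ω | ∃ j ≤ 2 ^ a,
      R < ‖eulerScheme β A B W Z x₀ (dyadic T a) (2 ^ a) (dyadic T a j) ω‖} ≤
        ENNReal.ofReal ε := by
  obtain ⟨κ, hκ, hβκ⟩ := hβ.coercive
  obtain ⟨K, hK, htight⟩ := exists_measure_exists_lt_norm_le hW hQ hq hq_sum A B T hκ hcZ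
  set C₀ := K * (1 + ∫ ω, ‖x₀ + Z 0 ω‖ ^ 2 ∂P)
  obtain ⟨R, hR, hRε⟩ : ∃ R : ℝ, 0 < R ∧ C₀ / R ^ 2 ≤ ε := by
    have h1 : Tendsto (fun R : ℝ => C₀ / R ^ 2) atTop (𝓝 0) :=
      (tendsto_pow_atTop two_ne_zero).const_div_atTop C₀
    exact ((eventually_gt_atTop 0).and (h1.eventually_le_const hε)).exists
  obtain ⟨C, hC, hβC⟩ := hβ.exists_bound R
  -- the mesh is chosen after `R`, in terms of the size of the drift on the ball
  obtain ⟨a₀, ha₀⟩ := exists_forall_div_two_pow_mul_le T (C ^ 2) one_pos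
  refine ⟨R, hR, a₀, fun a ha => ?_⟩
  set N : ℕ → Ω → Hd := eulerNode β A B W Z x₀ (dyadic T a)
  have hN0 : N 0 = fun ω => x₀ + Z 0 ω := by
    funext ω
    simp only [N, eulerNode, dyadic_zero]
  have h := htight (dyadic T a) (dyadic_mono T a) (dyadic_le T a) (fun i => β (dyadic T a i))
    (fun i => hβ.continuous (dyadic_le T a i)) (fun i x => hβκ _ (dyadic_mem_Icc T a i) x) R hR
    (fun i x hx => ?_) (fun i ω => Z (dyadic T a (i + 1)) ω - Z (dyadic T a i) ω) ?_ (fun i => ?_)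
    N (fun j => ?_) ?_ (fun j ω => ?_) (2 ^ a)
  · rw [hN0] at h
    refine (measure_mono ?_).trans (h.trans (ENNReal.ofReal_le_ofReal hRε))
    rintro ω ⟨j, hj, hlt⟩
    rw [eulerScheme_node (dyadic_mono T a) ω hj] at hlt
    exact ⟨j, hj, hlt⟩
  · have h1 := hβC _ (dyadic_mem_Icc T a i) x hx
    have h2 := dyadic_sub_le T a i
    refine le_trans ?_ (ha₀ a ha)
    gcongr
  · have hinc := fun i => hZ.increment _ _ (dyadic_mono T a (Nat.le_succ i)) (dyadic_le T a (i + 1))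
    exact ⟨fun i => (hZ.adapted _ (dyadic_le T a _)).sub ((hZ.adapted _ (dyadic_le T a i)).mono
      (F.mono (dyadic_mono T a (Nat.le_succ i)))), fun i => (hinc i).1, fun i => (hinc i).2.2⟩
  · exact (hZ.increment _ _ (dyadic_mono T a (Nat.le_succ i)) (dyadic_le T a (i + 1))).2.1
  · exact stronglyMeasurable_of_aestronglyMeasurable (P := P)
      (fun A hA => F.mono zero_le _ (hF A hA))
      (aestronglyMeasurable_eulerNode (m := F) F.mono' (dyadic_mono T a) (dyadic_le T a)
        (fun _ ht => hβ.continuous ht) (fun t _ => (hW.adapted t).aestronglyMeasurable)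
        (fun t ht => (hZ.adapted t ht).aestronglyMeasurable) j)
  · rw [hN0]
    exact (memLp_const x₀).add hZ.memLp_zero
  · rfl

/-- With high probability, the Euler scheme is bounded at the grid points and oscillates little within
the cells of the grid, uniformly for all fine grids. -/
lemma exists_measure_eulerScheme_irregular_le
    (hF : ∀ A : Set Ω, P A = 0 → MeasurableSet[F 0] A) (hW : IsQWiener F P Q W)
    (hQ : ∀ m, Q (f m) = q m • f m) (hq : ∀ m, 0 ≤ q m) (hq_sum : Summable q)
    (hβ : IsCoerciveDrift T β) (hZ : IsAdditiveNoise F P T cZ Z) (hcZ : 0 ≤ cZ)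
    (A : Hi →L[ℝ] Hd) (B : Hd →L[ℝ] Hi →L[ℝ] Hd) (x₀ : Hd) {ε : ℝ} (hε : 0 < ε) :
    ∃ R : ℝ, 0 < R ∧ ∀ θ : ℝ, 0 < θ → ∃ a₀ : ℕ, ∀ a ≥ a₀,
      P {ω | ∃ l < 2 ^ a, ∃ s, dyadic T a l ≤ s ∧ s ≤ dyadic T a (l + 1) ∧
        (R < ‖eulerScheme β A B W Z x₀ (dyadic T a) (2 ^ a) (dyadic T a l) ω‖ ∨
        θ < ‖eulerScheme β A B W Z x₀ (dyadic T a) (2 ^ a) (dyadic T a l) ω -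
          eulerScheme β A B W Z x₀ (dyadic T a) (2 ^ a) s ω‖)} ≤ ENNReal.ofReal ε := by
  have hε3 : 0 < ε / 3 := by positivity
  have hεe : 0 < ENNReal.ofReal (ε / 3) := ENNReal.ofReal_pos.2 hε3
  obtain ⟨R, hR, a₁, ha₁⟩ := exists_measure_exists_lt_norm_eulerScheme_le hF hW hQ hq hq_sum hβ hZ
    hcZ A B x₀ hε3
  refine ⟨R, hR, fun θ hθ => ?_⟩
  obtain ⟨C, hC, hβC⟩ := hβ.exists_bound R
  set D := ‖A‖ + ‖B‖ * R with hD
  have hD0 : 0 ≤ D := by positivity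
  set θ₁ := θ / (2 * (1 + D)) with hθ₁
  have hθ₁0 : 0 < θ₁ := by positivity
  have hθ₁D : θ₁ + D * θ₁ = θ / 2 := by rw [hθ₁]; field_simp
  obtain ⟨a₂, ha₂⟩ := exists_modulus (P := P) T (Y := W)
    (fun t _ => ((hW.adapted t).mono (F.le t)).aestronglyMeasurable)
    (by filter_upwards [hW.cont] with ω hω using hω.continuousOn) hθ₁0 hεe
  obtain ⟨a₃, ha₃⟩ := exists_modulus (P := P) T (Y := Z)
    (fun t ht => ((hZ.adapted t ht).mono (F.le t)).aestronglyMeasurable) hZ.cont hθ₁0 hεe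
  obtain ⟨a₄, ha₄⟩ := exists_forall_div_two_pow_mul_le T C (half_pos hθ)
  refine ⟨max (max a₁ a₂) (max a₃ a₄), fun a ha => ?_⟩
  have hsub : {ω | ∃ l < 2 ^ a, ∃ s, dyadic T a l ≤ s ∧ s ≤ dyadic T a (l + 1) ∧
        (R < ‖eulerScheme β A B W Z x₀ (dyadic T a) (2 ^ a) (dyadic T a l) ω‖ ∨
        θ < ‖eulerScheme β A B W Z x₀ (dyadic T a) (2 ^ a) (dyadic T a l) ω -
          eulerScheme β A B W Z x₀ (dyadic T a) (2 ^ a) s ω‖)} ⊆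
      {ω | ∃ j ≤ 2 ^ a,
        R < ‖eulerScheme β A B W Z x₀ (dyadic T a) (2 ^ a) (dyadic T a j) ω‖} ∪
      ({ω | ∃ s ≤ T, ∃ t ≤ T, dist s t ≤ T / 2 ^ a ∧ θ₁ ≤ ‖W s ω - W t ω‖} ∪
      {ω | ∃ s ≤ T, ∃ t ≤ T, dist s t ≤ T / 2 ^ a ∧ θ₁ ≤ ‖Z s ω - Z t ω‖}) := by
    intro ω hω
    by_contra hcon
    simp only [Set.mem_union, not_or, Set.mem_ofPred_eq, not_exists, not_and, not_lt,
      not_le] at hcon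
    obtain ⟨h1, h2, h3⟩ := hcon
    obtain ⟨l, hl, s, hs, hs', hor⟩ := hω
    have hRl := h1 l hl.le
    rcases hor with h | h
    · exact absurd h (not_lt.2 hRl)
    have hd := dist_le_of_mem_cell T hs hs' le_rfl (dyadic_mono T a (Nat.le_succ l))
    have h4 := h2 s (hs'.trans (dyadic_le T a _)) _ (dyadic_le T a l) hd
    have h5 := h3 s (hs'.trans (dyadic_le T a _)) _ (dyadic_le T a l) hd
    refine absurd h (not_lt.2 ?_)
    rw [norm_sub_rev, eulerScheme_sub (dyadic_mono T a) hl le_rfl hs hs', eulerCell]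
    rw [eulerScheme_node (dyadic_mono T a) ω hl.le] at hRl
    set x := eulerNode β A B W Z x₀ (dyadic T a) l ω
    have h6 : ‖((s : ℝ) - dyadic T a l) • β (dyadic T a l) x‖ ≤ T / 2 ^ a * C := by
      rw [norm_smul]
      rw [NNReal.dist_eq] at hd
      exact mul_le_mul hd (hβC _ (dyadic_mem_Icc T a l) x hRl) (norm_nonneg _) (by positivity)
    have h7 : ‖(A + B x) (W s ω - W (dyadic T a l) ω)‖ ≤ D * θ₁ := by
      refine ((A + B x).le_opNorm _).trans (mul_le_mul ?_ h4.le (norm_nonneg _) hD0)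
      refine (norm_add_le _ _).trans (add_le_add le_rfl ((B.le_opNorm _).trans ?_))
      gcongr
    have h8 := ha₄ a ((le_max_right _ _).trans ((le_max_right _ _).trans ha))
    refine (norm_add_le _ _).trans ?_
    have h9 := norm_add_le (((s : ℝ) - dyadic T a l) • β (dyadic T a l) x)
      ((A + B x) (W s ω - W (dyadic T a l) ω))
    linarith
  refine (measure_mono hsub).trans ((measure_union_le _ _).trans ((add_le_add
    (ha₁ a ((le_max_left _ _).trans ((le_max_left _ _).trans ha)))
    ((measure_union_le _ _).trans (add_le_add
      (ha₂ a ((le_max_right _ _).trans ((le_max_left _ _).trans ha)))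
      (ha₃ a ((le_max_left _ _).trans ((le_max_right _ _).trans ha)))))).trans (le_of_eq ?_)))
  rw [← ofNat_mul_ofReal_div 3 ε]
  ring

/-- The Euler scheme has a small defect on all refinements of its grid. -/
lemma exists_measure_eulerDefect_eulerScheme_le
    (hF : ∀ A : Set Ω, P A = 0 → MeasurableSet[F 0] A) (hW : IsQWiener F P Q W)
    (hQ : ∀ m, Q (f m) = q m • f m) (hq : ∀ m, 0 ≤ q m) (hq_sum : Summable q)
    (hβ : IsCoerciveDrift T β) (hZ : IsAdditiveNoise F P T cZ Z) (hcZ : 0 ≤ cZ)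
    (A : Hi →L[ℝ] Hd) (B : Hd →L[ℝ] Hi →L[ℝ] Hd) (x₀ : Hd) {δ ε : ℝ} (hδ : 0 < δ) (hε : 0 < ε) :
    ∃ a₀ : ℕ, ∀ a ≥ a₀, ∀ M ≥ a, P {ω | ∃ j ≤ 2 ^ M,
      δ ≤ ‖eulerDefect β A B W Z x₀ (dyadic T M)
        (eulerScheme β A B W Z x₀ (dyadic T a) (2 ^ a)) j ω‖} ≤ ENNReal.ofReal ε := by
  obtain ⟨R, hR, hreg⟩ := exists_measure_eulerScheme_irregular_le hF hW hQ hq hq_sum hβ hZ hcZ A B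
    x₀ (half_pos hε)
  have hτ : 0 ≤ ∑' m, q m := tsum_nonneg hq
  set θ' : ℝ := δ / (4 * (T + 1)) with hθ'
  have hT1 : (0 : ℝ) < T + 1 := by positivity
  have hθ'0 : 0 < θ' := by positivity
  have hTθ' : T * θ' < δ / 2 := by
    have : (T + 1) * θ' = δ / 4 := by rw [hθ']; field_simp
    nlinarith
  obtain ⟨δ₁, hδ₁, hβδ⟩ := hβ.exists_modulus (R + 1) hθ'0
  obtain ⟨θ, hθ, hθ1, hθδ, hθN⟩ : ∃ θ : ℝ, 0 < θ ∧ θ ≤ 1 ∧ θ ≤ δ₁ ∧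
      (T * ((∑' m, q m) * (‖B‖ * θ) ^ 2)) / (δ / 2) ^ 2 ≤ ε / 2 := by
    have hc : ContinuousAt (fun θ : ℝ => (T * ((∑' m, q m) * (‖B‖ * θ) ^ 2)) / (δ / 2) ^ 2) 0 := by
      fun_prop
    have h1 : ∀ᶠ θ in 𝓝[>] (0 : ℝ), (T * ((∑' m, q m) * (‖B‖ * θ) ^ 2)) / (δ / 2) ^ 2 < ε / 2 :=
      (hc.tendsto.mono_left nhdsWithin_le_nhds).eventually_lt_const (by simpa using half_pos hε)
    have h2 : ∀ᶠ θ in 𝓝[>] (0 : ℝ), θ ≤ min 1 δ₁ :=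
      (eventually_le_nhds (lt_min one_pos hδ₁)).filter_mono nhdsWithin_le_nhds
    obtain ⟨θ, ⟨h3, h4⟩, h5⟩ := ((h1.and h2).and self_mem_nhdsWithin).exists
    exact ⟨θ, h5, h4.trans (min_le_left _ _), h4.trans (min_le_right _ _), h3.le⟩
  obtain ⟨a₁, ha₁⟩ := hreg θ hθ
  obtain ⟨a₂, ha₂⟩ := exists_forall_div_two_pow_mul_le T 1 hδ₁
  refine ⟨max a₁ a₂, fun a ha M hM => ?_⟩
  obtain ⟨b, rfl⟩ := Nat.exists_eq_add_of_le hM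
  set X := eulerScheme β A B W Z x₀ (dyadic T a) (2 ^ a) with hX
  have hXm : ∀ t ≤ T, StronglyMeasurable[F t] (X t) := fun t ht =>
    stronglyMeasurable_eulerScheme hF hW hβ hZ A B x₀ a ht
  -- the bound for the accumulated norm of the integrand, where the oscillation is at most `θ`
  set N : ℝ := T * ((∑' m, q m) * (‖B‖ * θ) ^ 2) with hN
  have hlen := hW.measure_exists_le_norm_sum_apply_le hQ hq (dyadic_mono T (a + b))
    (Φ := fun i ω => B (X (dyadic T a (i / 2 ^ b)) ω - X (dyadic T (a + b) i) ω))
    (fun i => B.continuous.comp_stronglyMeasurable (((hXm _ (dyadic_le T a _)).mono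
      (F.mono (dyadic_div_le T a b i))).sub (hXm _ (dyadic_le T (a + b) i)))) (2 ^ (a + b))
    (N := N) (half_pos hδ)
  refine (measure_mono (t := {ω | ∃ l < 2 ^ a, ∃ s, dyadic T a l ≤ s ∧ s ≤ dyadic T a (l + 1) ∧
    (R < ‖X (dyadic T a l) ω‖ ∨ θ < ‖X (dyadic T a l) ω - X s ω‖)} ∪ _) ?_).trans
    ((measure_union_le _ _).trans ((add_le_add (ha₁ a ((le_max_left _ _).trans ha))
      (hlen.trans (ENNReal.ofReal_le_ofReal hθN))).trans (le_of_eq ?_)))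
  · rintro ω ⟨j, hj, hle⟩
    by_contra hcon
    rw [Set.mem_union, not_or] at hcon
    obtain ⟨h1, h2⟩ := hcon
    simp only [Set.mem_ofPred_eq, not_exists, not_and, not_or, not_lt, not_le] at h1 h2
    have hi : ∀ i < 2 ^ (a + b), ‖X (dyadic T a (i / 2 ^ b)) ω‖ ≤ R ∧
        ‖X (dyadic T a (i / 2 ^ b)) ω - X (dyadic T (a + b) i) ω‖ ≤ θ := fun i hi =>
      h1 _ (by rw [Nat.div_lt_iff_lt_mul (by positivity), ← pow_add]; exact hi) _
        (dyadic_div_le T a b i) (dyadic_le_div_succ T a b i)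
    have hstep : ∀ i, (0 : ℝ) ≤ (dyadic T (a + b) (i + 1) : ℝ) - dyadic T (a + b) i := fun i =>
      sub_nonneg.2 (by exact_mod_cast dyadic_mono T (a + b) (Nat.le_succ i))
    have hsum : ∀ j, ∑ i ∈ Finset.range j,
        ((dyadic T (a + b) (i + 1) : ℝ) - dyadic T (a + b) i) ≤ T := fun j => by
      rw [Finset.sum_range_sub (fun i => (dyadic T (a + b) i : ℝ))]
      simpa using (dyadic_mem_Icc T (a + b) j).2
    have hdrift : ‖∑ i ∈ Finset.range j,
        ((dyadic T (a + b) (i + 1) : ℝ) - dyadic T (a + b) i) •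
          (β (dyadic T a (i / 2 ^ b)) (X (dyadic T a (i / 2 ^ b)) ω) -
          β (dyadic T (a + b) i) (X (dyadic T (a + b) i) ω))‖ ≤ T * θ' := by
      refine (norm_sum_le _ _).trans ?_
      refine le_trans (Finset.sum_le_sum (g := fun i =>
        ((dyadic T (a + b) (i + 1) : ℝ) - dyadic T (a + b) i) * θ') fun i hij => ?_) ?_
      · obtain ⟨h3, h4⟩ := hi i ((Finset.mem_range.1 hij).trans_le hj)
        rw [norm_smul, Real.norm_of_nonneg (hstep i)]
        refine mul_le_mul_of_nonneg_left ?_ (hstep i)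
        refine hβδ _ (dyadic_mem_Icc T a _) _ (dyadic_mem_Icc T (a + b) i) _ _ (by linarith) ?_ ?_
          (h4.trans hθδ)
        · have := norm_sub_norm_le (X (dyadic T (a + b) i) ω) (X (dyadic T a (i / 2 ^ b)) ω)
          rw [norm_sub_rev] at this
          linarith
        · refine le_trans ?_ (by simpa using ha₂ a ((le_max_right _ _).trans ha))
          exact dist_le_of_mem_cell T le_rfl (dyadic_mono T a (Nat.le_succ _))
            (dyadic_div_le T a b i) (dyadic_le_div_succ T a b i)
      · rw [← Finset.sum_mul]
        exact mul_le_mul_of_nonneg_right (hsum j) hθ'0.le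
    have hmart : ‖∑ i ∈ Finset.range j, B (X (dyadic T a (i / 2 ^ b)) ω - X (dyadic T (a + b) i) ω)
        (W (dyadic T (a + b) (i + 1)) ω - W (dyadic T (a + b) i) ω)‖ < δ / 2 := by
      by_contra hge
      refine absurd (h2 ⟨j, hj, not_lt.1 hge⟩) (not_lt.2 ?_)
      refine le_trans (Finset.sum_le_sum (g := fun i => ENNReal.ofReal
        (((dyadic T (a + b) (i + 1) : ℝ) - dyadic T (a + b) i) *
          ((∑' m, q m) * (‖B‖ * θ) ^ 2))) fun i hij => ?_) ?_
      · rw [ENNReal.ofReal_mul (hstep i)]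
        refine mul_le_mul_right ((hsNormSq_le f hq hq_sum _).trans (ENNReal.ofReal_le_ofReal ?_)) _
        refine mul_le_mul_of_nonneg_left (pow_le_pow_left₀ (norm_nonneg _)
          ((B.le_opNorm _).trans ?_) 2) hτ
        exact mul_le_mul_of_nonneg_left (hi i (Finset.mem_range.1 hij)).2 (norm_nonneg _)
      · rw [← ENNReal.ofReal_sum_of_nonneg fun i _ => mul_nonneg (hstep i) (by positivity),
          ← Finset.sum_mul]
        exact ENNReal.ofReal_le_ofReal (mul_le_mul_of_nonneg_right (hsum _) (by positivity))
    refine absurd hle (not_le.2 ?_)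
    rw [hX, eulerDefect_eulerScheme T a b ω hj]
    exact (norm_add_le _ _).trans_lt (by linarith)
  · rw [← ENNReal.ofReal_add (half_pos hε).le (half_pos hε).le, add_halves]

end Tightness

/-! ### Convergence of the Euler scheme to a solution -/

section Existence

variable {Hd Hi Ω : Type*} [NormedAddCommGroup Hd] [InnerProductSpace ℝ Hd]
  [NormedAddCommGroup Hi] [InnerProductSpace ℝ Hi] {mΩ : MeasurableSpace Ω}
  {F : Filtration ℝ≥0 mΩ} {P : Measure Ω} [IsProbabilityMeasure P]
  {f : HilbertBasis ℕ ℝ Hi} {Q : Hi →L[ℝ] Hi} {q : ℕ → ℝ} {W : ℝ≥0 → Ω → Hi}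
  [MeasurableSpace Hi] [BorelSpace Hi] [FiniteDimensional ℝ Hd] [CompleteSpace Hi]
  {T : ℝ≥0} {β : ℝ → Hd → Hd} {Z : ℝ≥0 → Ω → Hd} {cZ : ℝ}

lemma ae_continuousOn_eulerScheme (hW : IsQWiener F P Q W) (hZ : IsAdditiveNoise F P T cZ Z)
    (A : Hi →L[ℝ] Hd) (B : Hd →L[ℝ] Hi →L[ℝ] Hd) (x₀ : Hd) (a : ℕ) :
    ∀ᵐ ω ∂P, ContinuousOn (fun t => eulerScheme β A B W Z x₀ (dyadic T a) (2 ^ a) t ω)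
      (Set.Iic T) := by
  filter_upwards [hW.cont, hZ.cont] with ω h1 h2 using continuousOn_eulerScheme h1 h2

/-- The Euler scheme along the dyadic grids is a Cauchy sequence in probability, uniformly on
`[0, T]`. -/
lemma exists_measure_eulerScheme_sub_le
    (hF : ∀ A : Set Ω, P A = 0 → MeasurableSet[F 0] A) (hW : IsQWiener F P Q W)
    (hQ : ∀ m, Q (f m) = q m • f m) (hq : ∀ m, 0 ≤ q m) (hq_sum : Summable q)
    (hβ : IsCoerciveDrift T β) (hZ : IsAdditiveNoise F P T cZ Z) (hcZ : 0 ≤ cZ)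
    (A : Hi →L[ℝ] Hd) (B : Hd →L[ℝ] Hi →L[ℝ] Hd) (x₀ : Hd) {ε : ℝ} (hε : 0 < ε) :
    ∃ K : ℕ, ∀ k ≥ K, ∀ l ≥ K, P {ω | ∃ t ≤ T,
      ε ≤ ‖eulerScheme β A B W Z x₀ (dyadic T k) (2 ^ k) t ω -
        eulerScheme β A B W Z x₀ (dyadic T l) (2 ^ l) t ω‖} ≤ ENNReal.ofReal ε := by
  have hε5 : 0 < ε / 5 := by positivity
  obtain ⟨R, hR, hreg⟩ := exists_measure_eulerScheme_irregular_le hF hW hQ hq hq_sum hβ hZ hcZ A B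
    x₀ hε5
  obtain ⟨a₁, ha₁⟩ := hreg 1 one_pos
  obtain ⟨L, hL, hLip⟩ := hβ.lipschitz (R + 1)
  obtain ⟨η, hη, hstab⟩ := exists_eulerDefect_bound (A := A) (B := B) (Z := Z) (x₀ := x₀) hW hQ hq
    hq_sum hβ.continuousOn hL hLip (half_pos hε) hε5
  obtain ⟨a₂, ha₂⟩ := exists_measure_eulerDefect_eulerScheme_le hF hW hQ hq hq_sum hβ hZ hcZ A B x₀
    hη hε5
  have hbound : ∀ a ≥ a₁, P {ω | ∃ t ≤ T,
      R + 1 < ‖eulerScheme β A B W Z x₀ (dyadic T a) (2 ^ a) t ω‖} ≤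
        ENNReal.ofReal (ε / 5) := by
    intro a ha
    refine (measure_mono ?_).trans (ha₁ a ha)
    rintro ω ⟨t, ht, hlt⟩
    obtain ⟨l, hl, h1, h2⟩ := exists_dyadic_cell T a ht
    refine ⟨l, hl, t, h1, h2, ?_⟩
    by_contra! hcon
    have := norm_sub_norm_le (eulerScheme β A B W Z x₀ (dyadic T a) (2 ^ a) t ω)
      (eulerScheme β A B W Z x₀ (dyadic T a) (2 ^ a) (dyadic T a l) ω)
    rw [norm_sub_rev] at this
    linarith [hcon.1, hcon.2]
  refine ⟨max a₁ a₂, fun k hk l hl => ?_⟩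
  rw [← ofNat_mul_ofReal_div 5 ε]
  refine (measure_mono ?_).trans (hstab _ _
    (fun t ht => stronglyMeasurable_eulerScheme hF hW hβ hZ A B x₀ k ht)
    (fun t ht => stronglyMeasurable_eulerScheme hF hW hβ hZ A B x₀ l ht)
    (ae_continuousOn_eulerScheme hW hZ A B x₀ k) (ae_continuousOn_eulerScheme hW hZ A B x₀ l)
    (hbound k ((le_max_left _ _).trans hk)) (hbound l ((le_max_left _ _).trans hl)) (max k l)
    (fun M hM => ha₂ k ((le_max_right _ _).trans hk) M ((le_max_left _ _).trans hM))
    (fun M hM => ha₂ l ((le_max_right _ _).trans hl) M ((le_max_right _ _).trans hM)))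
  exact fun ω ⟨t, ht, hle⟩ => ⟨t, ht, (half_lt_self hε).trans_le hle⟩

/-- Existence: the equation `dX = β(t, X) dt + (A + B(X)) dW + dZ`, `X 0 = x₀ + Z 0`, has a solution
on `[0, T]`, which is measurable with respect to any family of σ-algebras to which `W` and `Z` are
adapted. -/
lemma exists_solution_of_isCoerciveDrift
    (hF : ∀ A : Set Ω, P A = 0 → MeasurableSet[F 0] A) (hW : IsQWiener F P Q W)
    (hQ : ∀ m, Q (f m) = q m • f m) (hq : ∀ m, 0 ≤ q m) (hq_sum : Summable q)
    (hβ : IsCoerciveDrift T β) (hZ : IsAdditiveNoise F P T cZ Z) (hcZ : 0 ≤ cZ)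
    (A : Hi →L[ℝ] Hd) (B : Hd →L[ℝ] Hi →L[ℝ] Hd) (x₀ : Hd)
    {m : ℝ≥0 → MeasurableSpace Ω} (hm : Monotone m)
    (hWm : ∀ t ≤ T, AEStronglyMeasurable[m t] (W t) P)
    (hZm : ∀ t ≤ T, AEStronglyMeasurable[m t] (Z t) P) :
    ∃ X I : ℝ≥0 → Ω → Hd, (∀ t ≤ T, StronglyMeasurable[F t] (X t)) ∧
      (∀ t ≤ T, AEStronglyMeasurable[m t] (X t) P) ∧
      (∀ᵐ ω ∂P, ContinuousOn (fun t => X t ω) (Set.Iic T)) ∧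
      IsItoIntegral F P f q W T (fun s ω => B (X s ω)) I ∧
      ∀ ω, ∀ t ≤ T, X t ω = x₀ + (∫ s in (0 : ℝ)..t, β s (X s.toNNReal ω))
        + A (W t ω) + I t ω + Z t ω := by
  have hτ : 0 ≤ ∑' m, q m := tsum_nonneg hq
  set Y : ℕ → ℝ≥0 → Ω → Hd := fun a => eulerScheme β A B W Z x₀ (dyadic T a) (2 ^ a) with hY
  have hYm : ∀ a, ∀ t ≤ T, StronglyMeasurable[F t] (Y a t) := fun a t ht =>
    stronglyMeasurable_eulerScheme hF hW hβ hZ A B x₀ a ht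
  obtain ⟨X, φ, hφ, hXu, hXp⟩ := exists_tendsto_of_cauchy_in_measure (P := P) T Y fun ε hε =>
    exists_measure_eulerScheme_sub_le hF hW hQ hq hq_sum hβ hZ hcZ A B x₀ hε
  have hXlim : ∀ t ≤ T, ∀ᵐ ω ∂P, Tendsto (fun k => Y (φ k) t ω) atTop (𝓝 (X t ω)) := fun t ht => by
    filter_upwards [hXu] with ω hω using hω.tendsto_at ht
  have hXae : ∀ m' : ℝ≥0 → MeasurableSpace Ω, Monotone m' →
      (∀ t ≤ T, AEStronglyMeasurable[m' t] (W t) P) →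
      (∀ t ≤ T, AEStronglyMeasurable[m' t] (Z t) P) →
      ∀ t ≤ T, AEStronglyMeasurable[m' t] (X t) P := fun m' hm' h1 h2 t ht =>
    aestronglyMeasurable_of_tendsto (fun k => aestronglyMeasurable_eulerScheme hm'
      (dyadic_mono T (φ k)) (dyadic_le T (φ k)) (fun _ ht => hβ.continuous ht) h1 h2 _ ht)
      (hXlim t ht)
  have hXm : ∀ t ≤ T, StronglyMeasurable[F t] (X t) := fun t ht =>
    stronglyMeasurable_of_aestronglyMeasurable (P := P) (fun A hA => F.mono zero_le _ (hF A hA))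
      (hXae F F.mono' (fun t _ => (hW.adapted t).aestronglyMeasurable)
        (fun t ht => (hZ.adapted t ht).aestronglyMeasurable) t ht)
  have hXc : ∀ᵐ ω ∂P, ContinuousOn (fun t => X t ω) (Set.Iic T) := by
    filter_upwards [hXu, hW.cont, hZ.cont] with ω h1 h2 h3
    exact h1.continuousOn (.of_forall fun k => continuousOn_eulerScheme h2 h3)
  -- the stochastic integral is defined by the equation, and shown to be the Itô integral of `B (X)`
  set I : ℝ≥0 → Ω → Hd := fun t ω => X t ω - (x₀ + (∫ s in (0 : ℝ)..t, β s (X s.toNNReal ω))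
    + A (W t ω) + Z t ω) with hI
  refine ⟨X, I, hXm, hXae m hm hWm hZm, hXc, ?_, fun ω t _ => by simp only [hI]; abel⟩
  -- with high probability, the scheme stays close to `X` between its grid points
  have hclose : ∀ ε : ℝ, 0 < ε → ∃ R : ℝ, 0 < R ∧ ∀ θ : ℝ, 0 < θ → ∃ a₀ : ℕ, ∀ a ≥ a₀,
      ∃ E : Set Ω, P E ≤ ENNReal.ofReal ε ∧ ∀ ω ∉ E,
        (∀ t ≤ T, ‖Y a t ω‖ ≤ R + 1) ∧ (∀ t ≤ T, ‖X t ω‖ ≤ R + 2) ∧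
        (∀ t ≤ T, ‖Y a t ω - X t ω‖ ≤ θ) ∧
        ∀ l < 2 ^ a, ∀ s, dyadic T a l ≤ s → s ≤ dyadic T a (l + 1) →
          ‖Y a (dyadic T a l) ω - X s ω‖ ≤ 2 * θ := by
    intro ε hε
    obtain ⟨R, hR, hreg⟩ := exists_measure_eulerScheme_irregular_le hF hW hQ hq hq_sum hβ hZ hcZ
      A B x₀ (half_pos hε)
    refine ⟨R, hR, fun θ hθ => ?_⟩
    have hθ1 : 0 < min θ 1 := lt_min hθ one_pos
    obtain ⟨a₁, ha₁⟩ := hreg (min θ 1) hθ1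
    obtain ⟨a₂, ha₂⟩ := eventually_atTop.1 ((hXp (min θ 1) hθ1).eventually_le_const
      (ENNReal.ofReal_pos.2 (half_pos hε)))
    refine ⟨max a₁ a₂, fun a ha => ⟨_, (measure_union_le _ _).trans ((add_le_add
      (ha₁ a ((le_max_left _ _).trans ha)) (ha₂ a ((le_max_right _ _).trans ha))).trans
      (le_of_eq ?_)), fun ω hω => ?_⟩⟩
    · rw [← ENNReal.ofReal_add (half_pos hε).le (half_pos hε).le, add_halves]
    · rw [Set.mem_union, not_or] at hω
      obtain ⟨h1, h2⟩ := hω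
      simp only [Set.mem_ofPred_eq, not_exists, not_and, not_or, not_lt, not_le] at h1 h2
      have hmθ := min_le_left θ 1
      have hm1 := min_le_right θ 1
      have h3 : ∀ t ≤ T, ‖Y a t ω‖ ≤ R + 1 := fun t ht => by
        obtain ⟨l, hl, h4, h5⟩ := exists_dyadic_cell T a ht
        obtain ⟨h6, h7⟩ := h1 l hl t h4 h5
        have := norm_sub_norm_le (Y a t ω) (Y a (dyadic T a l) ω)
        rw [norm_sub_rev] at this
        linarith
      refine ⟨h3, fun t ht => ?_, fun t ht => ((h2 t ht).le.trans hmθ), fun l hl s hs hs' => ?_⟩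
      · have := norm_sub_norm_le (X t ω) (Y a t ω)
        rw [norm_sub_rev] at this
        linarith [h2 t ht, h3 t ht]
      · have h4 := norm_sub_le_norm_sub_add_norm_sub (Y a (dyadic T a l) ω) (Y a s ω) (X s ω)
        linarith [(h1 l hl s hs hs').2, h2 s (hs'.trans (dyadic_le T a _))]
  -- reduction to small exceptional events
  have htend : ∀ E : ℕ → Set Ω, (∀ ε : ℝ, 0 < ε → ∃ a₀, ∀ a ≥ a₀, P (E a) ≤ ENNReal.ofReal ε) →
      Tendsto (fun a => P (E a)) atTop (𝓝 0) := by
    intro E hE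
    refine ENNReal.tendsto_nhds_zero.2 fun ε hε => ?_
    obtain ⟨r, hr, hrε⟩ := ENNReal.lt_iff_exists_nnreal_btwn.1 hε
    obtain ⟨a₀, ha₀⟩ := hE r (by exact_mod_cast hr)
    refine eventually_atTop.2 ⟨a₀, fun a ha => (ha₀ a ha).trans ?_⟩
    rw [ENNReal.ofReal_coe_nnreal]
    exact hrε.le
  -- the cut-off at level `a` is not active with high probability, as the schemes are bounded
  refine ⟨fun a => riemannIntegrand B T a a (hYm a), fun δ hδ => htend _ fun ε hε => ?_,
    fun δ hδ => htend _ fun ε hε => ?_⟩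
  · obtain ⟨R, hR, hR'⟩ := hclose ε hε
    obtain ⟨θ, hθ, hθδ⟩ : ∃ θ : ℝ, 0 < θ ∧
        ENNReal.ofReal ((∑' m, q m) * (‖B‖ * (2 * θ)) ^ 2 * T) < δ := by
      have hc : Continuous fun θ : ℝ =>
          ENNReal.ofReal ((∑' m, q m) * (‖B‖ * (2 * θ)) ^ 2 * T) :=
        ENNReal.continuous_ofReal.comp (by fun_prop)
      have h1 := ((hc.tendsto 0).mono_left
        (nhdsWithin_le_nhds (s := Set.Ioi (0 : ℝ)))).eventually_lt_const (u := δ) (by simpa using hδ)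
      obtain ⟨θ, h2, h3⟩ := (h1.and self_mem_nhdsWithin).exists
      exact ⟨θ, h3, h2⟩
    obtain ⟨a₀, ha₀⟩ := hR' θ hθ
    refine ⟨max a₀ ⌈R + 1⌉₊, fun a ha => ?_⟩
    obtain ⟨E, hE, hEω⟩ := ha₀ a ((le_max_left _ _).trans ha)
    refine (measure_mono fun ω hω => ?_).trans hE
    by_contra hcon
    obtain ⟨h1, -, -, h4⟩ := hEω ω hcon
    have ha' : R + 1 ≤ a := (Nat.le_ceil _).trans (by exact_mod_cast (le_max_right _ _).trans ha)
    refine absurd (show δ ≤ _ from hω) (not_le.2 (lt_of_le_of_lt ?_ hθδ))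
    rw [← setLIntegral_congr (Ioc_ae_eq_Icc (a := (0 : ℝ)) (b := T))]
    refine (setLIntegral_mono' measurableSet_Ioc fun s hs => hsNormSq_riemann_sub_le
      (Y := fun s => X s ω) hq hq_sum (fun t ht => (h1 t ht).trans ha') h4 hs).trans ?_
    rw [setLIntegral_const, Real.volume_Ioc, sub_zero, ← ENNReal.ofReal_mul (by positivity)]
  · obtain ⟨R, hR, hR'⟩ := hclose ε hε
    set θ' : ℝ := δ / (4 * (T + 1)) with hθ'
    have hT1 : (0 : ℝ) < T + 1 := by positivity
    have hθ'0 : 0 < θ' := by positivity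
    have hTθ' : T * θ' < δ / 2 := by
      have : (T + 1) * θ' = δ / 4 := by rw [hθ']; field_simp
      nlinarith
    obtain ⟨δ₁, hδ₁, hβδ⟩ := hβ.exists_modulus (R + 2) hθ'0
    set θ := min (δ / 4) (δ₁ / 2) with hθ
    have hθ0 : 0 < θ := lt_min (by positivity) (by positivity)
    have hθδ : θ ≤ δ / 4 := min_le_left _ _
    have hθδ₁ : θ ≤ δ₁ / 2 := min_le_right _ _
    obtain ⟨a₀, ha₀⟩ := hR' θ hθ0
    obtain ⟨a₁, ha₁⟩ := exists_forall_div_two_pow_mul_le T 1 hδ₁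
    refine ⟨max a₀ (max a₁ ⌈R + 1⌉₊), fun a ha => ?_⟩
    have ha1 := ha₁ a ((le_max_left _ _).trans ((le_max_right _ _).trans ha))
    rw [mul_one] at ha1
    obtain ⟨E, hE, hEω⟩ := ha₀ a ((le_max_left _ _).trans ha)
    refine (measure_le_of_ae_imp ?_).trans hE
    filter_upwards [hXc, hW.zero] with ω hXω hW0 ⟨t, ht, hle⟩
    by_contra hcon
    obtain ⟨h1, h2, h3, h4⟩ := hEω ω hcon
    have ha' : R + 1 ≤ a := (Nat.le_ceil _).trans
      (by exact_mod_cast (le_max_right _ _).trans ((le_max_right _ _).trans ha))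
    rw [riemannIntegrand_integral (fun t ht => (h1 t ht).trans ha')] at hle
    have hnode : ∀ l ∈ Finset.range (2 ^ a), Y a (dyadic T a l) ω =
        eulerNode β A B W Z x₀ (dyadic T a) l ω := fun l hl =>
      eulerScheme_node (dyadic_mono T a) ω (Finset.mem_range.1 hl).le
    have hint := norm_integral_sub_sum_le T (a := a) (continuousOn_comp_toNNReal hβ.continuousOn hXω)
      (v := fun l => β (dyadic T a l) (Y a (dyadic T a l) ω)) hθ'0.le (fun l hl s hs hs' => by
        have hs0 : 0 ≤ s := (NNReal.coe_nonneg _).trans hs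
        lift s to ℝ≥0 using hs0
        simp only [Real.toNNReal_coe]
        have hs1 : dyadic T a l ≤ s := by exact_mod_cast hs
        have hs2 : s ≤ dyadic T a (l + 1) := by exact_mod_cast hs'
        have hsT := hs2.trans (dyadic_le T a _)
        refine hβδ _ ⟨s.2, by exact_mod_cast hsT⟩ _ (dyadic_mem_Icc T a l) _ _ (h2 s hsT)
          ((h1 _ (dyadic_le T a l)).trans (by linarith)) ?_ ?_
        · exact (dist_le_of_mem_cell T hs1 hs2 le_rfl (dyadic_mono T a (Nat.le_succ l))).trans ha1
        · rw [norm_sub_rev]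
          exact (h4 l hl s hs1 hs2).trans (by linarith)) ht
    have hYeq : Y a t ω = x₀ + Z t ω + ∑ l ∈ Finset.range (2 ^ a),
        (((min (dyadic T a (l + 1)) t : ℝ≥0) : ℝ) - (min (dyadic T a l) t : ℝ≥0)) •
          β (dyadic T a l) (Y a (dyadic T a l) ω) + A (W t ω) +
        ∑ l ∈ Finset.range (2 ^ a), B (Y a (dyadic T a l) ω)
          (W (min (dyadic T a (l + 1)) t) ω - W (min (dyadic T a l) t) ω) := by
      refine (eulerScheme_eq ω (2 ^ a) t).trans ?_
      rw [dyadic_two_pow, min_eq_right ht, dyadic_zero, min_eq_left zero_le, hW0, sub_zero]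
      congr 1
      · congr 2
        exact Finset.sum_congr rfl fun l hl => by rw [hnode l hl]
      · exact Finset.sum_congr rfl fun l hl => by rw [hnode l hl]
    set S₁ := ∑ l ∈ Finset.range (2 ^ a),
        (((min (dyadic T a (l + 1)) t : ℝ≥0) : ℝ) - (min (dyadic T a l) t : ℝ≥0)) •
          β (dyadic T a l) (Y a (dyadic T a l) ω)
    set S₂ := ∑ l ∈ Finset.range (2 ^ a), B (Y a (dyadic T a l) ω)
          (W (min (dyadic T a (l + 1)) t) ω - W (min (dyadic T a l) t) ω)
    have hdiff : S₂ - I t ω = (Y a t ω - X t ω) +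
        ((∫ s in (0 : ℝ)..t, β s (X s.toNNReal ω)) - S₁) := by
      simp only [hI]
      rw [hYeq]
      abel
    refine absurd hle (not_le.2 ?_)
    rw [hdiff]
    exact (norm_add_le _ _).trans_lt (by linarith [h3 t ht])

end Existence

/-! ### The climate equation -/

section ClimateEquation

variable {Hd Hi Ω : Type*} [NormedAddCommGroup Hd] [InnerProductSpace ℝ Hd]
  [NormedAddCommGroup Hi] [InnerProductSpace ℝ Hi] {mΩ : MeasurableSpace Ω}

lemma isCoerciveDrift_drift [CompleteSpace Hd] [CompleteSpace Hi] {d : ℕ} {T : ℝ≥0}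
    (c : Coefficients Hd Hi) (e : OrthonormalBasis (Fin d) ℝ Hd) (f : HilbertBasis ℕ ℝ Hi)
    {q : ℕ → ℝ} (hq : ∀ m, 0 ≤ q m) (hq_sum : Summable q)
    (hF1 : ContinuousOn c.F1 (Set.Icc 0 (T : ℝ)))
    (hC1 : c.A21 = ContinuousLinearMap.adjoint c.A12)
    (hC2 : ∀ x x' : Hd, ⟪c.B111 x' x, x⟫ = 0)
    (hC3 : ∀ (x x' : Hd) (y : Hi), ⟪c.B112 x' y, x⟫ = -⟪c.B211 x' x, y⟫) :
    IsCoerciveDrift T (drift c e f q) where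
  continuousOn := by
    have h : Function.uncurry (drift c e f q) = fun p : ℝ × Hd => c.F1 p.1 + stateDrift c e f q p.2 :=
      funext fun p => drift_eq c e f p.1 p.2
    rw [h]
    exact (hF1.comp continuousOn_fst fun p hp => hp.1).add
      ((contDiff_stateDrift c e f hq hq_sum).continuous.comp continuous_snd).continuousOn
  lipschitz R := by
    obtain ⟨L, hL, h⟩ := exists_lipschitz_stateDrift c e f hq hq_sum R
    refine ⟨L, hL, fun s _ x y hx hy => ?_⟩
    rw [drift_eq, drift_eq, add_sub_add_left_eq_sub]
    exact h x y hx hy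
  coercive := by
    obtain ⟨M, hM⟩ := isCompact_Icc.exists_bound_of_continuousOn hF1
    obtain ⟨κ, hκ, h⟩ := exists_coercive c e f hq hq_sum hC1 hC2 hC3 M
    refine ⟨κ, hκ, fun s hs x => ?_⟩
    rw [drift_eq]
    exact h x _ (hM s hs)

variable {F : Filtration ℝ≥0 mΩ} {P : Measure Ω} [IsProbabilityMeasure P]
  {Q : Hi →L[ℝ] Hi} {W : ℝ≥0 → Ω → Hi} {Wb : ℕ × ℕ → ℝ≥0 → Ω → ℝ}
  [MeasurableSpace Hi]

lemma noiseSigma_mono : Monotone (noiseSigma W Wb) := fun _ _ hst =>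
  biSup_mono fun _ hr => le_trans (Set.mem_Iic.1 hr) hst

lemma comap_le_noiseSigma (t : ℝ≥0) :
    MeasurableSpace.comap (W t) inferInstance ≤ noiseSigma W Wb t :=
  le_trans le_sup_left (le_iSup₂_of_le (f := fun s (_ : s ∈ Set.Iic t) =>
    (MeasurableSpace.comap (W s) inferInstance ⊔
      ⨆ i, MeasurableSpace.comap (Wb i s) inferInstance)) t (Set.mem_Iic.2 le_rfl) le_rfl)

variable [BorelSpace Hi]

lemma IsNoise.noiseSigma_le (hW : IsNoise F P Q W Wb) (t : ℝ≥0) : noiseSigma W Wb t ≤ F t := by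
  refine iSup₂_le fun s hs => sup_le ?_ (iSup_le fun i => ?_)
  · exact ((hW.wiener.adapted s).mono (F.mono hs)).measurable.comap_le
  · exact ((hW.adapted i s).mono (F.mono hs)).measurable.comap_le

/-- Mean square limits are unique up to null sets. -/
lemma ae_eq_of_tendsto_eLpNorm {E : Type*} [NormedAddCommGroup E] {ι : Type*} {l : Filter ι}
    [l.NeBot] {u : ι → Ω → E} (hu : ∀ i, AEStronglyMeasurable (u i) P) {z z' : Ω → E}
    (hz : AEStronglyMeasurable z P) (hz' : AEStronglyMeasurable z' P)
    (h : Tendsto (fun i => eLpNorm (fun ω => u i ω - z ω) 2 P) l (𝓝 0))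
    (h' : Tendsto (fun i => eLpNorm (fun ω => u i ω - z' ω) 2 P) l (𝓝 0)) : z =ᵐ[P] z' := by
  have h0 : eLpNorm (z - z') 2 P = 0 := by
    refine le_antisymm (ge_of_tendsto (by simpa using h'.add h) (.of_forall fun i => ?_)) zero_le
    have : z - z' = (fun ω => u i ω - z' ω) - (fun ω => u i ω - z ω) := by
      funext ω; simp
    rw [this]
    exact eLpNorm_sub_le ((hu i).sub hz') ((hu i).sub hz) (by norm_num)
  have := (eLpNorm_eq_zero_iff (hz.sub hz') (by norm_num)).1 h0
  filter_upwards [this] with ω hω using sub_eq_zero.1 hω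

end ClimateEquation

end Climate

open Climate in
theorem proposition5p1
    {Hd Hi : Type*}
    [NormedAddCommGroup Hd] [InnerProductSpace ℝ Hd] [CompleteSpace Hd]
    [NormedAddCommGroup Hi] [InnerProductSpace ℝ Hi] [CompleteSpace Hi]
    [MeasurableSpace Hi] [BorelSpace Hi]
    {d : ℕ} (e : OrthonormalBasis (Fin d) ℝ Hd) (f : HilbertBasis ℕ ℝ Hi)
    -- the trace class covariance operator, diagonal in the basis `f`
    (Q : Hi →L[ℝ] Hi) (q : ℕ → ℝ) (hQ : ∀ m, Q (f m) = q m • f m)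
    (hq : ∀ m, 0 ≤ q m) (hq_sum : Summable q)
    -- the coefficients of the model
    (T : ℝ≥0) (c : Climate.Coefficients Hd Hi)
    (hF1 : ContinuousOn c.F1 (Set.Icc 0 (T : ℝ)))
    (hC1 : c.A21 = ContinuousLinearMap.adjoint c.A12)
    (hC2 : ∀ x x' : Hd, ⟪c.B111 x' x, x⟫ = 0)
    (hC3 : ∀ (x x' : Hd) (y : Hi), ⟪c.B112 x' y, x⟫ = -⟪c.B211 x' x, y⟫)
    (x₀ : Hd)
    -- a complete filtered probability space carrying the driving noise
    {Ω : Type*} {mΩ : MeasurableSpace Ω} (P : Measure Ω) [IsProbabilityMeasure P]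
    (F : Filtration ℝ≥0 mΩ) (hF : ∀ A : Set Ω, P A = 0 → MeasurableSet[F 0] A)
    (W : ℝ≥0 → Ω → Hi) (Wb : ℕ × ℕ → ℝ≥0 → Ω → ℝ)
    (hW : Climate.IsNoise F P Q W Wb) :
    -- existence of a global solution that is adapted to the completed noise filtration
    (∃ X : ℝ≥0 → Ω → Hd, Climate.IsSolution c e f q F P W Wb T x₀ X ∧
      ∀ t ≤ T, AEStronglyMeasurable[Climate.noiseSigma W Wb t] (X t) P) ∧
    -- pathwise uniqueness
    (∀ X Y : ℝ≥0 → Ω → Hd, Climate.IsSolution c e f q F P W Wb T x₀ X →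
      Climate.IsSolution c e f q F P W Wb T x₀ Y →
      ∀ᵐ ω ∂P, ∀ t ≤ T, X t ω = Y t ω) := by
  have : FiniteDimensional ℝ Hd := e.toBasis.finiteDimensional_of_finite
  have hβ : IsCoerciveDrift T (drift c e f q) :=
    isCoerciveDrift_drift c e f hq hq_sum hF1 hC1 hC2 hC3
  have hb := summable_normSq_bvec c e f hq hq_sum
  have hpm : ∀ N t, AEStronglyMeasurable (partialNoise Wb (bvec c e f q) N t) P := fun N t =>
    ((hW.stronglyMeasurable_partialNoise _ N t).mono (F.le t)).aestronglyMeasurable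
  refine ⟨?_, ?_⟩
  · obtain ⟨Z, hZm, hZc, hZlim⟩ := hW.exists_additiveNoise hb T
    have hZF : ∀ t ≤ T, StronglyMeasurable[F t] (Z t) := fun t ht =>
      stronglyMeasurable_of_aestronglyMeasurable (P := P)
        (fun A hA => F.mono zero_le _ (hF A hA)) ((hZm t ht).mono (hW.noiseSigma_le t))
    have hZP : ∀ t ≤ T, AEStronglyMeasurable (Z t) P := fun t ht =>
      ((hZF t ht).mono (F.le t)).aestronglyMeasurable
    have hZ0 : Z 0 =ᵐ[P] 0 := by
      refine ae_eq_of_tendsto_eLpNorm (fun N => hpm N 0) (hZP 0 zero_le)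
        aestronglyMeasurable_zero (hZlim 0 zero_le) (tendsto_const_nhds.congr fun N => ?_)
      refine (eLpNorm_eq_zero_of_ae_zero ?_).symm
      filter_upwards [hW.partialNoise_zero (bvec c e f q)] with ω hω
      simp [hω N]
    have hZ : IsAdditiveNoise F P T (∑' p, ‖bvec c e f q p‖ ^ 2) Z :=
      ⟨hZF, hZc, MemLp.zero.ae_eq hZ0.symm,
        fun s t hst ht => hW.additiveNoise_increment hb hZP hZlim hst ht⟩
    have := secondCountableTopology_of_hilbertBasis f
    obtain ⟨X, I, hX, hXm, hXc, hI, hXeq⟩ := exists_solution_of_isCoerciveDrift hF hW.wiener hQ hq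
      hq_sum hβ hZ (tsum_nonneg fun _ => by positivity) c.A12 c.B112 x₀
      (m := noiseSigma W Wb) noiseSigma_mono (fun t _ =>
        (Measurable.of_comap_le (comap_le_noiseSigma t)).stronglyMeasurable.aestronglyMeasurable) hZm
    exact ⟨X, ⟨hX, hXc, I, Z, hI, hZP, hZlim, ae_of_all _ hXeq⟩, hXm⟩
  · rintro X Y ⟨hX, hXc, I, Z, hI, hZm, hZlim, hXeq⟩ ⟨hY, hYc, J, Z', hJ, hZm', hZlim', hYeq⟩
    exact ae_forall_eq_of_equation hW.wiener hQ hq hq_sum hβ.continuousOn hβ.lipschitz hX hXc hI hXeq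
      hY hYc hJ hYeq fun t ht =>
        ae_eq_of_tendsto_eLpNorm (fun N => hpm N t) (hZm t ht) (hZm' t ht) (hZlim t ht) (hZlim' t ht)
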